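/- **Setting.** Let $H$ be a separable complex Hilbert space, $A_0$ a self-adjoint operator in $H$ with domain $\operatorname{dom}A_0$, $d\ge 3$ odd, $r\in\mathbb N$, and let $c^1,\dots,c^d\in\mathbb C^{r\times r}$ be skew-Hermitian matrices with $c^ic^j+c^jc^i=-2\delta_{ij}1$. For an operator $T$ and $z\in\mathbb C\setminus(-\infty,0]$ put $\langle T\rangle_z=(T^*T+z)^{1/2}$ (principal branch) and $\langle T\rangle=\langle T\rangle_1$. In $L^2(\mathbb R^d,\mathbb C^r\otimes H)$ consider the Dirac operator $\not\partial=\sum_i c^i\partial_i$ with domain $H^1(\mathbb R^d,\mathbb C^r\otimes H)$, the Laplacian $\Delta=-\sum_i\partial_i^2$ with domain $H^2(\mathbb R^d,\mathbb C^r\otimes H)$, the multiplication operator $(M_0f)(x)=A_0f(x)$ with domain $L^2(\mathbb R^d,\mathbb C^r\otimes\operatorname{dom}A_0)$ (graph norm on $\operatorname{dom} A_0$), and $$D_0=i\!\not\partial+M_0,\quad \operatorname{dom}D_0=\operatorname{dom}\not\partial\cap\operatorname{dom}M_0,\qquad H_0=\Delta+M_0^2,\quad \operatorname{dom}H_0=H^2(\mathbb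 R^d,\mathbb C^r\otimes H)\cap\operatorname{dom}M_0^2 .$$ Let $B=(B(x))_{x\in\mathbb R^d}$ be a family of symmetric operators in $H$, all with domain $\operatorname{dom}A_0$, such that $B\in W^{1,\infty}(\mathbb R^d,A_0,1)$, i.e. for every $\beta\in[-1,1]$ the operators $\langle A_0\rangle^{\beta}B(x)\langle A_0\rangle^{-1-\beta}$, $x\in\mathbb R^d$, are closable with closure a bounded operator on all of $H$, and these closures form a family in $W^{1,\infty}(\mathbb R^d,B(H))$, where $B(H)$ carries the strong operator topology (strongly measurable, essentially bounded in operator norm, with weak first partial derivatives, taken after applying the family to vectors of $H$, of the same kind). For $z\in\mathbb C\setminus(-\infty,0]$ let $$\rho_z(B)=\operatorname*{ess\,sup}_{x}\big\|B(x)\langle A_0\rangle_z^{-1}\big\|+\operatorname*{ess\,sup}_{x}\big\|\langle A_0\rangle B(x)\langle A_0\rangle^{-1}\langle A_0\rangle_z^{-1}\big\|+\sum_{i=1}^d\operatorname*{ess\,sup}_{x}\big\|\big(\partial_i(B\langle A_0\rangle^{-1})\big)(x)\,\langle A_0\rangle_z^{-1}\big\| ,$$ and assume $\rho_z(B)\to0$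 as $\operatorname{dist}(z,(-\infty,0])\to\infty$. Define $$D_B=i\!\not\partial+B+M_0\ \text{ on }\operatorname{dom}D_0,\qquad H_B=\Delta+(B+M_0)^2\ \text{ on }\operatorname{dom}H_0,$$ where $B$ also denotes the multiplication operator $(Bf)(x)=B(x)f(x)$. **Proposition.** $D_B$ is a well-defined, densely defined, closed operator on $\operatorname{dom}D_0$, and its adjoint is $$D_B^*=-i\!\not\partial+B+M_0,\qquad \operatorname{dom}D_B^*=\operatorname{dom}D_0 .$$ Moreover $D_BD_B^*$ and $D_B^*D_B$ (on their natural domains) and $H_B$ are non-negative and self-adjoint, each with domain exactly $\operatorname{dom}H_0$. -/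

import Mathlib

open MeasureTheory Filter Topology
open scoped ENNReal ContDiff LinearPMap

noncomputable section

namespace DiracSchrodinger

/-! ### Unbounded operators in a Hilbert space -/

section Unbounded

variable {E : Type*} [NormedAddCommGroup E] [InnerProductSpace ℂ E]

/-- The composition `S T` of unbounded operators on its natural domain
`{u ∈ dom T | T u ∈ dom S}`. -/
def opMul (S T : E →ₗ.[ℂ] E) : E →ₗ.[ℂ] E where
  domain := (S.domain.comap T.toFun).map T.domain.subtype
  toFun :=
    { toFun := fun u => S ⟨T ⟨u, by
          obtain ⟨v, -, hv⟩ := u.2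
          exact hv ▸ v.2⟩, by
          obtain ⟨v, hv, hvu⟩ := u.2
          have h : (⟨u, hvu ▸ v.2⟩ : T.domain) = v := Subtype.ext hvu.symm
          rw [h]
          exact hv⟩
      map_add' := fun u v => by
        rw [← LinearPMap.map_add]
        congr 1
        apply Subtype.ext
        exact T.map_add ⟨u, _⟩ ⟨v, _⟩
      map_smul' := fun c u => by
        rw [RingHom.id_apply, ← LinearPMap.map_smul]
        congr 1
        apply Subtype.ext
        exact T.map_smul c ⟨u, _⟩ }

/-- The everywhere defined operator given by a bounded operator. -/
def ofBdd (S : E →L[ℂ] E) : E →ₗ.[ℂ] E := (S : E →ₗ[ℂ] E).toPMap ⊤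

/-- `T` is closable and its closure is a bounded operator, defined on the whole space. -/
def HasBddClosure (T : E →ₗ.[ℂ] E) : Prop :=
  T.IsClosable ∧ ∃ S : E →L[ℂ] E, T.closure = ofBdd S

open Classical in
/-- The closure of `T` as a bounded operator (`0` if `T` has no bounded closure). -/
def bddClosure (T : E →ₗ.[ℂ] E) : E →L[ℂ] E :=
  if h : HasBddClosure T then h.2.choose else 0

/-- The operator norm `sup ‖T u‖ / ‖u‖` over `0 ≠ u ∈ dom T`, which is `∞` if `T` is unbounded. -/
def opENorm (T : E →ₗ.[ℂ] E) : ℝ≥0∞ := ⨆ u : T.domain, ‖T u‖ₑ / ‖(u : E)‖ₑ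

/-- `T` is non-negative: `⟨u, T u⟩ ≥ 0` on `dom T`. (For symmetric `T` this number is real.) -/
def IsNonneg (T : E →ₗ.[ℂ] E) : Prop := ∀ u : T.domain, 0 ≤ (inner ℂ (u : E) (T u)).re

variable [CompleteSpace E]

/-- `(T* T + 1)⁻¹` as a bounded operator. -/
def sqResolvent (T : E →ₗ.[ℂ] E) : E →L[ℂ] E :=
  bddClosure (opMul T† T + ofBdd 1).inverse

/-- `⟨T⟩_z ^ (-γ) = (T* T + z) ^ (-γ / 2)` for `γ ≥ 0` and `z ∈ ℂ \ (-∞, 0]`, principal branch.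
With `s = 1 / (λ ^ 2 + 1)` one has `s / ((1 - s) + z s) = 1 / (λ ^ 2 + z)`, so this is the
continuous functional calculus of `(T* T + 1)⁻¹`, whose spectrum is contained in `[0, 1]`. -/
def bracketNeg (T : E →ₗ.[ℂ] E) (z : ℂ) (γ : ℝ) : E →L[ℂ] E :=
  cfc (fun s : ℂ => (s / ((1 - s) + z * s)) ^ ((γ / 2 : ℝ) : ℂ)) (sqResolvent T)

/-- `⟨T⟩ ^ β = (T* T + 1) ^ (β / 2)` for real `β`, on its natural domain. -/
def bracketPow (T : E →ₗ.[ℂ] E) (β : ℝ) : E →ₗ.[ℂ] E :=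
  if β ≤ 0 then ofBdd (bracketNeg T 1 (-β)) else (ofBdd (bracketNeg T 1 β)).inverse

end Unbounded

/-! ### Operator valued functions on `ℝ^d` -/

/-- `ℝ^d` with its euclidean norm and Lebesgue measure. -/
abbrev Rn (d : ℕ) : Type := EuclideanSpace ℝ (Fin d)

/-- The partial derivative `∂_i η` of a scalar function. -/
def partialDeriv {d : ℕ} (i : Fin d) (η : Rn d → ℝ) (x : Rn d) : ℝ :=
  fderiv ℝ η x (EuclideanSpace.single i 1)

section Families

variable {d : ℕ} {H : Type*} [NormedAddCommGroup H] [InnerProductSpace ℂ H]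

/-- `F ∈ L^∞(ℝ^d, B(H))`, where `B(H)` carries the strong operator topology: `x ↦ F x φ` is
measurable for every `φ`, and `‖F x‖` is essentially bounded. -/
def MemLInfty (F : Rn d → H →L[ℂ] H) : Prop :=
  (∀ φ : H, AEStronglyMeasurable (fun x => F x φ) volume) ∧
    essSup (fun x => ‖F x‖ₑ) volume < ⊤

/-- `G` is the weak `i`-th partial derivative of `F` (in the strong operator sense). -/
def IsWeakPartial (i : Fin d) (F G : Rn d → H →L[ℂ] H) : Prop :=
  ∀ (φ : H) (η : Rn d → ℝ), ContDiff ℝ ∞ η → HasCompactSupport η →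
    ∫ x, partialDeriv i η x • F x φ = -∫ x, η x • G x φ

/-- `F ∈ W^{k,∞}(ℝ^d, B(H))`, where `B(H)` carries the strong operator topology. -/
def MemWInfty : ℕ → (Rn d → H →L[ℂ] H) → Prop
  | 0, F => MemLInfty F
  | k + 1, F => MemLInfty F ∧ ∀ i : Fin d, ∃ G, IsWeakPartial i F G ∧ MemWInfty k G

open Classical in
/-- The (almost everywhere unique) weak derivative `∂_i F ∈ L^∞(ℝ^d, B(H))`, if it exists. -/
def weakPartial (i : Fin d) (F : Rn d → H →L[ℂ] H) : Rn d → H →L[ℂ] H :=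
  if h : ∃ G, IsWeakPartial i F G ∧ MemLInfty G then h.choose else 0

variable [CompleteSpace H]

/-- `B ∈ W^{k,∞}(ℝ^d, A₀, m)`: for every `β ∈ [-m, m]` the operators
`⟨A₀⟩^β B(x) ⟨A₀⟩^(-1-β)` have bounded closures, which form a family in `W^{k,∞}(ℝ^d, B(H))`. -/
def MemWInftyRel (k : ℕ) (A₀ : H →ₗ.[ℂ] H) (m : ℝ) (B : Rn d → H →ₗ.[ℂ] H) : Prop :=
  ∀ β ∈ Set.Icc (-m) m,
    (∀ x, HasBddClosure
      (opMul (bracketPow A₀ β) (opMul (B x) (bracketPow A₀ (-1 - β))))) ∧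
    MemWInfty k fun x =>
      bddClosure (opMul (bracketPow A₀ β) (opMul (B x) (bracketPow A₀ (-1 - β))))

/-- The semi-norm `ρ_z(B)`, with values in `[0, ∞]`: the sum of the `L^∞(ℝ^d)` norms of
`‖B(x) ⟨A₀⟩_z⁻¹‖`, `‖⟨A₀⟩ B(x) ⟨A₀⟩⁻¹ ⟨A₀⟩_z⁻¹‖` and, for `1 ≤ i ≤ d`,
`‖(∂_i (B ⟨A₀⟩⁻¹))(x) ⟨A₀⟩_z⁻¹‖`. -/
def rho (A₀ : H →ₗ.[ℂ] H) (B : Rn d → H →ₗ.[ℂ] H) (z : ℂ) : ℝ≥0∞ :=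
  essSup (fun x => opENorm (opMul (B x) (ofBdd (bracketNeg A₀ z 1)))) volume +
  essSup (fun x => opENorm (opMul (bracketPow A₀ 1) (opMul (B x)
    (opMul (bracketPow A₀ (-1)) (ofBdd (bracketNeg A₀ z 1)))))) volume +
  ∑ i : Fin d, essSup (fun x =>
    ‖(weakPartial i (fun y => bddClosure (opMul (B y) (bracketPow A₀ (-1)))) x).comp
      (bracketNeg A₀ z 1)‖ₑ) volume

end Families

/-! ### Operators in `L²(ℝ^d, ℂ^r ⊗ H)` -/

/-- `L²(ℝ^d, ℂ^r ⊗ H)`, with `ℂ^r ⊗ H` realised as the `r`-fold Hilbert space sum of `H`. -/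
abbrev L2 (d r : ℕ) (H : Type*) [NormedAddCommGroup H] [InnerProductSpace ℂ H] : Type _ :=
  Lp (PiLp 2 fun _ : Fin r => H) 2 (volume : Measure (Rn d))

section L2

variable {d r : ℕ} {H : Type*} [NormedAddCommGroup H] [InnerProductSpace ℂ H]

/-- The graph of the multiplication operator by a family `T(x)` of operators in `H`, acting
componentwise on `ℂ^r ⊗ H`. -/
def mulGraph (T : Rn d → H →ₗ.[ℂ] H) : Submodule ℂ (L2 d r H × L2 d r H) where
  carrier := {p | ∀ᵐ x, ∀ k, ((p.1 x) k, (p.2 x) k) ∈ (T x).graph}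
  zero_mem' := by
    filter_upwards [Lp.coeFn_zero (PiLp 2 fun _ : Fin r => H) 2 (volume : Measure (Rn d))]
      with x hx k
    simp only [Prod.fst_zero, Prod.snd_zero, hx, Pi.zero_apply, PiLp.zero_apply]
    exact (T x).graph.zero_mem
  add_mem' := by
    intro p q hp hq
    filter_upwards [hp, hq, Lp.coeFn_add p.1 q.1, Lp.coeFn_add p.2 q.2] with x h1 h2 h3 h4 k
    simp only [Prod.fst_add, Prod.snd_add, h3, h4, Pi.add_apply, PiLp.add_apply]
    exact (T x).graph.add_mem (h1 k) (h2 k)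
  smul_mem' := by
    intro c p hp
    filter_upwards [hp, Lp.coeFn_smul c p.1, Lp.coeFn_smul c p.2] with x h1 h3 h4 k
    simp only [Prod.smul_fst, Prod.smul_snd, h3, h4, Pi.smul_apply, PiLp.smul_apply]
    exact (T x).graph.smul_mem c (h1 k)

/-- The multiplication operator `(T f)(x) = T(x) f(x)`, on the maximal domain of all `f ∈ L²` with
`f(x) ∈ ℂ^r ⊗ dom T(x)` for almost every `x` and `x ↦ T(x) f(x)` in `L²`. For a constant family
`A₀` this domain is `L²(ℝ^d, ℂ^r ⊗ dom A₀)`. -/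
def mulOp (T : Rn d → H →ₗ.[ℂ] H) : L2 d r H →ₗ.[ℂ] L2 d r H := (mulGraph T).toLinearPMap

theorem mulOp_graph (T : Rn d → H →ₗ.[ℂ] H) :
    (mulOp T : L2 d r H →ₗ.[ℂ] L2 d r H).graph = mulGraph T := by
  apply Submodule.toLinearPMap_graph_eq
  rintro ⟨f, g⟩ h hf
  obtain rfl : f = 0 := hf
  apply Lp.ext
  have h' : ∀ᵐ x, ∀ k, (((0 : L2 d r H) x) k, (g x) k) ∈ (T x).graph := h
  filter_upwards [h', Lp.coeFn_zero (PiLp 2 fun _ : Fin r => H) 2 (volume : Measure (Rn d))]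
    with x h1 h2
  ext k
  have := h1 k
  rw [h2] at this ⊢
  exact LinearPMap.graph_fst_eq_zero_snd _ this rfl

theorem integrable_test_smul (f : L2 d r H) {η : Rn d → ℝ} (hη : Continuous η)
    (hc : HasCompactSupport η) : Integrable (fun x => η x • f x) :=
  ((Lp.memLp f).locallyIntegrable (by norm_num)).integrable_smul_left_of_hasCompactSupport hη hc

theorem continuous_partialDeriv (i : Fin d) {η : Rn d → ℝ} (hη : ContDiff ℝ ∞ η) :
    Continuous (partialDeriv i η) :=
  (hη.continuous_fderiv (by simp)).clm_apply continuous_const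

theorem hasCompactSupport_partialDeriv (i : Fin d) {η : Rn d → ℝ} (hη : HasCompactSupport η) :
    HasCompactSupport (partialDeriv i η) :=
  hη.fderiv_apply ℝ _

/-- The graph of the weak partial derivative `∂_i` in `L²`. -/
def derivGraph (i : Fin d) : Submodule ℂ (L2 d r H × L2 d r H) where
  carrier := {p | ∀ η : Rn d → ℝ, ContDiff ℝ ∞ η → HasCompactSupport η →
    ∫ x, partialDeriv i η x • p.1 x = -∫ x, η x • p.2 x}
  zero_mem' := by
    intro η _ _
    have h := Lp.coeFn_zero (PiLp 2 fun _ : Fin r => H) 2 (volume : Measure (Rn d))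
    have h1 : ∀ θ : Rn d → ℝ, ∫ x, θ x • (0 : L2 d r H) x = 0 := fun θ => by
      rw [integral_eq_zero_of_ae]
      filter_upwards [h] with x hx
      rw [hx, Pi.zero_apply, smul_zero]
    simp only [Prod.fst_zero, Prod.snd_zero, h1, neg_zero]
  add_mem' := by
    intro p q hp hq η h1 h2
    have h : ∀ (θ : Rn d → ℝ) (f g : L2 d r H), Continuous θ → HasCompactSupport θ →
        ∫ x, θ x • (f + g : L2 d r H) x = (∫ x, θ x • f x) + ∫ x, θ x • g x := by
      intro θ f g hθ hc
      rw [← integral_add (integrable_test_smul f hθ hc) (integrable_test_smul g hθ hc)]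
      apply integral_congr_ae
      filter_upwards [Lp.coeFn_add f g] with x hx
      rw [hx, Pi.add_apply, smul_add]
    simp only [Prod.fst_add, Prod.snd_add]
    rw [h _ _ _ (continuous_partialDeriv i h1) (hasCompactSupport_partialDeriv i h2),
      h _ _ _ h1.continuous h2, hp η h1 h2, hq η h1 h2, neg_add]
  smul_mem' := by
    intro c p hp η h1 h2
    have h : ∀ (θ : Rn d → ℝ) (f : L2 d r H),
        ∫ x, θ x • (c • f : L2 d r H) x = c • ∫ x, θ x • f x := by
      intro θ f
      rw [← integral_smul]
      apply integral_congr_ae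
      filter_upwards [Lp.coeFn_smul c f] with x hx
      simp only [hx, Pi.smul_apply]
      rw [smul_comm]
    simp only [Prod.smul_fst, Prod.smul_snd]
    rw [h, h, hp η h1 h2, smul_neg]

/-- The weak partial derivative `∂_i` in `L²`, on the domain of all `f ∈ L²` whose weak derivative
`∂_i f` lies in `L²`. -/
def derivOp (i : Fin d) : L2 d r H →ₗ.[ℂ] L2 d r H := (derivGraph i).toLinearPMap

theorem derivOp_graph [CompleteSpace H] (i : Fin d) :
    (derivOp i : L2 d r H →ₗ.[ℂ] L2 d r H).graph = derivGraph i := by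
  apply Submodule.toLinearPMap_graph_eq
  rintro ⟨f, g⟩ h hf
  obtain rfl : f = 0 := hf
  apply Lp.ext
  have h0 := Lp.coeFn_zero (PiLp 2 fun _ : Fin r => H) 2 (volume : Measure (Rn d))
  have h1 : ∀ᵐ x, g x = 0 := by
    apply ae_eq_zero_of_integral_contDiff_smul_eq_zero
      ((Lp.memLp g).locallyIntegrable (by norm_num))
    intro η hη hc
    have h2 : ∫ x, partialDeriv i η x • (0 : L2 d r H) x = -∫ x, η x • g x := h η hη hc
    rw [integral_eq_zero_of_ae] at h2
    · exact neg_eq_zero.mp h2.symm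
    · filter_upwards [h0] with x hx
      rw [hx, Pi.zero_apply, smul_zero]
  filter_upwards [h0, h1] with x h2 h3
  exact h3.trans h2.symm

/-- The domain of `H²(ℝ^d, ℂ^r ⊗ H)` inside `L²`. -/
def sobolev2 (d r : ℕ) (H : Type*) [NormedAddCommGroup H] [InnerProductSpace ℂ H] :
    Submodule ℂ (L2 d r H) :=
  (⨅ i : Fin d, (derivOp i : L2 d r H →ₗ.[ℂ] L2 d r H).domain) ⊓
    ⨅ (i : Fin d) (j : Fin d),
      (opMul (derivOp i) (derivOp j) : L2 d r H →ₗ.[ℂ] L2 d r H).domain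

/-- The Laplace operator `Δ = -∑ ∂_i²` with domain `H²(ℝ^d, ℂ^r ⊗ H)`. -/
def laplaceOp : L2 d r H →ₗ.[ℂ] L2 d r H :=
  (-∑ i : Fin d, opMul (derivOp i) (derivOp i)).domRestrict (sobolev2 d r H)

/-- A matrix `c ∈ ℂ^{r × r}` acting on `ℂ^r ⊗ H`. -/
def matrixAct (c : Matrix (Fin r) (Fin r) ℂ) :
    (PiLp 2 fun _ : Fin r => H) →L[ℂ] (PiLp 2 fun _ : Fin r => H) :=
  ((PiLp.continuousLinearEquiv 2 ℂ fun _ : Fin r => H).symm :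
      (Fin r → H) →L[ℂ] PiLp 2 fun _ : Fin r => H).comp
    (ContinuousLinearMap.pi fun k => ∑ l, c k l • PiLp.proj 2 (fun _ : Fin r => H) l)

/-- The Dirac operator `∂̸ = ∑ c^i ∂_i`; its domain is the intersection of the domains of the
`∂_i`, that is `H¹(ℝ^d, ℂ^r ⊗ H)`. -/
def diracOp (c : Fin d → Matrix (Fin r) (Fin r) ℂ) : L2 d r H →ₗ.[ℂ] L2 d r H :=
  ∑ i : Fin d, opMul (ofBdd ((matrixAct (c i)).compLpL 2 volume)) (derivOp i)

/-- The multiplication operator `M₀` by the constant family `A₀`. -/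
def M0 (A₀ : H →ₗ.[ℂ] H) : L2 d r H →ₗ.[ℂ] L2 d r H := mulOp fun _ => A₀

/-- `D₀ = i ∂̸ + M₀` on `dom ∂̸ ∩ dom M₀`. -/
def D0 (c : Fin d → Matrix (Fin r) (Fin r) ℂ) (A₀ : H →ₗ.[ℂ] H) : L2 d r H →ₗ.[ℂ] L2 d r H :=
  Complex.I • diracOp c + M0 A₀

/-- `H₀ = Δ + M₀²` on `H²(ℝ^d, ℂ^r ⊗ H) ∩ dom M₀²`. -/
def H0 (A₀ : H →ₗ.[ℂ] H) : L2 d r H →ₗ.[ℂ] L2 d r H := laplaceOp + opMul (M0 A₀) (M0 A₀)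

/-- `D_B = i ∂̸ + B + M₀` on `dom D₀`. -/
def DB (c : Fin d → Matrix (Fin r) (Fin r) ℂ) (A₀ : H →ₗ.[ℂ] H) (B : Rn d → H →ₗ.[ℂ] H) :
    L2 d r H →ₗ.[ℂ] L2 d r H :=
  (Complex.I • diracOp c + mulOp B + M0 A₀).domRestrict (D0 c A₀).domain

/-- `-i ∂̸ + B + M₀` on `dom D₀`. -/
def DBminus (c : Fin d → Matrix (Fin r) (Fin r) ℂ) (A₀ : H →ₗ.[ℂ] H) (B : Rn d → H →ₗ.[ℂ] H) :
    L2 d r H →ₗ.[ℂ] L2 d r H :=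
  (-(Complex.I • diracOp c) + mulOp B + M0 A₀).domRestrict (D0 c A₀).domain

/-- `H_B = Δ + (B + M₀)²` on `dom H₀`. -/
def HB (A₀ : H →ₗ.[ℂ] H) (B : Rn d → H →ₗ.[ℂ] H) : L2 d r H →ₗ.[ℂ] L2 d r H :=
  (laplaceOp + opMul (mulOp B + M0 A₀) (mulOp B + M0 A₀)).domRestrict (H0 A₀).domain

end L2

end DiracSchrodinger

end

/-!
The proof is a perturbation argument around `H₀ = Δ + M₀²`, carried out with graphs of operators
in `L²` and with everywhere defined bounded operators only.

*The unperturbed operator.* For `μ > 0` let `a = (Δ + μ)⁻¹`, which is constructed by Fourier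
transform, and `W = (M₀² + μ)^(-1/2)`, which acts fibrewise. These are commuting symmetric bounded
operators, and `u = a W² (a + W²)⁻¹ h` solves `(H₀ + 2μ) u = h`; a priori only the operators
`X = a (a + W²)⁻¹` and `Y = W² (a + W²)⁻¹` make sense, as continuous extensions from the dense
range of `a + W²` (`exists_resolvent_sum`). This gives the maximal regularity of `H₀`: every
`u ∈ dom H₀` has the derivatives `∂_i ∂_j u`, the terms `M₀ u`, `M₀² u`, and the mixed terms
`∂_i M₀ u = M₀ ∂_i u`, which are collected in a `Jet`; moreover
`‖(M₀² + μ) u‖ ≤ ‖(H₀ + 2μ) u‖` (`exists_resolvent_jet`, `exists_jet_of_mem_H0_domain`).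

*The perturbation.* With `w = ⟨M₀⟩ u` one has `B u = (B ⟨M₀⟩⁻¹) w`, so that `B` acts on
functions with a `Jet` through bounded families of operators, which satisfy a product rule
(`mulCLM_mem_derivGraph`) and, by the case `β = 1` of the hypothesis on `B`, preserve `dom M₀`.
Since `ρ_μ(B) → 0`, the terms `B M₀ u`, `M₀ B u`, `B² u` and `[∂_i, B] u` are bounded by
`2 ε ‖(M₀² + μ) u‖`, `ε ≤ 1`, for suitable large `μ` (`exists_perturbation_bounds`).

*Conclusion.* By the Clifford relations, `(∓i ∂̸ + B + M₀) (±i ∂̸ + B + M₀)` and `H_B` are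
`H₀` plus such terms (`diracRel_comp`), so that a Neumann series shows that each of these operators plus
`2μ` maps `dom H₀` onto `L²` (`surjective_of_small_perturbation`). Being symmetric and
non-negative, they are self-adjoint with domain exactly `dom H₀`. Finally, if `P` and `Q` are
formally adjoint and `Q P + ν` and `P Q + ν` are surjective for some real `ν`, then `P* = Q`
(`adjoint_eq_of_surj`); this identifies the adjoint of `D_B` and shows that `D_B` is closed.
-/

noncomputable section

namespace DiracSchrodinger

/-! ### Graphs of unbounded operators -/

section Graphs

variable {E : Type*} [NormedAddCommGroup E] [InnerProductSpace ℂ E]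

theorem inner_self_eq_ofReal (x : E) : inner ℂ x x = ((‖x‖ ^ 2 : ℝ) : ℂ) := by
  rw [inner_self_eq_norm_sq_to_K, Complex.ofReal_pow]
  rfl

theorem mem_graph_of_domain (T : E →ₗ.[ℂ] E) {x : E} (hx : x ∈ T.domain) :
    (x, T ⟨x, hx⟩) ∈ T.graph := T.mem_graph ⟨x, hx⟩

theorem domain_of_mem_graph {T : E →ₗ.[ℂ] E} {x y : E} (h : (x, y) ∈ T.graph) : x ∈ T.domain :=
  LinearPMap.mem_domain_of_mem_graph h

theorem apply_of_mem_graph {T : E →ₗ.[ℂ] E} {x y : E} (h : (x, y) ∈ T.graph) (hx : x ∈ T.domain) :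
    T ⟨x, hx⟩ = y := T.mem_graph_snd_inj (mem_graph_of_domain T hx) h rfl

theorem inner_eq_of_isFormalAdjoint {P Q : E →ₗ.[ℂ] E} (h : P.IsFormalAdjoint Q) {u g v k : E}
    (h1 : (u, g) ∈ P.graph) (h2 : (v, k) ∈ Q.graph) : inner ℂ g v = inner ℂ u k := by
  have := h ⟨u, domain_of_mem_graph h1⟩ ⟨v, domain_of_mem_graph h2⟩
  rwa [apply_of_mem_graph h1, apply_of_mem_graph h2] at this

theorem mem_opMul_graph {S T : E →ₗ.[ℂ] E} {x z : E} :
    (x, z) ∈ (opMul S T).graph ↔ ∃ y, (x, y) ∈ T.graph ∧ (y, z) ∈ S.graph := by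
  constructor
  · intro h
    have hx := domain_of_mem_graph h
    have hz := apply_of_mem_graph h hx
    obtain ⟨v, hv, hvx⟩ := id hx
    obtain rfl : (v : E) = x := hvx
    refine ⟨T v, T.mem_graph v, ?_⟩
    rw [← hz]
    exact S.mem_graph ⟨T v, hv⟩
  · rintro ⟨y, h1, h2⟩
    have hx := domain_of_mem_graph h1
    have hy := domain_of_mem_graph h2
    have e1 := apply_of_mem_graph h1 hx
    subst e1
    have e2 := apply_of_mem_graph h2 hy
    subst e2
    exact (opMul S T).mem_graph ⟨x, ⟨x, hx⟩, hy, rfl⟩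

theorem mem_ofBdd_graph {S : E →L[ℂ] E} {x y : E} : (x, y) ∈ (ofBdd S).graph ↔ y = S x := by
  constructor
  · intro h
    exact (apply_of_mem_graph h Submodule.mem_top).symm
  · rintro rfl
    exact (ofBdd S).mem_graph ⟨x, Submodule.mem_top⟩

theorem opMul_ofBdd_one (T : E →ₗ.[ℂ] E) : opMul (ofBdd 1) T = T := by
  apply LinearPMap.eq_of_eq_graph
  ext ⟨x, z⟩
  rw [mem_opMul_graph]
  constructor
  · rintro ⟨y, h1, h2⟩
    rw [mem_ofBdd_graph] at h2
    rwa [h2]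
  · intro h
    exact ⟨z, h, mem_ofBdd_graph.2 rfl⟩

theorem mem_add_graph {S T : E →ₗ.[ℂ] E} {x z : E} :
    (x, z) ∈ (S + T).graph ↔ ∃ y w, (x, y) ∈ S.graph ∧ (x, w) ∈ T.graph ∧ z = y + w := by
  constructor
  · intro h
    have hx := domain_of_mem_graph h
    have hz := apply_of_mem_graph h hx
    exact ⟨_, _, S.mem_graph ⟨x, hx.1⟩, T.mem_graph ⟨x, hx.2⟩, hz.symm⟩
  · rintro ⟨y, w, h1, h2, rfl⟩
    have hx := domain_of_mem_graph h1
    have hx' := domain_of_mem_graph h2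
    rw [← apply_of_mem_graph h1 hx, ← apply_of_mem_graph h2 hx']
    exact (S + T).mem_graph ⟨x, hx, hx'⟩

theorem mem_smul_graph {T : E →ₗ.[ℂ] E} {c : ℂ} {x z : E} :
    (x, z) ∈ (c • T).graph ↔ ∃ y, (x, y) ∈ T.graph ∧ z = c • y := by
  constructor
  · intro h
    have hx := domain_of_mem_graph h
    exact ⟨_, T.mem_graph ⟨x, hx⟩, (apply_of_mem_graph h hx).symm⟩
  · rintro ⟨y, h, rfl⟩
    have hx := domain_of_mem_graph h
    rw [← apply_of_mem_graph h hx]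
    exact (c • T).mem_graph ⟨x, hx⟩

theorem mem_neg_graph {T : E →ₗ.[ℂ] E} {x z : E} :
    (x, z) ∈ (-T).graph ↔ (x, -z) ∈ T.graph := by
  constructor
  · intro h
    have hx := domain_of_mem_graph h
    have hz := apply_of_mem_graph h hx
    rw [← hz, LinearPMap.neg_apply, neg_neg]
    exact T.mem_graph ⟨x, hx⟩
  · intro h
    have hx := domain_of_mem_graph h
    have := (-T).mem_graph ⟨x, hx⟩
    rwa [LinearPMap.neg_apply, apply_of_mem_graph h hx, neg_neg] at this

theorem mem_domRestrict_graph {T : E →ₗ.[ℂ] E} {D : Submodule ℂ E} {x z : E} :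
    (x, z) ∈ (T.domRestrict D).graph ↔ x ∈ D ∧ (x, z) ∈ T.graph := by
  constructor
  · intro h
    have hx := domain_of_mem_graph h
    refine ⟨hx.1, ?_⟩
    exact LinearPMap.le_graph_of_le LinearPMap.domRestrict_le h
  · rintro ⟨h1, h2⟩
    have hx := domain_of_mem_graph h2
    have hx' : x ∈ (T.domRestrict D).domain := ⟨h1, hx⟩
    have hle : T.domRestrict D ≤ T := LinearPMap.domRestrict_le
    have h3 := LinearPMap.le_graph_of_le hle (mem_graph_of_domain _ hx')
    rw [T.mem_graph_snd_inj h2 h3 rfl]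
    exact mem_graph_of_domain _ hx'

theorem mem_sum_graph {ι : Type*} (s : Finset ι) (T : ι → E →ₗ.[ℂ] E) {x z : E} :
    (x, z) ∈ (∑ i ∈ s, T i).graph ↔
      ∃ y : ι → E, (∀ i ∈ s, (x, y i) ∈ (T i).graph) ∧ z = ∑ i ∈ s, y i := by
  classical
  induction s using Finset.induction_on generalizing z with
  | empty =>
    simp only [Finset.sum_empty, Finset.notMem_empty, IsEmpty.forall_iff, implies_true,
      true_and, exists_const]
    constructor
    · intro h
      exact (apply_of_mem_graph h Submodule.mem_top).symm
    · rintro rfl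
      exact (0 : E →ₗ.[ℂ] E).mem_graph ⟨x, Submodule.mem_top⟩
  | insert a s ha ih =>
    rw [Finset.sum_insert ha, mem_add_graph]
    constructor
    · rintro ⟨y, w, h1, h2, rfl⟩
      obtain ⟨y', hy', rfl⟩ := ih.1 h2
      have hne : ∀ i ∈ s, i ≠ a := fun i hi h => ha (h ▸ hi)
      refine ⟨Function.update y' a y, ?_, ?_⟩
      · intro i hi
        rcases Finset.mem_insert.1 hi with rfl | hi
        · simpa using h1
        · rw [Function.update_of_ne (hne i hi)]
          exact hy' i hi
      · rw [Finset.sum_insert ha, Function.update_self]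
        congr 1
        exact Finset.sum_congr rfl fun i hi => (Function.update_of_ne (hne i hi) _ _).symm
    · rintro ⟨y, hy, rfl⟩
      exact ⟨y a, ∑ i ∈ s, y i, hy a (Finset.mem_insert_self a s),
        ih.2 ⟨y, fun i hi => hy i (Finset.mem_insert_of_mem hi), rfl⟩, Finset.sum_insert ha⟩

theorem mem_inverse_graph {T : E →ₗ.[ℂ] E} (hT : LinearMap.ker T.toFun = ⊥) {x y : E} :
    (x, y) ∈ T.inverse.graph ↔ (y, x) ∈ T.graph := by
  rw [LinearPMap.inverse_graph hT]
  simp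

theorem ker_toFun_eq_bot {T : E →ₗ.[ℂ] E} (h : ∀ x, (x, 0) ∈ T.graph → x = 0) :
    LinearMap.ker T.toFun = ⊥ := by
  rw [LinearMap.ker_eq_bot']
  rintro x hx
  apply Subtype.ext
  apply h
  have := T.mem_graph x
  have h2 : T x = 0 := hx
  rwa [h2] at this

/-- An operator with bounded closure `S` agrees with `S` on its domain. -/
theorem HasBddClosure.apply_eq {T : E →ₗ.[ℂ] E} (h : HasBddClosure T) {x y : E}
    (hxy : (x, y) ∈ T.graph) : bddClosure T x = y := by
  have hS : T.closure = ofBdd (bddClosure T) := by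
    rw [bddClosure, dif_pos h]
    exact h.2.choose_spec
  have := LinearPMap.le_graph_of_le T.le_closure hxy
  rw [hS, mem_ofBdd_graph] at this
  exact this.symm

theorem HasBddClosure.dense {T : E →ₗ.[ℂ] E} (h : HasBddClosure T) :
    Dense (T.domain : Set E) := by
  have hS : T.closure = ofBdd (bddClosure T) := by
    rw [bddClosure, dif_pos h]
    exact h.2.choose_spec
  intro x
  have hx : (x, bddClosure T x) ∈ T.closure.graph := by
    rw [hS, mem_ofBdd_graph]
  rw [← h.1.graph_closure_eq_closure_graph] at hx
  have h2 : (x, bddClosure T x) ∈ closure (T.graph : Set (E × E)) := hx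
  have h3 := image_closure_subset_closure_image continuous_fst ⟨_, h2, rfl⟩
  refine closure_mono ?_ h3
  rintro _ ⟨⟨a, b⟩, hp, rfl⟩
  exact domain_of_mem_graph hp

/-- An everywhere defined bounded operator is its own closure. -/
theorem bddClosure_ofBdd (S : E →L[ℂ] E) : bddClosure (ofBdd S) = S := by
  have hcl : (ofBdd S).IsClosed := by
    have : ((ofBdd S).graph : Set (E × E)) = {p | p.2 = S p.1} := by
      ext ⟨x, y⟩
      exact mem_ofBdd_graph
    rw [LinearPMap.IsClosed, this]
    exact isClosed_eq continuous_snd (S.continuous.comp continuous_fst)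
  have hb : HasBddClosure (ofBdd S) := by
    refine ⟨hcl.isClosable, S, ?_⟩
    apply LinearPMap.eq_of_eq_graph
    apply SetLike.coe_injective
    rw [← hcl.isClosable.graph_closure_eq_closure_graph, Submodule.topologicalClosure_coe]
    exact hcl.closure_eq
  ext x
  exact hb.apply_eq (mem_ofBdd_graph.2 rfl)

end Graphs

/-! ### Factorization through operators with dense range -/

section Extension

variable {E : Type*} [NormedAddCommGroup E] [InnerProductSpace ℂ E] [CompleteSpace E]

/-- If `T` has dense range and `‖S k‖ ≤ C ‖T k‖` for all `k`, then `S` factors through `T`. -/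
theorem exists_factor_of_denseRange (T S : E →L[ℂ] E) (hT : DenseRange T) {C : ℝ}
    (h : ∀ k, ‖S k‖ ≤ C * ‖T k‖) : ∃ X : E →L[ℂ] E, (∀ k, X (T k) = S k) ∧ ∀ v, ‖X v‖ ≤ C * ‖v‖ := by
  have hX : ∀ k, (LinearMap.extendOfNorm (S : E →ₗ[ℂ] E) (T : E →ₗ[ℂ] E)) (T k) = S k := fun k =>
    LinearMap.extendOfNorm_eq hT ⟨C, h⟩ k
  refine ⟨LinearMap.extendOfNorm (S : E →ₗ[ℂ] E) (T : E →ₗ[ℂ] E), hX, fun v => ?_⟩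
  refine hT.induction_on (p := fun v =>
    ‖(LinearMap.extendOfNorm (S : E →ₗ[ℂ] E) (T : E →ₗ[ℂ] E)) v‖ ≤ C * ‖v‖) v ?_ ?_
  · exact isClosed_le (by fun_prop) (by fun_prop)
  · intro k
    rw [hX]
    exact h k

theorem dense_of_forall_orthogonal (K : Submodule ℂ E)
    (h : ∀ x, (∀ u ∈ K, inner ℂ u x = 0) → x = 0) : Dense (K : Set E) := by
  rw [Submodule.dense_iff_topologicalClosure_eq_top, Submodule.topologicalClosure_eq_top_iff,
    Submodule.eq_bot_iff]
  exact fun x hx => h x ((Submodule.mem_orthogonal _ _).1 hx)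

/-- A self-adjoint injective bounded operator has dense range. -/
theorem denseRange_of_symm_of_injective (T : E →L[ℂ] E)
    (hT : ∀ x y, inner ℂ (T x) y = inner ℂ x (T y)) (hi : ∀ x, T x = 0 → x = 0) :
    DenseRange T := by
  refine dense_of_forall_orthogonal (LinearMap.range (T : E →ₗ[ℂ] E)) fun x hx => ?_
  apply hi
  apply ext_inner_left ℂ
  intro v
  rw [← hT, inner_zero_right]
  exact hx _ ⟨v, rfl⟩

/-- The resolvent of a sum of two commuting non-negative operators: if `a` and `b = W²` are the
resolvents of the summands, then `X (a + b) = a` and `Y (a + b) = b` define contractions, and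
`a Y = b X` is the resolvent of the sum. -/
theorem exists_resolvent_sum (a W : E →L[ℂ] E)
    (ha : ∀ x y, inner ℂ (a x) y = inner ℂ x (a y)) (hpos : ∀ x, 0 ≤ (inner ℂ (a x) x).re)
    (hinj : ∀ x, a x = 0 → x = 0) (hW : ∀ x y, inner ℂ (W x) y = inner ℂ x (W y))
    (hcomm : ∀ x, a (W x) = W (a x)) :
    DenseRange (a + W * W) ∧
    (∀ k, ‖a k‖ ≤ ‖(a + W * W) k‖) ∧ (∀ k, ‖W (W k)‖ ≤ ‖(a + W * W) k‖) ∧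
    ∃ X Y : E →L[ℂ] E, (∀ k, X ((a + W * W) k) = a k) ∧ (∀ k, Y ((a + W * W) k) = W (W k)) ∧
      (∀ v, X v + Y v = v) ∧ (∀ v, a (Y v) = W (W (X v))) ∧
      (∀ v, ‖X v‖ ≤ ‖v‖) ∧ (∀ v, ‖Y v‖ ≤ ‖v‖) := by
  have hadd : ∀ k, (a + W * W) k = a k + W (W k) := fun k => rfl
  have hcross : ∀ k, 0 ≤ (inner ℂ (a k) (W (W k))).re := fun k => by
    rw [← hW, ← hcomm]
    exact hpos _
  have hsq : ∀ k, ‖a k + W (W k)‖ ^ 2 =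
      ‖a k‖ ^ 2 + 2 * (inner ℂ (a k) (W (W k))).re + ‖W (W k)‖ ^ 2 := fun k =>
    norm_add_sq (𝕜 := ℂ) _ _
  have h1 : ∀ k, ‖a k‖ ≤ ‖(a + W * W) k‖ := fun k => by
    rw [hadd]
    apply le_of_sq_le_sq _ (norm_nonneg _)
    rw [hsq]
    nlinarith [hcross k, sq_nonneg ‖W (W k)‖]
  have h2 : ∀ k, ‖W (W k)‖ ≤ ‖(a + W * W) k‖ := fun k => by
    rw [hadd]
    apply le_of_sq_le_sq _ (norm_nonneg _)
    rw [hsq]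
    nlinarith [hcross k, sq_nonneg ‖a k‖]
  have hd : DenseRange (a + W * W) := by
    apply denseRange_of_symm_of_injective
    · intro x y
      rw [hadd, hadd, inner_add_left, inner_add_right, ha, hW, hW]
    · intro x hx
      apply hinj
      have := h1 x
      rw [hx, norm_zero] at this
      exact norm_le_zero_iff.1 this
  refine ⟨hd, h1, h2, ?_⟩
  obtain ⟨X, hX, hX'⟩ := exists_factor_of_denseRange _ a hd (C := 1) (by simpa using h1)
  obtain ⟨Y, hY, hY'⟩ := exists_factor_of_denseRange _ (W * W) hd (C := 1) (by simpa using h2)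
  refine ⟨X, Y, hX, hY, fun v => ?_, fun v => ?_, by simpa using hX', by simpa using hY'⟩
  · refine hd.induction_on (p := fun v => X v + Y v = v) v
      (isClosed_eq (by fun_prop) (by fun_prop)) fun k => ?_
    rw [hX, hY]
    rfl
  · refine hd.induction_on (p := fun v => a (Y v) = W (W (X v))) v
      (isClosed_eq (by fun_prop) (by fun_prop)) fun k => ?_
    rw [hX, hY]
    simp only [mul_apply_eq_comp, hcomm]

end Extension

/-! ### Self-adjointness criteria -/

section SelfAdjoint

variable {E : Type*} [NormedAddCommGroup E] [InnerProductSpace ℂ E] [CompleteSpace E]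

/-- Perturbation of a resolvent: if `T + ν` is within distance `1 / 2` of the identity after
composition with `G`, then `(T + ν) G` is onto. -/
theorem exists_solution_of_near_resolvent (T : E →ₗ.[ℂ] E) (G : E →L[ℂ] E) (ν : ℂ)
    (hG : ∀ h, G h ∈ T.domain)
    (hb : ∀ h, ‖T ⟨G h, hG h⟩ + ν • G h - h‖ ≤ 1 / 2 * ‖h‖) (f : E) :
    ∃ h, T ⟨G h, hG h⟩ + ν • G h = f := by
  let V₀ : E →ₗ[ℂ] E :=
    { toFun := fun h => h - (T ⟨G h, hG h⟩ + ν • G h)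
      map_add' := fun x y => by
        have : (⟨G (x + y), hG _⟩ : T.domain) = ⟨G x, hG x⟩ + ⟨G y, hG y⟩ :=
          Subtype.ext (G.map_add x y)
        rw [this, LinearPMap.map_add, G.map_add, smul_add]
        abel
      map_smul' := fun c x => by
        have : (⟨G (c • x), hG _⟩ : T.domain) = c • ⟨G x, hG x⟩ :=
          Subtype.ext (G.map_smul c x)
        rw [this, LinearPMap.map_smul, G.map_smul, RingHom.id_apply, smul_comm ν c,
          ← smul_add, smul_sub] }
  have hV₀ : ∀ h, ‖V₀ h‖ ≤ 1 / 2 * ‖h‖ := fun h => by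
    have := hb h
    rw [norm_sub_rev] at this
    exact this
  let V : E →L[ℂ] E := V₀.mkContinuous (1 / 2) hV₀
  have hV : ‖V‖ < 1 := by
    have := V₀.mkContinuous_norm_le (by norm_num) hV₀
    exact lt_of_le_of_lt this (by norm_num)
  obtain ⟨w, hw⟩ := isUnit_one_sub_of_norm_lt_one hV
  refine ⟨(↑w⁻¹ : E →L[ℂ] E) f, ?_⟩
  have h1 : (1 - V) ((↑w⁻¹ : E →L[ℂ] E) f) = f := by
    rw [← hw, ← mul_apply_eq_comp, Units.mul_inv, one_apply_eq_self]
  have h2 : ∀ h, (1 - V) h = T ⟨G h, hG h⟩ + ν • G h := fun h => by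
    change h - (h - (T ⟨G h, hG h⟩ + ν • G h)) = _
    abel
  rw [← h2, h1]

/-- A symmetric operator `T` such that `T + ν` is onto for some real `ν` is self-adjoint. -/
theorem isSelfAdjoint_of_symm_of_surj (T : E →ₗ.[ℂ] E) (hT : T.IsFormalAdjoint T) (ν : ℝ)
    (hs : ∀ f, ∃ u g, (u, g) ∈ T.graph ∧ g + (ν : ℂ) • u = f) : IsSelfAdjoint T := by
  have hsym : ∀ {u g v k : E}, (u, g) ∈ T.graph → (v, k) ∈ T.graph →
      inner ℂ g v = inner ℂ u k := by
    intro u g v k h1 h2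
    have := hT ⟨u, domain_of_mem_graph h1⟩ ⟨v, domain_of_mem_graph h2⟩
    rwa [apply_of_mem_graph h1, apply_of_mem_graph h2] at this
  have hsym' : ∀ {u g v k : E}, (u, g) ∈ T.graph → (v, k) ∈ T.graph →
      inner ℂ (g + (ν : ℂ) • u) v = inner ℂ u (k + (ν : ℂ) • v) := by
    intro u g v k h1 h2
    rw [inner_add_left, inner_add_right, hsym h1 h2, inner_smul_left, inner_smul_right,
      Complex.conj_ofReal]
  have hd : Dense (T.domain : Set E) := by
    refine dense_of_forall_orthogonal _ fun x hx => ?_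
    obtain ⟨u, g, hu, rfl⟩ := hs x
    have hu0 : u = 0 := by
      apply ext_inner_right ℂ
      intro f
      obtain ⟨v, k, hv, rfl⟩ := hs f
      rw [← hsym' hu hv, inner_zero_left, ← inner_conj_symm, hx v (domain_of_mem_graph hv),
        map_zero]
    subst hu0
    rw [LinearPMap.graph_fst_eq_zero_snd _ hu rfl, smul_zero, add_zero]
  rw [LinearPMap.isSelfAdjoint_def]
  refine (LinearPMap.eq_of_le_of_domain_eq (hT.le_adjoint hd) ?_).symm
  refine le_antisymm (hT.le_adjoint hd).1 fun g hg => ?_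
  obtain ⟨u, k, hu, hk⟩ := hs (T† ⟨g, hg⟩ + (ν : ℂ) • g)
  have hgu : g = u := by
    apply ext_inner_right ℂ
    intro f
    obtain ⟨v, l, hv, rfl⟩ := hs f
    have h1 := LinearPMap.adjoint_isFormalAdjoint hd ⟨g, hg⟩ ⟨v, domain_of_mem_graph hv⟩
    rw [apply_of_mem_graph hv] at h1
    rw [← hsym' hu hv, hk, inner_add_left, inner_add_right, h1, inner_smul_left, inner_smul_right,
      Complex.conj_ofReal]
  rw [hgu]
  exact domain_of_mem_graph hu

/-- Let `P` and `Q` be formally adjoint, and let `Q P + ν` map a subspace `D` onto the whole space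
for some `ν > 0`. Then `Q P` is non-negative and self-adjoint with domain exactly `D`. -/
theorem opMul_isSelfAdjoint_of_surj {P Q : E →ₗ.[ℂ] E} (hadj : P.IsFormalAdjoint Q)
    {D : Submodule ℂ E} (hD : D ≤ (opMul Q P).domain) {ν : ℝ} (hν : 0 < ν)
    (hs : ∀ f, ∃ u ∈ D, ∃ g, (u, g) ∈ (opMul Q P).graph ∧ g + (ν : ℂ) • u = f) :
    (opMul Q P).domain = D ∧ IsSelfAdjoint (opMul Q P) ∧ IsNonneg (opMul Q P) := by
  have hnn : ∀ {u g : E}, (u, g) ∈ (opMul Q P).graph → 0 ≤ (inner ℂ u g).re := by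
    intro u g hu
    obtain ⟨y, h1, h2⟩ := mem_opMul_graph.1 hu
    rw [← inner_eq_of_isFormalAdjoint hadj h1 h2]
    exact inner_self_nonneg (𝕜 := ℂ)
  refine ⟨le_antisymm (fun u hu => ?_) hD, ?_, fun u => hnn ((opMul Q P).mem_graph u)⟩
  · obtain ⟨v, hv, g, hg, he⟩ := hs ((opMul Q P) ⟨u, hu⟩ + (ν : ℂ) • u)
    have hsub := (opMul Q P).graph.sub_mem (mem_graph_of_domain _ hu) hg
    have h0 : (opMul Q P) ⟨u, hu⟩ - g = -((ν : ℂ) • (u - v)) := by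
      rw [smul_sub, eq_neg_iff_add_eq_zero, ← sub_eq_zero.2 he.symm]
      abel
    have h1 := hnn hsub
    simp only [h0, inner_neg_right, inner_smul_right, Complex.neg_re] at h1
    rw [Complex.re_ofReal_mul, inner_self_eq_norm_sq_to_K] at h1
    have h2 : ((‖u - v‖ : ℂ) ^ 2).re = ‖u - v‖ ^ 2 := by
      rw [← Complex.ofReal_pow, Complex.ofReal_re]
    have h3 : ‖u - v‖ ^ 2 ≤ 0 := by
      have h4 : 0 ≤ -(ν * ‖u - v‖ ^ 2) := by rw [← h2]; exact h1
      by_contra h5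
      nlinarith
    have h4 : u - v = 0 := by
      rw [← norm_eq_zero]
      exact pow_eq_zero_iff (two_ne_zero) |>.1 (le_antisymm h3 (sq_nonneg _))
    rw [sub_eq_zero.1 h4]
    exact hv
  · refine isSelfAdjoint_of_symm_of_surj _ (fun x y => ?_) ν fun f => ?_
    · obtain ⟨x', hx1, hx2⟩ := mem_opMul_graph.1 ((opMul Q P).mem_graph x)
      obtain ⟨y', hy1, hy2⟩ := mem_opMul_graph.1 ((opMul Q P).mem_graph y)
      rw [← inner_eq_of_isFormalAdjoint hadj.symm hx2 hy1 |>.symm,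
        ← inner_eq_of_isFormalAdjoint hadj hx1 hy2]
    · obtain ⟨u, -, g, hg, he⟩ := hs f
      exact ⟨u, g, hg, he⟩

/-- Let `P` and `Q` be formally adjoint, such that `Q P + ν` and `P Q + ν`
are onto for some real `ν`. Then `P† = Q`. This is the passage from an off-diagonal `2 × 2` block
operator to its square: the element `g ∈ dom P†` with `P† g = h` is recovered as
`g = ν (P Q + ν)⁻¹ g + P (Q P + ν)⁻¹ h`. -/
theorem adjoint_eq_of_surj {P Q : E →ₗ.[ℂ] E} (hadj : P.IsFormalAdjoint Q)
    (hd : Dense (P.domain : Set E)) {ν : ℝ}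
    (h1 : ∀ f, ∃ u g, (u, g) ∈ (opMul Q P).graph ∧ g + (ν : ℂ) • u = f)
    (h2 : ∀ f, ∃ u g, (u, g) ∈ (opMul P Q).graph ∧ g + (ν : ℂ) • u = f) : P† = Q := by
  have hle : Q ≤ P† := hadj.le_adjoint hd
  refine (LinearPMap.eq_of_le_of_domain_eq hle (le_antisymm hle.1 fun g hg => ?_)).symm
  obtain ⟨a, a2, ha, hae⟩ := h2 g
  obtain ⟨b, b2, hb, hbe⟩ := h1 (P† ⟨g, hg⟩)
  obtain ⟨a1, ha1, ha2⟩ := mem_opMul_graph.1 ha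
  obtain ⟨b1, hb1, hb2⟩ := mem_opMul_graph.1 hb
  have hg' : g = (ν : ℂ) • a + b1 := by
    apply ext_inner_left ℂ
    intro k
    obtain ⟨w, w2, hw, rfl⟩ := h2 k
    obtain ⟨w1, hw1, hw2⟩ := mem_opMul_graph.1 hw
    have e1 : inner ℂ w2 g = inner ℂ w1 (P† ⟨g, hg⟩) := by
      have := LinearPMap.adjoint_isFormalAdjoint hd ⟨g, hg⟩ ⟨w1, domain_of_mem_graph hw2⟩
      rw [apply_of_mem_graph hw2] at this
      rw [← inner_conj_symm, ← this, inner_conj_symm]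
    have e2 : inner ℂ w2 a = inner ℂ w1 a1 := inner_eq_of_isFormalAdjoint hadj hw2 ha1
    have e3 : inner ℂ w1 a1 = inner ℂ w a2 := inner_eq_of_isFormalAdjoint hadj.symm hw1 ha2
    have e4 : inner ℂ w2 b1 = inner ℂ w1 b2 := inner_eq_of_isFormalAdjoint hadj hw2 hb2
    have e5 : inner ℂ w1 b = inner ℂ w b1 := inner_eq_of_isFormalAdjoint hadj.symm hw1 hb1
    rw [inner_add_left, e1, ← hbe]
    nth_rewrite 1 [← hae]
    simp only [inner_add_left, inner_add_right, inner_smul_left, inner_smul_right,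
      Complex.conj_ofReal, e2, e3, e4, e5]
    ring
  rw [hg']
  refine Q.domain.add_mem (Q.domain.smul_mem _ (domain_of_mem_graph ha1)) ?_
  exact domain_of_mem_graph hb2

end SelfAdjoint

/-! ### The resolvent of the square of a self-adjoint operator -/

section SqResolvent

variable {H : Type*} [NormedAddCommGroup H] [InnerProductSpace ℂ H]

/-- An everywhere defined bounded `LinearPMap` is given by a bounded operator. -/
theorem exists_eq_ofBdd {T : H →ₗ.[ℂ] H} {C : ℝ} (hT : ∀ x, ∃ y, (x, y) ∈ T.graph)
    (hb : ∀ x y, (x, y) ∈ T.graph → ‖y‖ ≤ C * ‖x‖) : ∃ S : H →L[ℂ] H, T = ofBdd S := by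
  have hd : ∀ x, x ∈ T.domain := fun x => by
    obtain ⟨y, hy⟩ := hT x
    exact domain_of_mem_graph hy
  let S₀ : H →ₗ[ℂ] H :=
    { toFun := fun x => T ⟨x, hd x⟩
      map_add' := fun x y => T.map_add ⟨x, hd x⟩ ⟨y, hd y⟩
      map_smul' := fun c x => T.map_smul c ⟨x, hd x⟩ }
  refine ⟨S₀.mkContinuous C fun x => hb x _ (T.mem_graph ⟨x, hd x⟩), ?_⟩
  apply LinearPMap.eq_of_eq_graph
  ext ⟨x, y⟩
  rw [mem_ofBdd_graph]
  constructor
  · intro h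
    exact (apply_of_mem_graph h (hd x)).symm
  · rintro rfl
    exact T.mem_graph ⟨x, hd x⟩

variable [CompleteSpace H] {A : H →ₗ.[ℂ] H}

theorem inner_eq_of_isSelfAdjoint (hA : IsSelfAdjoint A) {u g v k : H}
    (h1 : (u, g) ∈ A.graph) (h2 : (v, k) ∈ A.graph) : inner ℂ g v = inner ℂ u k := by
  have h := LinearPMap.adjoint_isFormalAdjoint hA.dense_domain
  rw [LinearPMap.isSelfAdjoint_def.1 hA] at h
  exact inner_eq_of_isFormalAdjoint h h1 h2

/-- `A² + 1` is onto: decompose `(v, 0)` along the closed graph of `A` and its orthogonal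
complement `{(-A y, y)}`. -/
theorem exists_sq_add_one_eq (hA : IsSelfAdjoint A) (v : H) :
    ∃ x y, (x, y) ∈ A.graph ∧ (y, v - x) ∈ A.graph := by
  let e := (WithLp.linearEquiv 2 ℂ (H × H))
  let K : Submodule ℂ (WithLp 2 (H × H)) := A.graph.comap (e : WithLp 2 (H × H) →ₗ[ℂ] H × H)
  have hK : IsClosed (K : Set (WithLp 2 (H × H))) :=
    hA.isClosed.preimage (WithLp.prod_continuous_ofLp 2 H H)
  have : CompleteSpace K := hK.completeSpace_coe
  obtain ⟨k, hk, o, ho, hko⟩ := K.exists_add_mem_mem_orthogonal (WithLp.toLp 2 (v, (0 : H)))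
  have h1 : v = k.fst + o.fst := congrArg (fun p : WithLp 2 (H × H) => p.fst) hko
  have h2 : (0 : H) = k.snd + o.snd := congrArg (fun p : WithLp 2 (H × H) => p.snd) hko
  have hk' : (k.fst, k.snd) ∈ A.graph := hk
  have ho' : (o.snd, -o.fst) ∈ A.graph := by
    have h3 : (o.snd, -o.fst) ∈ (A†).graph := by
      rw [LinearPMap.adjoint_graph_eq_graph_adjoint hA.dense_domain, Submodule.mem_adjoint_iff]
      intro a b hab
      have := (Submodule.mem_orthogonal _ _).1 ho (WithLp.toLp 2 (a, b)) hab
      rw [WithLp.prod_inner_apply] at this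
      simp only [inner_neg_right, sub_neg_eq_add]
      rw [add_comm]
      exact this
    rwa [LinearPMap.isSelfAdjoint_def.1 hA] at h3
  refine ⟨k.fst, k.snd, hk', ?_⟩
  have e1 : k.snd = -o.snd := eq_neg_of_add_eq_zero_left h2.symm
  have e2 : v - k.fst = - -o.fst := by rw [h1]; abel
  rw [e1, e2]
  exact A.graph.neg_mem ho'

/-- Uniqueness for `(A² + 1) x = v`. -/
theorem sq_add_one_unique (hA : IsSelfAdjoint A) {v x y x' y' : H} (h1 : (x, y) ∈ A.graph)
    (h2 : (y, v - x) ∈ A.graph) (h1' : (x', y') ∈ A.graph) (h2' : (y', v - x') ∈ A.graph) :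
    x = x' := by
  have h3 := A.graph.sub_mem h1 h1'
  have h4 := A.graph.sub_mem h2 h2'
  have h5 := inner_eq_of_isSelfAdjoint hA h3 h4
  have e : v - x - (v - x') = -(x - x') := by abel
  simp only [e, inner_neg_right, inner_self_eq_norm_sq_to_K] at h5
  have h6 : ‖y - y'‖ ^ 2 = -‖x - x'‖ ^ 2 := by
    have := congrArg Complex.re h5
    simpa [← Complex.ofReal_pow] using this
  have h7 : ‖x - x'‖ ^ 2 ≤ 0 := by nlinarith [sq_nonneg ‖y - y'‖]
  exact sub_eq_zero.1 (norm_eq_zero.1 (pow_eq_zero_iff two_ne_zero |>.1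
    (le_antisymm h7 (sq_nonneg _))))

theorem norm_sq_sq_add_one (hA : IsSelfAdjoint A) {v x y : H} (h1 : (x, y) ∈ A.graph)
    (h2 : (y, v - x) ∈ A.graph) : ‖x‖ ^ 2 + ‖y‖ ^ 2 = (inner ℂ x v).re := by
  have := inner_eq_of_isSelfAdjoint hA h1 h2
  rw [inner_sub_right, inner_self_eq_norm_sq_to_K, inner_self_eq_norm_sq_to_K] at this
  have := congrArg Complex.re this
  simp only [Complex.sub_re, Complex.coe_algebraMap, ← Complex.ofReal_pow, Complex.ofReal_re]
    at this
  linarith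

theorem norm_le_sq_add_one (hA : IsSelfAdjoint A) {v x y : H} (h1 : (x, y) ∈ A.graph)
    (h2 : (y, v - x) ∈ A.graph) : ‖x‖ ≤ ‖v‖ ∧ ‖y‖ ≤ ‖v‖ := by
  have h := norm_sq_sq_add_one hA h1 h2
  have h3 : (inner ℂ x v).re ≤ ‖x‖ * ‖v‖ := re_inner_le_norm (𝕜 := ℂ) x v
  have hx : ‖x‖ ≤ ‖v‖ := by
    by_contra hc
    nlinarith [norm_nonneg v, sq_nonneg ‖y‖]
  refine ⟨hx, ?_⟩
  apply le_of_sq_le_sq _ (norm_nonneg _)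
  nlinarith [norm_nonneg v, norm_nonneg x]

theorem mem_sq_add_one_graph (hA : IsSelfAdjoint A) {x v : H} :
    (x, v) ∈ (opMul A† A + ofBdd 1).graph ↔ ∃ y, (x, y) ∈ A.graph ∧ (y, v - x) ∈ A.graph := by
  rw [LinearPMap.isSelfAdjoint_def.1 hA, mem_add_graph]
  constructor
  · rintro ⟨z, w, h1, h2, rfl⟩
    obtain ⟨y, h3, h4⟩ := mem_opMul_graph.1 h1
    rw [mem_ofBdd_graph] at h2
    subst h2
    refine ⟨y, h3, ?_⟩
    simpa using h4
  · rintro ⟨y, h1, h2⟩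
    exact ⟨v - x, x, mem_opMul_graph.2 ⟨y, h1, h2⟩, mem_ofBdd_graph.2 rfl, by abel⟩

/-- `sqResolvent A` solves `(A² + 1) x = v`. -/
theorem sqResolvent_spec (hA : IsSelfAdjoint A) (v : H) :
    ∃ y, (sqResolvent A v, y) ∈ A.graph ∧ (y, v - sqResolvent A v) ∈ A.graph := by
  have hker : LinearMap.ker (opMul A† A + ofBdd 1).toFun = ⊥ := by
    apply ker_toFun_eq_bot
    intro x hx
    obtain ⟨y, h1, h2⟩ := (mem_sq_add_one_graph hA).1 hx
    refine sq_add_one_unique hA (v := 0) h1 h2 A.graph.zero_mem ?_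
    rw [sub_zero]
    exact A.graph.zero_mem
  have hg : ∀ v x, (v, x) ∈ (opMul A† A + ofBdd 1).inverse.graph ↔
      ∃ y, (x, y) ∈ A.graph ∧ (y, v - x) ∈ A.graph := fun v x => by
    rw [mem_inverse_graph hker, mem_sq_add_one_graph hA]
  obtain ⟨S, hS⟩ : ∃ S : H →L[ℂ] H, (opMul A† A + ofBdd 1).inverse = ofBdd S := by
    apply exists_eq_ofBdd (C := 1)
    · intro v
      obtain ⟨x, y, h1, h2⟩ := exists_sq_add_one_eq hA v
      exact ⟨x, (hg v x).2 ⟨y, h1, h2⟩⟩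
    · intro v x h
      obtain ⟨y, h1, h2⟩ := (hg v x).1 h
      rw [one_mul]
      exact (norm_le_sq_add_one hA h1 h2).1
  rw [← hg, sqResolvent, hS, bddClosure_ofBdd, mem_ofBdd_graph]

theorem sqResolvent_symm (hA : IsSelfAdjoint A) (u v : H) :
    inner ℂ (sqResolvent A u) v = inner ℂ u (sqResolvent A v) := by
  obtain ⟨y, h1, h2⟩ := sqResolvent_spec hA u
  obtain ⟨z, h3, h4⟩ := sqResolvent_spec hA v
  have e1 := inner_eq_of_isSelfAdjoint hA h1 h4
  have e2 := inner_eq_of_isSelfAdjoint hA h2 h3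
  rw [inner_sub_right] at e1
  rw [inner_sub_left] at e2
  have h : inner ℂ (sqResolvent A u) v - inner ℂ (sqResolvent A u) (sqResolvent A v) =
    inner ℂ u (sqResolvent A v) - inner ℂ (sqResolvent A u) (sqResolvent A v) := by
    rw [← e1, e2]
  exact sub_left_injective h

theorem sqResolvent_nonneg (hA : IsSelfAdjoint A) : 0 ≤ sqResolvent A := by
  rw [ContinuousLinearMap.nonneg_iff_isPositive, ContinuousLinearMap.isPositive_def]
  refine ⟨fun u v => sqResolvent_symm hA u v, fun v => ?_⟩
  obtain ⟨y, h1, h2⟩ := sqResolvent_spec hA v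
  have := norm_sq_sq_add_one hA h1 h2
  rw [ContinuousLinearMap.reApplyInnerSelf]
  change 0 ≤ (inner ℂ (sqResolvent A v) v).re
  rw [← this]
  positivity

theorem norm_sqResolvent_le (hA : IsSelfAdjoint A) : ‖sqResolvent A‖ ≤ 1 := by
  apply ContinuousLinearMap.opNorm_le_bound _ zero_le_one
  intro v
  obtain ⟨y, h1, h2⟩ := sqResolvent_spec hA v
  rw [one_mul]
  exact (norm_le_sq_add_one hA h1 h2).1

/-- The bounded operator `A (A² + 1)⁻¹`. -/
def mulSqResolvent (A : H →ₗ.[ℂ] H) : H →L[ℂ] H := bddClosure (opMul A (ofBdd (sqResolvent A)))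

theorem mulSqResolvent_spec (hA : IsSelfAdjoint A) (v : H) :
    (sqResolvent A v, mulSqResolvent A v) ∈ A.graph ∧
      (mulSqResolvent A v, v - sqResolvent A v) ∈ A.graph := by
  obtain ⟨S, hS⟩ : ∃ S : H →L[ℂ] H, opMul A (ofBdd (sqResolvent A)) = ofBdd S := by
    apply exists_eq_ofBdd (C := 1)
    · intro v
      obtain ⟨y, h1, h2⟩ := sqResolvent_spec hA v
      exact ⟨y, mem_opMul_graph.2 ⟨_, mem_ofBdd_graph.2 rfl, h1⟩⟩
    · intro v x h
      obtain ⟨y, h1, h2⟩ := mem_opMul_graph.1 h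
      rw [mem_ofBdd_graph] at h1
      subst h1
      obtain ⟨z, h3, h4⟩ := sqResolvent_spec hA v
      rw [A.mem_graph_snd_inj h2 h3 rfl, one_mul]
      exact (norm_le_sq_add_one hA h3 h4).2
  have h : (sqResolvent A v, mulSqResolvent A v) ∈ A.graph := by
    have h1 : (v, S v) ∈ (opMul A (ofBdd (sqResolvent A))).graph := by
      rw [hS, mem_ofBdd_graph]
    obtain ⟨y, h2, h3⟩ := mem_opMul_graph.1 h1
    rw [mem_ofBdd_graph] at h2
    subst h2
    rwa [mulSqResolvent, hS, bddClosure_ofBdd]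
  refine ⟨h, ?_⟩
  obtain ⟨z, h3, h4⟩ := sqResolvent_spec hA v
  rwa [A.mem_graph_snd_inj h h3 rfl]

theorem sqResolvent_mem_graph (hA : IsSelfAdjoint A) {x y : H} (h : (x, y) ∈ A.graph) :
    (sqResolvent A x, sqResolvent A y) ∈ A.graph := by
  obtain ⟨h1, h2⟩ := mulSqResolvent_spec hA x
  obtain ⟨h3, h4⟩ := mulSqResolvent_spec hA y
  have : mulSqResolvent A x = sqResolvent A y :=
    sq_add_one_unique hA h2 (A.graph.sub_mem h h1) h3 h4
  rwa [← this]

/-- The graph of `A`, described by bounded operators. -/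
theorem mem_graph_iff_sqResolvent (hA : IsSelfAdjoint A) {x y : H} :
    (x, y) ∈ A.graph ↔ mulSqResolvent A x = sqResolvent A y := by
  constructor
  · intro h
    exact A.mem_graph_snd_inj (mulSqResolvent_spec hA x).1 (sqResolvent_mem_graph hA h) rfl
  · intro h
    obtain ⟨h1, h2⟩ := mulSqResolvent_spec hA x
    obtain ⟨h3, h4⟩ := mulSqResolvent_spec hA y
    rw [h] at h1 h2
    have h5 := A.graph.add_mem h1 h4
    have := A.mem_graph_snd_inj h2 h3 rfl
    simp only [Prod.mk_add_mk, ← this] at h5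
    convert h5 using 2 <;> abel

theorem commute_sqResolvent_mulSqResolvent (hA : IsSelfAdjoint A) :
    Commute (sqResolvent A) (mulSqResolvent A) := by
  ext v
  exact A.mem_graph_snd_inj (sqResolvent_mem_graph hA (mulSqResolvent_spec hA v).1)
    (mulSqResolvent_spec hA _).1 rfl

end SqResolvent

/-! ### The operators `(A² + μ)^(-1/2)` -/

section Bracket

variable {H : Type*} [NormedAddCommGroup H] [InnerProductSpace ℂ H] [CompleteSpace H]
  {A : H →ₗ.[ℂ] H}

theorem sqResolvent_isSelfAdjoint (hA : IsSelfAdjoint A) : IsSelfAdjoint (sqResolvent A) :=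
  IsSelfAdjoint.of_nonneg (sqResolvent_nonneg hA)

theorem spectrum_sqResolvent (hA : IsSelfAdjoint A) {t : ℝ} (ht : t ∈ spectrum ℝ (sqResolvent A)) :
    0 ≤ t ∧ t ≤ 1 := by
  refine ⟨spectrum_nonneg_of_nonneg (sqResolvent_nonneg hA) ht, ?_⟩
  have h1 : (t : ℂ) ∈ spectrum ℂ (sqResolvent A) := spectrum.algebraMap_mem ℂ ht
  have h2 := spectrum.norm_le_norm_mul_of_mem h1
  have h3 : ‖(1 : H →L[ℂ] H)‖ ≤ 1 := ContinuousLinearMap.norm_id_le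
  have h4 := norm_sqResolvent_le hA
  rw [Complex.norm_real] at h2
  calc t ≤ ‖t‖ := Real.le_norm_self t
    _ ≤ _ := h2
    _ ≤ 1 * 1 := mul_le_mul h4 h3 (norm_nonneg _) zero_le_one
    _ = 1 := one_mul 1

/-- For `μ > 0`, `⟨A⟩_μ ^ (-γ)` is given by the real functional calculus. -/
theorem bracketNeg_eq_cfc (hA : IsSelfAdjoint A) {μ : ℝ} (hμ : 0 < μ) (γ : ℝ) :
    bracketNeg A (μ : ℂ) γ =
      cfc (fun t : ℝ => (t / ((1 - t) + μ * t)) ^ (γ / 2)) (sqResolvent A) := by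
  rw [bracketNeg, cfc_real_eq_complex _ (sqResolvent_isSelfAdjoint hA)]
  apply cfc_congr
  intro z hz
  have h1 := (sqResolvent_isSelfAdjoint hA).mem_spectrum_eq_re hz
  have h2 : z.re ∈ spectrum ℝ (sqResolvent A) := by
    rw [h1] at hz
    exact (spectrum.algebraMap_mem_iff ℂ).1 hz
  obtain ⟨h3, h4⟩ := spectrum_sqResolvent hA h2
  have h5 : 0 ≤ z.re / ((1 - z.re) + μ * z.re) := by
    apply div_nonneg h3
    nlinarith
  simp only
  rw [Complex.ofReal_cpow h5]
  nth_rewrite 1 2 3 [h1]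
  push_cast
  rfl

theorem bracketNeg_zero (hA : IsSelfAdjoint A) : bracketNeg A 1 0 = 1 := by
  have := bracketNeg_eq_cfc hA one_pos 0
  simp only [zero_div, Real.rpow_zero, Complex.ofReal_one] at this
  rw [this, cfc_const_one ℝ _ (sqResolvent_isSelfAdjoint hA)]

theorem bracketNeg_two (hA : IsSelfAdjoint A) : bracketNeg A 1 2 = sqResolvent A := by
  have := bracketNeg_eq_cfc hA one_pos 2
  norm_num at this
  rw [this, cfc_id' ℝ _ (sqResolvent_isSelfAdjoint hA)]

/-- `(A² + μ)^(-1/2)` for `μ > 0`. -/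
def sqrtResolvent (A : H →ₗ.[ℂ] H) (μ : ℝ) : H →L[ℂ] H :=
  cfc (fun t : ℝ => √(t / ((1 - t) + μ * t))) (sqResolvent A)

theorem bracketNeg_one (hA : IsSelfAdjoint A) {μ : ℝ} (hμ : 0 < μ) :
    bracketNeg A (μ : ℂ) 1 = sqrtResolvent A μ := by
  rw [bracketNeg_eq_cfc hA hμ, sqrtResolvent]
  congr 1
  ext t
  rw [Real.sqrt_eq_rpow]

theorem denom_pos {μ t : ℝ} (hμ : 0 < μ) (h0 : 0 ≤ t) (h1 : t ≤ 1) : 0 < (1 - t) + μ * t := by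
  rcases h0.eq_or_lt with rfl | h
  · norm_num
  · have := mul_pos hμ h
    linarith

theorem continuousOn_sqrt_div (hA : IsSelfAdjoint A) {μ : ℝ} (hμ : 0 < μ) {p : ℝ → ℝ}
    (hp : Continuous p) :
    ContinuousOn (fun t : ℝ => √(p t / ((1 - t) + μ * t))) (spectrum ℝ (sqResolvent A)) := by
  apply ContinuousOn.sqrt
  apply ContinuousOn.div hp.continuousOn (by fun_prop)
  intro t ht
  obtain ⟨h0, h1⟩ := spectrum_sqResolvent hA ht
  exact (denom_pos hμ h0 h1).ne'

theorem sqrtResolvent_symm (A : H →ₗ.[ℂ] H) (μ : ℝ) (x y : H) :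
    inner ℂ (sqrtResolvent A μ x) y = inner ℂ x (sqrtResolvent A μ y) := by
  have h : IsSelfAdjoint (sqrtResolvent A μ) := cfc_predicate _ _
  exact (ContinuousLinearMap.isSelfAdjoint_iff_isSymmetric.1 h) x y

theorem commute_sqrtResolvent {S : H →L[ℂ] H} (h : Commute (sqResolvent A) S) (μ : ℝ) :
    Commute (sqrtResolvent A μ) S := h.cfc_real _

/-- `(A² + μ)⁻¹ = Q C` where `Q = (A² + 1)⁻¹` and `C` is the inverse of `(1 - Q) + μ Q`. -/
theorem exists_sqrtResolvent_sq (hA : IsSelfAdjoint A) {μ : ℝ} (hμ : 0 < μ) :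
    ∃ C : H →L[ℂ] H, ∀ v, sqrtResolvent A μ (sqrtResolvent A μ v) = sqResolvent A (C v) ∧
      v = C v - sqResolvent A (C v) + (μ : ℂ) • sqResolvent A (C v) := by
  have hs := sqResolvent_isSelfAdjoint hA
  have hc : ContinuousOn (fun t : ℝ => √(t / ((1 - t) + μ * t))) (spectrum ℝ (sqResolvent A)) :=
    continuousOn_sqrt_div hA hμ continuous_id
  have hd : ∀ t ∈ spectrum ℝ (sqResolvent A), 0 < (1 - t) + μ * t := fun t ht =>
    denom_pos hμ (spectrum_sqResolvent hA ht).1 (spectrum_sqResolvent hA ht).2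
  have hci : ContinuousOn (fun t : ℝ => ((1 - t) + μ * t)⁻¹) (spectrum ℝ (sqResolvent A)) :=
    ContinuousOn.inv₀ (by fun_prop) fun t ht => (hd t ht).ne'
  have h1 : sqrtResolvent A μ * sqrtResolvent A μ =
      sqResolvent A * cfc (fun t : ℝ => ((1 - t) + μ * t)⁻¹) (sqResolvent A) := by
    conv_rhs => lhs; rw [← cfc_id' ℝ (sqResolvent A) hs]
    rw [sqrtResolvent, ← cfc_mul _ _ _ hc hc, ← cfc_mul _ _ _ (by fun_prop) hci]
    apply cfc_congr
    intro t ht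
    simp only
    rw [Real.mul_self_sqrt (div_nonneg (spectrum_sqResolvent hA ht).1 (hd t ht).le),
      div_eq_mul_inv]
  have h2 : ((1 - sqResolvent A) + (μ : ℂ) • sqResolvent A) *
      cfc (fun t : ℝ => ((1 - t) + μ * t)⁻¹) (sqResolvent A) = 1 := by
    have h3 : (1 - sqResolvent A) + (μ : ℂ) • sqResolvent A =
        cfc (fun t : ℝ => (1 - t) + μ * t) (sqResolvent A) := by
      rw [cfc_add (sqResolvent A) (fun t : ℝ => 1 - t) (fun t => μ * t),
        cfc_sub (fun _ : ℝ => 1) (fun t => t) (sqResolvent A), cfc_const_one ℝ _ hs,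
        cfc_id' ℝ _ hs, cfc_const_mul μ (fun t : ℝ => t), cfc_id' ℝ _ hs]
      rfl
    rw [h3, ← cfc_mul _ _ _ (by fun_prop) hci, ← cfc_const_one ℝ (sqResolvent A) hs]
    apply cfc_congr
    intro t ht
    exact mul_inv_cancel₀ (hd t ht).ne'
  exact ⟨_, fun v => ⟨congrArg (fun S : H →L[ℂ] H => S v) h1,
    (congrArg (fun S : H →L[ℂ] H => S v) h2).symm⟩⟩

/-- `⟨A⟩_μ⁻¹ = ⟨A⟩⁻¹ K` with a contraction `K`, for `μ ≥ 1`. -/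
theorem exists_sqrtResolvent_factor (hA : IsSelfAdjoint A) {μ : ℝ} (hμ : 1 ≤ μ) :
    ∃ K : H →L[ℂ] H, (∀ v, ‖K v‖ ≤ ‖v‖) ∧
      (∀ v, sqrtResolvent A 1 (K v) = sqrtResolvent A μ v) ∧
      Commute K (sqrtResolvent A μ) := by
  have hμ0 : 0 < μ := by linarith
  have hc := continuousOn_sqrt_div hA hμ0 (p := fun _ => 1) continuous_const
  have hc1 : ContinuousOn (fun t : ℝ => √(t / ((1 - t) + 1 * t))) (spectrum ℝ (sqResolvent A)) :=
    continuousOn_sqrt_div hA one_pos continuous_id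
  refine ⟨cfc (fun t : ℝ => √(1 / ((1 - t) + μ * t))) (sqResolvent A), fun v => ?_, fun v => ?_,
    cfc_commute_cfc _ _ _⟩
  · apply ContinuousLinearMap.le_of_opNorm_le_of_le _ _ le_rfl |>.trans (one_mul _).le
    apply norm_cfc_le zero_le_one
    intro t ht
    obtain ⟨h0, h1⟩ := spectrum_sqResolvent hA ht
    rw [Real.norm_of_nonneg (Real.sqrt_nonneg _)]
    apply Real.sqrt_le_one.2
    rw [div_le_one (denom_pos hμ0 h0 h1)]
    nlinarith
  · rw [sqrtResolvent, sqrtResolvent, ← mul_apply_eq_comp,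
      ← cfc_mul _ _ _ hc1 hc]
    congr 1
    apply cfc_congr
    intro t ht
    obtain ⟨h0, h1⟩ := spectrum_sqResolvent hA ht
    simp only
    rw [one_mul, sub_add_cancel, div_one, ← Real.sqrt_mul h0, mul_one_div]

theorem sqrtResolvent_mem_graph (hA : IsSelfAdjoint A) (μ : ℝ) {x y : H} (h : (x, y) ∈ A.graph) :
    (sqrtResolvent A μ x, sqrtResolvent A μ y) ∈ A.graph := by
  rw [mem_graph_iff_sqResolvent hA] at h ⊢
  have h1 := commute_sqrtResolvent (commute_sqResolvent_mulSqResolvent hA) μ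
  have h2 := commute_sqrtResolvent (Commute.refl (sqResolvent A)) μ
  have e1 : sqrtResolvent A μ (mulSqResolvent A x) = mulSqResolvent A (sqrtResolvent A μ x) :=
    congrArg (fun S : H →L[ℂ] H => S x) h1
  have e2 : sqrtResolvent A μ (sqResolvent A y) = sqResolvent A (sqrtResolvent A μ y) :=
    congrArg (fun S : H →L[ℂ] H => S y) h2
  rw [← e1, ← e2, h]

/-- `(A² + μ) W² = 1` for `W = (A² + μ)^(-1/2)`. -/
theorem sqrtResolvent_sq_spec (hA : IsSelfAdjoint A) {μ : ℝ} (hμ : 0 < μ) :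
    ∃ M : H →L[ℂ] H, ∀ v, (sqrtResolvent A μ (sqrtResolvent A μ v), M v) ∈ A.graph ∧
      (M v, v - (μ : ℂ) • sqrtResolvent A μ (sqrtResolvent A μ v)) ∈ A.graph := by
  obtain ⟨C, hC⟩ := exists_sqrtResolvent_sq hA hμ
  refine ⟨(mulSqResolvent A).comp C, fun v => ?_⟩
  obtain ⟨h1, h2⟩ := hC v
  obtain ⟨h3, h4⟩ := mulSqResolvent_spec hA (C v)
  rw [h1]
  refine ⟨h3, ?_⟩
  have : v - (μ : ℂ) • sqResolvent A (C v) = C v - sqResolvent A (C v) := by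
    nth_rewrite 1 [h2]
    abel
  rwa [this]

theorem sqrtResolvent_injective (hA : IsSelfAdjoint A) {μ : ℝ} (hμ : 0 < μ) {v : H}
    (hv : sqrtResolvent A μ v = 0) : v = 0 := by
  obtain ⟨M, hM⟩ := sqrtResolvent_sq_spec hA hμ
  obtain ⟨h1, h2⟩ := hM v
  rw [hv, map_zero] at h1 h2
  rw [LinearPMap.graph_fst_eq_zero_snd _ h1 rfl] at h2
  have := LinearPMap.graph_fst_eq_zero_snd _ h2 rfl
  rwa [smul_zero, sub_zero] at this

/-- The bounded operator `A (A² + μ)^(-1/2)` for `μ > 0`. -/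
def mulSqrtResolvent (A : H →ₗ.[ℂ] H) (μ : ℝ) : H →L[ℂ] H :=
  bddClosure (opMul A (ofBdd (sqrtResolvent A μ)))

theorem mulSqrtResolvent_spec (hA : IsSelfAdjoint A) {μ : ℝ} (hμ : 0 < μ) (v : H) :
    (sqrtResolvent A μ v, mulSqrtResolvent A μ v) ∈ A.graph := by
  set W := sqrtResolvent A μ with hW
  have hd : DenseRange W := denseRange_of_symm_of_injective W (sqrtResolvent_symm A μ)
    fun x hx => sqrtResolvent_injective hA hμ hx
  obtain ⟨M, hM⟩ := sqrtResolvent_sq_spec hA hμ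
  -- `‖A W² k‖² = ⟨W² k, k - μ W² k⟩ = ‖W k‖² - μ ‖W² k‖²`
  have hb : ∀ k, ‖M k‖ ≤ 1 * ‖W k‖ := fun k => by
    obtain ⟨h1, h2⟩ := hM k
    have h3 := inner_eq_of_isSelfAdjoint hA h1 h2
    have h4 : inner ℂ (W (W k)) k = inner ℂ (W k) (W k) := sqrtResolvent_symm A μ _ _
    rw [inner_sub_right, inner_smul_right, h4, inner_self_eq_ofReal, inner_self_eq_ofReal,
      inner_self_eq_ofReal] at h3
    have h5 : ‖M k‖ ^ 2 = ‖W k‖ ^ 2 - μ * ‖W (W k)‖ ^ 2 := by exact_mod_cast h3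
    rw [one_mul]
    apply le_of_sq_le_sq _ (norm_nonneg _)
    rw [h5]
    linarith [mul_nonneg hμ.le (sq_nonneg ‖W (W k)‖)]
  obtain ⟨N, hN, hN'⟩ := exists_factor_of_denseRange W M hd hb
  have hg : ∀ v, (W v, N v) ∈ A.graph := fun v => by
    refine hd.induction_on (p := fun v => (W v, N v) ∈ A.graph) v ?_ fun k => ?_
    · exact hA.isClosed.preimage (f := fun v => (W v, N v)) (by fun_prop)
    · rw [hN]
      exact (hM k).1
  have he : opMul A (ofBdd W) = ofBdd N := by
    apply LinearPMap.eq_of_eq_graph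
    ext ⟨x, y⟩
    rw [mem_opMul_graph, mem_ofBdd_graph]
    constructor
    · rintro ⟨z, h1, h2⟩
      rw [mem_ofBdd_graph] at h1
      subst h1
      exact A.mem_graph_snd_inj h2 (hg x) rfl
    · rintro rfl
      exact ⟨W x, mem_ofBdd_graph.2 rfl, hg x⟩
  rw [mulSqrtResolvent, ← hW, he, bddClosure_ofBdd]
  exact hg v

theorem mulSqrtResolvent_comm (hA : IsSelfAdjoint A) {μ : ℝ} (hμ : 0 < μ) (v : H) :
    mulSqrtResolvent A μ (sqrtResolvent A μ v) = sqrtResolvent A μ (mulSqrtResolvent A μ v) :=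
  A.mem_graph_snd_inj (mulSqrtResolvent_spec hA hμ _)
    (sqrtResolvent_mem_graph hA μ (mulSqrtResolvent_spec hA hμ v)) rfl

theorem mulSqrtResolvent_symm (hA : IsSelfAdjoint A) {μ : ℝ} (hμ : 0 < μ) (x y : H) :
    inner ℂ (mulSqrtResolvent A μ x) y = inner ℂ x (mulSqrtResolvent A μ y) := by
  have hd : DenseRange (sqrtResolvent A μ) :=
    denseRange_of_symm_of_injective _ (sqrtResolvent_symm A μ)
      fun x hx => sqrtResolvent_injective hA hμ hx
  refine hd.induction_on (p := fun y => inner ℂ (mulSqrtResolvent A μ x) y =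
    inner ℂ x (mulSqrtResolvent A μ y)) y (isClosed_eq (by fun_prop) (by fun_prop)) fun k => ?_
  rw [mulSqrtResolvent_comm hA hμ, ← sqrtResolvent_symm A μ x]
  exact inner_eq_of_isSelfAdjoint hA (mulSqrtResolvent_spec hA hμ x)
    (mulSqrtResolvent_spec hA hμ k)

/-- `N² + μ W² = 1` for `W = (A² + μ)^(-1/2)` and `N = A W`. -/
theorem mulSqrtResolvent_sq (hA : IsSelfAdjoint A) {μ : ℝ} (hμ : 0 < μ) (v : H) :
    mulSqrtResolvent A μ (mulSqrtResolvent A μ v) +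
      (μ : ℂ) • sqrtResolvent A μ (sqrtResolvent A μ v) = v := by
  obtain ⟨M, hM⟩ := sqrtResolvent_sq_spec hA hμ
  obtain ⟨h1, h2⟩ := hM v
  have h3 := mulSqrtResolvent_spec hA hμ (sqrtResolvent A μ v)
  have h4 := A.mem_graph_snd_inj h3 h1 rfl
  rw [← h4, mulSqrtResolvent_comm hA hμ] at h2
  rw [A.mem_graph_snd_inj (mulSqrtResolvent_spec hA hμ (mulSqrtResolvent A μ v)) h2 rfl]
  abel

theorem mulSqrtResolvent_of_mem_graph (hA : IsSelfAdjoint A) {μ : ℝ} (hμ : 0 < μ) {x y : H}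
    (h : (x, y) ∈ A.graph) : mulSqrtResolvent A μ x = sqrtResolvent A μ y :=
  A.mem_graph_snd_inj (mulSqrtResolvent_spec hA hμ x) (sqrtResolvent_mem_graph hA μ h) rfl

end Bracket

/-! ### Weak derivatives and the Fourier transform -/

section WeakDerivative

open FourierTransform LineDeriv
open scoped SchwartzMap

variable {d r : ℕ} {H : Type*} [NormedAddCommGroup H] [InnerProductSpace ℂ H]

theorem integrable_smul_of_memLp {φ : Rn d → ℂ} (hφ : MemLp φ 2 volume) (f : L2 d r H) :
    Integrable (fun x => φ x • f x) :=
  memLp_one_iff_integrable.1 ((Lp.memLp f).smul hφ)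

theorem integral_smul_complex_of_mem_derivGraph {i : Fin d} {f g : L2 d r H}
    (h : (f, g) ∈ derivGraph i) {ψ : Rn d → ℂ} (hψ : ContDiff ℝ ∞ ψ) (hc : HasCompactSupport ψ) :
    ∫ x, fderiv ℝ ψ x (EuclideanSpace.single i 1) • f x = -∫ x, ψ x • g x := by
  have hdiff : ∀ x, DifferentiableAt ℝ ψ x := fun x => (hψ.differentiable (by simp)) x
  have hre : ContDiff ℝ ∞ (fun x => (ψ x).re) := Complex.reCLM.contDiff.comp hψ
  have him : ContDiff ℝ ∞ (fun x => (ψ x).im) := Complex.imCLM.contDiff.comp hψ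
  have hrec : HasCompactSupport (fun x => (ψ x).re) := hc.comp_left (g := Complex.re) rfl
  have himc : HasCompactSupport (fun x => (ψ x).im) := hc.comp_left (g := Complex.im) rfl
  have h1 := h _ hre hrec
  have h2 := h _ him himc
  have e1 : ∀ x, partialDeriv i (fun x => (ψ x).re) x =
      (fderiv ℝ ψ x (EuclideanSpace.single i 1)).re := fun x => by
    have := (Complex.reCLM.hasFDerivAt.comp x (hdiff x).hasFDerivAt).fderiv
    exact congrArg (fun L : Rn d →L[ℝ] ℝ => L (EuclideanSpace.single i 1)) this
  have e2 : ∀ x, partialDeriv i (fun x => (ψ x).im) x =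
      (fderiv ℝ ψ x (EuclideanSpace.single i 1)).im := fun x => by
    have := (Complex.imCLM.hasFDerivAt.comp x (hdiff x).hasFDerivAt).fderiv
    exact congrArg (fun L : Rn d →L[ℝ] ℝ => L (EuclideanSpace.single i 1)) this
  have key : ∀ (θ : Rn d → ℂ) (u : L2 d r H), Integrable (fun x => (θ x).re • u x) →
      Integrable (fun x => (θ x).im • u x) →
      ∫ x, θ x • u x = (∫ x, (θ x).re • u x) + Complex.I • ∫ x, (θ x).im • u x := by
    intro θ u i1 i2
    have h3 := integral_add i1 (i2.smul Complex.I)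
    simp only [Pi.smul_apply] at h3
    rw [← integral_smul, ← h3]
    congr 1
    ext1 x
    conv_lhs => rw [← Complex.re_add_im (θ x)]
    rw [add_smul, mul_comm, mul_smul, Complex.coe_smul, Complex.coe_smul]
  have i1 := integrable_test_smul f (continuous_partialDeriv i hre)
    (hasCompactSupport_partialDeriv i hrec)
  have i2 := integrable_test_smul f (continuous_partialDeriv i him)
    (hasCompactSupport_partialDeriv i himc)
  simp only [e1, e2] at i1 i2 h1 h2
  rw [key _ f i1 i2, key _ g (integrable_test_smul g hre.continuous hrec)
    (integrable_test_smul g him.continuous himc), h1, h2, neg_add, smul_neg]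

/-- The weak derivative identity extends from test functions to Schwartz functions, by cutting
off at radius `n → ∞`. -/
theorem integral_smul_schwartz_of_mem_derivGraph {i : Fin d} {f g : L2 d r H}
    (h : (f, g) ∈ derivGraph i) (φ : 𝓢(Rn d, ℂ)) :
    ∫ x, (∂_{EuclideanSpace.single i (1 : ℝ)} φ) x • f x = -∫ x, φ x • g x := by
  let e : Rn d := EuclideanSpace.single i 1
  let χ : ContDiffBump (0 : Rn d) := ⟨1, 2, one_pos, one_lt_two⟩
  let t : ℕ → ℝ := fun n => (n + 1 : ℝ)⁻¹
  have ht0 : ∀ n, 0 < t n := fun n => by positivity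
  have ht1 : ∀ n, t n ≤ 1 := fun n => by
    apply inv_le_one_of_one_le₀
    linarith [(Nat.cast_nonneg n : (0 : ℝ) ≤ n)]
  have htt : Tendsto t atTop (𝓝 0) := tendsto_inv_atTop_zero.comp
    (tendsto_atTop_add_const_right _ _ tendsto_natCast_atTop_atTop)
  have hχ : ContDiff ℝ ∞ (χ : Rn d → ℝ) := χ.contDiff
  have hχd : ∀ x, DifferentiableAt ℝ (χ : Rn d → ℝ) x := hχ.differentiable (by simp)
  have hφd : ∀ x, DifferentiableAt ℝ φ x := fun x => φ.differentiableAt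
  have hχ1 : ∀ x, ‖χ x‖ ≤ 1 := fun x => by
    rw [Real.norm_of_nonneg χ.nonneg]
    exact χ.le_one
  obtain ⟨C, hC⟩ := (hχ.continuous_fderiv (by simp)).bounded_above_of_compact_support
    (χ.hasCompactSupport.fderiv ℝ)
  have hC0 : 0 ≤ C := (norm_nonneg _).trans (hC 0)
  have he : ‖e‖ = 1 := by simp [e]
  let ψ : ℕ → Rn d → ℂ := fun n x => χ (t n • x) • φ x
  have hψ : ∀ n, ContDiff ℝ ∞ (ψ n) := fun n =>
    (hχ.comp (contDiff_const_smul (t n))).smul (φ.smooth ⊤)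
  have hψc : ∀ n, HasCompactSupport (ψ n) := fun n =>
    (χ.hasCompactSupport.comp_smul (ht0 n).ne').smul_right
  have hψ' : ∀ n x, fderiv ℝ (ψ n) x e =
      χ (t n • x) • (∂_{e} φ) x + (t n * fderiv ℝ χ (t n • x) e) • φ x := fun n x => by
    have h1 : HasFDerivAt (fun x => χ (t n • x)) (t n • fderiv ℝ χ (t n • x)) x := by
      have := (hχd (t n • x)).hasFDerivAt.comp x ((hasFDerivAt_id x).const_smul (t n))
      have h0 : t n • fderiv ℝ χ (t n • x) =
          (fderiv ℝ χ (t n • x)).comp (t n • ContinuousLinearMap.id ℝ (Rn d)) := by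
        ext v
        simp
      rw [h0]
      exact this
    have h2 := (h1.smul (hφd x).hasFDerivAt).fderiv
    have h3 := congrArg (fun L : Rn d →L[ℝ] ℂ => L e) h2
    rw [SchwartzMap.lineDerivOp_apply_eq_fderiv]
    refine Eq.trans h3 ?_
    simp
  have hn : ∀ n x, ‖fderiv ℝ (ψ n) x e‖ ≤ ‖(∂_{e} φ) x‖ + C * ‖φ x‖ := fun n x => by
    rw [hψ']
    refine (norm_add_le _ _).trans (add_le_add ?_ ?_)
    · rw [norm_smul]
      exact mul_le_of_le_one_left (norm_nonneg _) (hχ1 _)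
    · rw [norm_smul, norm_mul, Real.norm_of_nonneg (ht0 n).le]
      apply mul_le_mul_of_nonneg_right _ (norm_nonneg _)
      have h4 : ‖fderiv ℝ χ (t n • x) e‖ ≤ C := by
        refine (ContinuousLinearMap.le_opNorm _ _).trans ?_
        rw [he, mul_one]
        exact hC _
      calc t n * ‖fderiv ℝ χ (t n • x) e‖ ≤ 1 * C :=
            mul_le_mul (ht1 n) h4 (norm_nonneg _) zero_le_one
        _ = C := one_mul C
  have hev : ∀ x : Rn d, ∀ᶠ n in atTop, ‖t n • x‖ < 1 := fun x => by
    have h5 : Tendsto (fun n => ‖t n • x‖) atTop (𝓝 0) := by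
      have := (htt.smul_const x).norm
      simpa using this
    exact h5.eventually_lt_const one_pos
  have hlimχ : ∀ x, Tendsto (fun n => χ (t n • x)) atTop (𝓝 1) := fun x => by
    apply tendsto_const_nhds.congr'
    filter_upwards [hev x] with n h6
    refine (χ.one_of_mem_closedBall ?_).symm
    rw [mem_closedBall_zero_iff]
    exact h6.le
  have hlim1 : ∀ x, Tendsto (fun n => fderiv ℝ (ψ n) x e • f x) atTop (𝓝 ((∂_{e} φ) x • f x)) := by
    intro x
    apply Tendsto.smul_const
    simp only [hψ']
    have h7 : Tendsto (fun n => t n * fderiv ℝ χ (t n • x) e) atTop (𝓝 0) := by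
      have h8 : Tendsto (fun n => fderiv ℝ χ (t n • x) e) atTop (𝓝 (fderiv ℝ χ 0 e)) := by
        have h9 : Continuous fun y => fderiv ℝ χ y e :=
          (hχ.continuous_fderiv (by simp)).clm_apply continuous_const
        refine (h9.tendsto 0).comp ?_
        have := htt.smul_const x
        rwa [zero_smul] at this
      have := htt.mul h8
      rwa [zero_mul] at this
    have := ((hlimχ x).smul_const ((∂_{e} φ) x)).add (h7.smul_const (φ x))
    rwa [one_smul, zero_smul, add_zero] at this
  have hlim2 : ∀ x, Tendsto (fun n => ψ n x • g x) atTop (𝓝 (φ x • g x)) := by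
    intro x
    apply Tendsto.smul_const
    have := (hlimχ x).smul_const (φ x)
    rwa [one_smul] at this
  have hI1 : Integrable (fun x => (‖(∂_{e} φ) x‖ + C * ‖φ x‖) * ‖f x‖) := by
    have a1 := (integrable_smul_of_memLp ((∂_{e} φ).memLp 2) f).norm
    have a2 := (integrable_smul_of_memLp (φ.memLp 2) f).norm.const_mul C
    refine (a1.add a2).congr (Eventually.of_forall fun x => ?_)
    simp only [Pi.add_apply, norm_smul]
    ring
  have hI2 : Integrable (fun x => ‖φ x‖ * ‖g x‖) := by
    refine (integrable_smul_of_memLp (φ.memLp 2) g).norm.congr (Eventually.of_forall fun x => ?_)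
    simp only [norm_smul]
  have L1 := tendsto_integral_of_dominated_convergence
    (F := fun n x => fderiv ℝ (ψ n) x e • f x) (f := fun x => (∂_{e} φ) x • f x) _
    (fun n => by
      have : Continuous fun x => fderiv ℝ (ψ n) x e :=
        ((hψ n).continuous_fderiv (by simp)).clm_apply continuous_const
      exact this.aestronglyMeasurable.smul (Lp.aestronglyMeasurable f)) hI1
    (fun n => Eventually.of_forall fun x => by
      rw [norm_smul]
      exact mul_le_mul_of_nonneg_right (hn n x) (norm_nonneg _))
    (Eventually.of_forall hlim1)
  have L2' := tendsto_integral_of_dominated_convergence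
    (F := fun n x => ψ n x • g x) (f := fun x => φ x • g x) _
    (fun n => (hψ n).continuous.aestronglyMeasurable.smul (Lp.aestronglyMeasurable g)) hI2
    (fun n => Eventually.of_forall fun x => by
      rw [norm_smul]
      apply mul_le_mul_of_nonneg_right _ (norm_nonneg _)
      simp only [ψ, norm_smul]
      exact mul_le_of_le_one_left (norm_nonneg _) (hχ1 _))
    (Eventually.of_forall hlim2)
  refine tendsto_nhds_unique L1 ?_
  refine L2'.neg.congr fun n => ?_
  exact (integral_smul_complex_of_mem_derivGraph h (hψ n) (hψc n)).symm

variable [CompleteSpace H]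

/-- Weak derivatives in `L²` are derivatives of tempered distributions. -/
theorem mem_derivGraph_iff_lineDeriv {i : Fin d} {f g : L2 d r H} :
    (f, g) ∈ derivGraph i ↔
      ∂_{EuclideanSpace.single i (1 : ℝ)} (f : 𝓢'(Rn d, PiLp 2 fun _ : Fin r => H)) =
        (g : 𝓢'(Rn d, PiLp 2 fun _ : Fin r => H)) := by
  constructor
  · intro h
    ext1 φ
    rw [TemperedDistribution.lineDerivOp_apply_apply, map_neg, Lp.toTemperedDistribution_apply,
      Lp.toTemperedDistribution_apply, integral_smul_schwartz_of_mem_derivGraph h, neg_neg]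
  · intro h η hη hc
    have hc' : HasCompactSupport (Complex.ofRealCLM ∘ η) := hc.comp_left rfl
    have hη' : ContDiff ℝ ∞ (Complex.ofRealCLM ∘ η) := by fun_prop
    have h1 := congrArg (fun T : 𝓢'(Rn d, PiLp 2 fun _ : Fin r => H) =>
      T (hc'.toSchwartzMap hη')) h
    rw [TemperedDistribution.lineDerivOp_apply_apply, map_neg, Lp.toTemperedDistribution_apply,
      Lp.toTemperedDistribution_apply] at h1
    have e1 : ∀ x, (∂_{EuclideanSpace.single i (1 : ℝ)} (hc'.toSchwartzMap hη')) x • f x =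
        partialDeriv i η x • f x := fun x => by
      rw [SchwartzMap.lineDerivOp_apply_eq_fderiv]
      have h2 : fderiv ℝ (Complex.ofRealCLM ∘ η) x = Complex.ofRealCLM.comp (fderiv ℝ η x) :=
        (Complex.ofRealCLM.hasFDerivAt.comp x
          ((hη.differentiable (by simp)) x).hasFDerivAt).fderiv
      have h3 : fderiv ℝ (hc'.toSchwartzMap hη') x (EuclideanSpace.single i 1) =
          ((partialDeriv i η x : ℝ) : ℂ) :=
        congrArg (fun L : Rn d →L[ℝ] ℂ => L (EuclideanSpace.single i 1)) h2
      rw [h3, Complex.coe_smul]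
    have e2 : ∀ x, (hc'.toSchwartzMap hη') x • g x = η x • g x := fun x => by
      change ((η x : ℝ) : ℂ) • g x = _
      rw [Complex.coe_smul]
    simp only [e1, e2] at h1
    exact neg_eq_iff_eq_neg.1 h1

/-- On the Fourier side, `∂_i` is multiplication by `2 π i ξ_i`. -/
theorem mem_derivGraph_iff_fourier {i : Fin d} {f g : L2 d r H} :
    (f, g) ∈ derivGraph i ↔
      ∀ᵐ ξ, (𝓕 g : L2 d r H) ξ = (2 * Real.pi * Complex.I * (ξ i : ℝ)) • (𝓕 f : L2 d r H) ξ := by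
  have htg : (fun ξ : Rn d => ((inner ℝ ξ (EuclideanSpace.single i (1 : ℝ)) : ℝ) : ℂ)
      ).HasTemperateGrowth := by fun_prop
  have hin : ∀ ξ : Rn d, inner ℝ ξ (EuclideanSpace.single i (1 : ℝ)) = ξ i := fun ξ => by
    simp [EuclideanSpace.inner_single_right]
  have hcont : Continuous fun ξ : Rn d => (2 * Real.pi * Complex.I * (ξ i : ℝ) : ℂ) := by fun_prop
  have h0 : (f, g) ∈ derivGraph i ↔ ∀ φ : 𝓢(Rn d, ℂ),
      ∫ ξ, φ ξ • (2 * Real.pi * Complex.I * (ξ i : ℝ) : ℂ) • (𝓕 f : L2 d r H) ξ =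
        ∫ ξ, φ ξ • (𝓕 g : L2 d r H) ξ := by
    rw [mem_derivGraph_iff_lineDeriv]
    have h1 : ∂_{EuclideanSpace.single i (1 : ℝ)} (f : 𝓢'(Rn d, PiLp 2 fun _ : Fin r => H)) =
        (g : 𝓢'(Rn d, PiLp 2 fun _ : Fin r => H)) ↔
        𝓕 (∂_{EuclideanSpace.single i (1 : ℝ)} (f : 𝓢'(Rn d, PiLp 2 fun _ : Fin r => H))) =
        𝓕 (g : 𝓢'(Rn d, PiLp 2 fun _ : Fin r => H)) := by
      constructor
      · exact congrArg _
      · intro h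
        have h3 := congrArg (fun T : 𝓢'(Rn d, PiLp 2 fun _ : Fin r => H) =>
          (𝓕⁻ T : 𝓢'(Rn d, PiLp 2 fun _ : Fin r => H))) h
        simpa only [FourierTransform.fourierInv_fourier_eq] using h3
    rw [h1, TemperedDistribution.fourier_lineDerivOp_eq, Lp.fourier_toTemperedDistribution_eq,
      Lp.fourier_toTemperedDistribution_eq]
    have h2 : ∀ φ : 𝓢(Rn d, ℂ), ((2 * Real.pi * Complex.I : ℂ) •
        TemperedDistribution.smulLeftCLM (PiLp 2 fun _ : Fin r => H)
          (fun ξ : Rn d => ((inner ℝ ξ (EuclideanSpace.single i (1 : ℝ)) : ℝ) : ℂ))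
          ((𝓕 f : L2 d r H) : 𝓢'(Rn d, PiLp 2 fun _ : Fin r => H))) φ =
        ∫ ξ, φ ξ • (2 * Real.pi * Complex.I * (ξ i : ℝ) : ℂ) • (𝓕 f : L2 d r H) ξ := fun φ => by
      change (2 * Real.pi * Complex.I : ℂ) •
        ((𝓕 f : L2 d r H) : 𝓢'(Rn d, PiLp 2 fun _ : Fin r => H))
          (SchwartzMap.smulLeftCLM ℂ _ φ) = _
      rw [Lp.toTemperedDistribution_apply, ← integral_smul]
      congr 1
      ext1 ξ
      rw [SchwartzMap.smulLeftCLM_apply_apply htg, hin, smul_smul, smul_smul]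
      congr 1
      simp only [smul_eq_mul]
      ring
    constructor
    · intro h φ
      rw [← h2, h, Lp.toTemperedDistribution_apply]
    · intro h
      ext1 φ
      rw [h2, h, Lp.toTemperedDistribution_apply]
  rw [h0]
  constructor
  · intro h
    have l1 : LocallyIntegrable (fun ξ => (𝓕 g : L2 d r H) ξ) :=
      (Lp.memLp (𝓕 g : L2 d r H)).locallyIntegrable (by norm_num)
    have l2 : LocallyIntegrable (fun ξ => (𝓕 f : L2 d r H) ξ) :=
      (Lp.memLp (𝓕 f : L2 d r H)).locallyIntegrable (by norm_num)
    apply ae_eq_of_integral_contDiff_smul_eq l1 (l2.continuous_smul hcont)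
    intro η hη hc
    have hc' : HasCompactSupport (Complex.ofRealCLM ∘ η) := hc.comp_left rfl
    have hη' : ContDiff ℝ ∞ (Complex.ofRealCLM ∘ η) := by fun_prop
    have h1 := h (hc'.toSchwartzMap hη')
    have e2 : ∀ (v : PiLp 2 fun _ : Fin r => H) x, (hc'.toSchwartzMap hη') x • v = η x • v :=
      fun v x => by
        change ((η x : ℝ) : ℂ) • v = _
        rw [Complex.coe_smul]
    simp only [e2] at h1
    exact h1.symm
  · intro h φ
    apply integral_congr_ae
    filter_upwards [h] with ξ hξ
    rw [hξ]

end WeakDerivative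

/-! ### Properties of the weak derivatives and of the Laplace operator -/

section WeakDerivativeConsequences

open FourierTransform LineDeriv
open scoped SchwartzMap

variable {d r : ℕ} {H : Type*} [NormedAddCommGroup H] [InnerProductSpace ℂ H]

theorem coeFn_sum_ae {ι : Type*} (s : Finset ι) (f : ι → L2 d r H) :
    ∀ᵐ x, (∑ i ∈ s, f i) x = ∑ i ∈ s, f i x := by
  classical
  induction s using Finset.induction_on with
  | empty =>
    simp only [Finset.sum_empty]
    filter_upwards [Lp.coeFn_zero (PiLp 2 fun _ : Fin r => H) 2 (volume : Measure (Rn d))]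
      with x hx
    rw [hx, Pi.zero_apply]
  | insert a s ha ih =>
    filter_upwards [ih, Lp.coeFn_add (f a) (∑ i ∈ s, f i)] with x h1 h2
    rw [Finset.sum_insert ha, Finset.sum_insert ha, h2, Pi.add_apply, h1]

theorem memLp_test_smul {η : Rn d → ℝ} (hη : Continuous η) (hc : HasCompactSupport η)
    (v : PiLp 2 fun _ : Fin r => H) : MemLp (fun x => η x • v) 2 (volume : Measure (Rn d)) :=
  (hη.smul continuous_const).memLp_of_hasCompactSupport hc.smul_right

variable [CompleteSpace H]

/-- `∂_i` is skew-symmetric. -/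
theorem inner_derivGraph {i : Fin d} {f f' g g' : L2 d r H} (hf : (f, f') ∈ derivGraph i)
    (hg : (g, g') ∈ derivGraph i) : inner ℂ f' g = -inner ℂ f g' := by
  rw [mem_derivGraph_iff_fourier] at hf hg
  rw [← Lp.inner_fourier_eq f' g, ← Lp.inner_fourier_eq f g', L2.inner_def, L2.inner_def,
    ← integral_neg]
  apply integral_congr_ae
  filter_upwards [hf, hg] with ξ h1 h2
  rw [h1, h2, inner_smul_left, inner_smul_right, ← neg_mul]
  congr 1
  simp [Complex.conj_ofNat]

theorem isClosed_derivGraph (i : Fin d) :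
    IsClosed ((derivGraph i : Submodule ℂ (L2 d r H × L2 d r H)) : Set (L2 d r H × L2 d r H)) := by
  have h : ((derivGraph i : Submodule ℂ (L2 d r H × L2 d r H)) : Set (L2 d r H × L2 d r H)) =
      {p | lineDerivOpCLM ℂ 𝓢'(Rn d, PiLp 2 fun _ : Fin r => H) (EuclideanSpace.single i (1 : ℝ))
        (Lp.toTemperedDistributionCLM (PiLp 2 fun _ : Fin r => H) volume 2 p.1) =
        Lp.toTemperedDistributionCLM (PiLp 2 fun _ : Fin r => H) volume 2 p.2} := by
    ext ⟨f, g⟩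
    exact mem_derivGraph_iff_lineDeriv
  rw [h]
  exact isClosed_eq (by fun_prop) (by fun_prop)

/-- Weak derivatives commute. -/
theorem derivGraph_comm {i j : Fin d} {u ui uj uij : L2 d r H} (hi : (u, ui) ∈ derivGraph i)
    (hj : (u, uj) ∈ derivGraph j) (hij : (ui, uij) ∈ derivGraph j) :
    (uj, uij) ∈ derivGraph i := by
  rw [mem_derivGraph_iff_fourier] at *
  filter_upwards [hi, hj, hij] with ξ h1 h2 h3
  rw [h3, h1, h2, smul_smul, smul_smul, mul_comm]

theorem compLpL_mem_derivGraph {i : Fin d} {f g : L2 d r H} (h : (f, g) ∈ derivGraph i)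
    (S : (PiLp 2 fun _ : Fin r => H) →L[ℂ] (PiLp 2 fun _ : Fin r => H)) :
    (S.compLpL 2 volume f, S.compLpL 2 volume g) ∈ derivGraph i := by
  intro η hη hc
  have key : ∀ (θ : Rn d → ℝ) (u : L2 d r H), Continuous θ → HasCompactSupport θ →
      ∫ x, θ x • (S.compLpL 2 volume u : L2 d r H) x = S (∫ x, θ x • u x) := by
    intro θ u h1 h2
    rw [← S.integral_comp_comm (integrable_test_smul u h1 h2)]
    apply integral_congr_ae
    filter_upwards [S.coeFn_compLpL (p := 2) (μ := volume) u] with x hx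
    rw [hx, ← Complex.coe_smul, ← Complex.coe_smul, S.map_smul]
  simp only
  rw [key _ f (continuous_partialDeriv i hη) (hasCompactSupport_partialDeriv i hc),
    key _ g hη.continuous hc, ← map_neg]
  exact congrArg S (h η hη hc)

/-- Bounded Fourier multipliers. -/
theorem exists_fourierMultiplier {s : Rn d → ℂ} (hs : Continuous s) {C : ℝ}
    (hC : ∀ ξ, ‖s ξ‖ ≤ C) (f : L2 d r H) :
    ∃ u : L2 d r H, ∀ᵐ ξ, (𝓕 u : L2 d r H) ξ = s ξ • (𝓕 f : L2 d r H) ξ := by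
  have hm : MemLp (fun ξ => s ξ • (𝓕 f : L2 d r H) ξ) 2 volume := by
    apply (Lp.memLp (𝓕 f : L2 d r H)).of_le_mul (c := C)
      (hs.aestronglyMeasurable.smul (Lp.aestronglyMeasurable _))
    filter_upwards with ξ
    rw [Pi.smul_apply', norm_smul]
    exact mul_le_mul_of_nonneg_right (hC ξ) (norm_nonneg _)
  refine ⟨𝓕⁻ (hm.toLp : L2 d r H), ?_⟩
  rw [FourierTransform.fourier_fourierInv_eq]
  exact hm.coeFn_toLp

/-- For `μ > 0`, the equation `-∑ ∂_i² u + μ u = f` has a solution in `H²`. -/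
theorem exists_laplace_eq {μ : ℝ} (hμ : 0 < μ) (f : L2 d r H) :
    ∃ (u : L2 d r H) (u' : Fin d → L2 d r H) (u'' : Fin d → Fin d → L2 d r H),
      (∀ i, (u, u' i) ∈ derivGraph i) ∧ (∀ i j, (u' i, u'' i j) ∈ derivGraph j) ∧
      -∑ i, u'' i i + (μ : ℂ) • u = f := by
  let p : Rn d → ℝ := fun ξ => (2 * Real.pi) ^ 2 * ‖ξ‖ ^ 2 + μ
  have hp : ∀ ξ, 0 < p ξ := fun ξ => by positivity
  have hpμ : ∀ ξ, μ ≤ p ξ := fun ξ => by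
    have : 0 ≤ (2 * Real.pi) ^ 2 * ‖ξ‖ ^ 2 := by positivity
    linarith
  have hpξ : ∀ ξ, (2 * Real.pi * ‖ξ‖) ^ 2 ≤ p ξ := fun ξ => by
    rw [mul_pow]
    linarith
  have hpc : Continuous p := by fun_prop
  let m : Fin d → Rn d → ℂ := fun i ξ => 2 * Real.pi * Complex.I * (ξ i : ℝ)
  have hmc : ∀ i, Continuous (m i) := fun i => by fun_prop
  have hmn : ∀ i ξ, ‖m i ξ‖ ≤ 2 * Real.pi * ‖ξ‖ := fun i ξ => by
    simp only [m, norm_mul, Complex.norm_I, mul_one, Complex.norm_real, Complex.norm_ofNat,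
      Real.norm_of_nonneg Real.pi_pos.le]
    apply mul_le_mul_of_nonneg_left (PiLp.norm_apply_le ξ i) (by positivity)
  have hs : Continuous fun ξ => ((p ξ)⁻¹ : ℂ) :=
    (Complex.continuous_ofReal.comp hpc).inv₀ fun ξ => Complex.ofReal_ne_zero.2 (hp ξ).ne'
  have hsn : ∀ ξ, ‖((p ξ)⁻¹ : ℂ)‖ = (p ξ)⁻¹ := fun ξ => by
    rw [norm_inv, Complex.norm_real, Real.norm_of_nonneg (hp ξ).le]
  obtain ⟨u, hu⟩ := exists_fourierMultiplier hs (C := μ⁻¹)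
    (fun ξ => by rw [hsn]; exact inv_anti₀ hμ (hpμ ξ)) f
  have h1 : ∀ i, ∃ v : L2 d r H, ∀ᵐ ξ, (𝓕 v : L2 d r H) ξ =
      (m i ξ * (p ξ : ℂ)⁻¹) • (𝓕 f : L2 d r H) ξ := fun i => by
    apply exists_fourierMultiplier ((hmc i).mul hs) (C := 1 + μ⁻¹)
    intro ξ
    rw [Pi.mul_apply, norm_mul, hsn, ← div_eq_mul_inv, div_le_iff₀ (hp ξ)]
    refine (hmn i ξ).trans ?_
    have e1 : 1 ≤ μ⁻¹ * p ξ := by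
      rw [inv_mul_eq_div, le_div_iff₀ hμ, one_mul]
      exact hpμ ξ
    nlinarith [hpξ ξ, sq_nonneg (2 * Real.pi * ‖ξ‖ - 1)]
  have h2 : ∀ i j, ∃ v : L2 d r H, ∀ᵐ ξ, (𝓕 v : L2 d r H) ξ =
      (m j ξ * (m i ξ * (p ξ : ℂ)⁻¹)) • (𝓕 f : L2 d r H) ξ := fun i j => by
    apply exists_fourierMultiplier ((hmc j).mul ((hmc i).mul hs)) (C := 1)
    intro ξ
    rw [Pi.mul_apply, Pi.mul_apply, norm_mul, norm_mul (m i ξ), hsn, ← mul_assoc, ← div_eq_mul_inv, div_le_iff₀ (hp ξ), one_mul]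
    refine le_trans ?_ (hpξ ξ)
    rw [sq]
    exact mul_le_mul (hmn j ξ) (hmn i ξ) (norm_nonneg _) (by positivity)
  choose u' hu' using h1
  choose u'' hu'' using h2
  refine ⟨u, u', u'', fun i => ?_, fun i j => ?_, ?_⟩
  · rw [mem_derivGraph_iff_fourier]
    filter_upwards [hu, hu' i] with ξ e1 e2
    rw [e1, e2, smul_smul]
  · rw [mem_derivGraph_iff_fourier]
    filter_upwards [hu' i, hu'' i j] with ξ e1 e2
    rw [e1, e2, smul_smul]
  · apply (Lp.fourierTransformₗᵢ (Rn d) (PiLp 2 fun _ : Fin r => H)).injective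
    rw [map_add, map_neg, map_sum, map_smul]
    have hF : ∀ v : L2 d r H,
      Lp.fourierTransformₗᵢ (Rn d) (PiLp 2 fun _ : Fin r => H) v = 𝓕 v := fun _ => rfl
    simp only [hF]
    apply Lp.ext
    have hall : ∀ᵐ ξ, ∀ i, (𝓕 (u'' i i) : L2 d r H) ξ =
      (m i ξ * (m i ξ * (p ξ : ℂ)⁻¹)) • (𝓕 f : L2 d r H) ξ := ae_all_iff.2 fun i => hu'' i i
    have hsum := coeFn_sum_ae Finset.univ fun i => (𝓕 (u'' i i) : L2 d r H)
    filter_upwards [hu, hall, hsum,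
      Lp.coeFn_add (-∑ i, (𝓕 (u'' i i) : L2 d r H)) ((μ : ℂ) • (𝓕 u : L2 d r H)),
      Lp.coeFn_neg (∑ i, (𝓕 (u'' i i) : L2 d r H)),
      Lp.coeFn_smul (μ : ℂ) (𝓕 u : L2 d r H)] with ξ e1 e2 e3 e4 e5 e6
    rw [e4, Pi.add_apply, e5, Pi.neg_apply, e6, Pi.smul_apply, e3, e1]
    simp only [e2]
    rw [← Finset.sum_smul, smul_smul, ← neg_smul, ← add_smul]
    have hne : (p ξ : ℂ) ≠ 0 := Complex.ofReal_ne_zero.2 (hp ξ).ne'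
    have e7 : -∑ i, m i ξ * (m i ξ * (p ξ : ℂ)⁻¹) + μ * (p ξ : ℂ)⁻¹ = 1 := by
      have e8 : ∀ i, m i ξ * (m i ξ * (p ξ : ℂ)⁻¹) =
          -(((2 * Real.pi) ^ 2 * (ξ i) ^ 2 : ℝ) : ℂ) * (p ξ : ℂ)⁻¹ := fun i => by
        simp only [m]
        push_cast
        linear_combination (4 * Real.pi ^ 2 * (ξ i : ℂ) ^ 2 * (p ξ : ℂ)⁻¹) * Complex.I_sq
      simp only [e8]
      rw [← Finset.sum_mul, Finset.sum_neg_distrib, ← Complex.ofReal_sum, ← Finset.mul_sum,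
        ← EuclideanSpace.real_norm_sq_eq, neg_mul, neg_neg, ← add_mul, ← Complex.ofReal_add]
      exact mul_inv_cancel₀ hne
    rw [e7, one_smul]

/-- The element `η ⊗ v` of `L²`, for a test function `η`. -/
def testL2 {η : Rn d → ℝ} (hη : Continuous η) (hc : HasCompactSupport η)
    (v : PiLp 2 fun _ : Fin r => H) : L2 d r H := (memLp_test_smul hη hc v).toLp

theorem inner_testL2 {η : Rn d → ℝ} (hη : Continuous η) (hc : HasCompactSupport η)
    (v : PiLp 2 fun _ : Fin r => H) (f : L2 d r H) :
    inner ℂ (testL2 hη hc v) f = inner ℂ v (∫ x, η x • f x) := by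
  rw [L2.inner_def, ← integral_inner (integrable_test_smul f hη hc)]
  apply integral_congr_ae
  filter_upwards [(memLp_test_smul hη hc v).coeFn_toLp] with x hx
  rw [testL2, hx, ← Complex.coe_smul, ← Complex.coe_smul, inner_smul_left, inner_smul_right,
    Complex.conj_ofReal]

theorem testL2_mem_derivGraph {η : Rn d → ℝ} (hη : ContDiff ℝ ∞ η) (hc : HasCompactSupport η)
    (i : Fin d) (v : PiLp 2 fun _ : Fin r => H) :
    (testL2 hη.continuous hc v, testL2 (continuous_partialDeriv i hη)
      (hasCompactSupport_partialDeriv i hc) v) ∈ derivGraph i := by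
  intro θ hθ hθc
  have h1 := (memLp_test_smul hη.continuous hc v).coeFn_toLp
  have h2 := (memLp_test_smul (continuous_partialDeriv i hη)
      (hasCompactSupport_partialDeriv i hc) v).coeFn_toLp
  have e1 : ∫ x, partialDeriv i θ x • (testL2 hη.continuous hc v : L2 d r H) x =
      (∫ x, partialDeriv i θ x * η x) • v := by
    rw [← integral_smul_const]
    apply integral_congr_ae
    filter_upwards [h1] with x hx
    rw [testL2, hx, smul_smul]
  have e2 : ∫ x, θ x • (testL2 (continuous_partialDeriv i hη)
      (hasCompactSupport_partialDeriv i hc) v : L2 d r H) x =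
      (∫ x, θ x * partialDeriv i η x) • v := by
    rw [← integral_smul_const]
    apply integral_congr_ae
    filter_upwards [h2] with x hx
    rw [testL2, hx, smul_smul]
  simp only
  rw [e1, e2, ← neg_smul]
  congr 1
  have hθd := hθ.differentiable (by simp)
  have hηd := hη.differentiable (by simp)
  have i1 : Integrable (fun x => partialDeriv i θ x * η x) :=
    ((continuous_partialDeriv i hθ).mul hη.continuous).integrable_of_hasCompactSupport
      hc.mul_left
  have i2 : Integrable (fun x => θ x * partialDeriv i η x) :=
    (hθ.continuous.mul (continuous_partialDeriv i hη)).integrable_of_hasCompactSupport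
      hθc.mul_right
  have i3 : Integrable (fun x => θ x * η x) :=
    (hθ.continuous.mul hη.continuous).integrable_of_hasCompactSupport hθc.mul_right
  have h3 := integral_mul_fderiv_eq_neg_fderiv_mul_of_integrable i1 i2 i3
    (fun x _ => hθd x) (fun x _ => hηd x)
  exact (neg_eq_iff_eq_neg.2 h3).symm

/-- Test functions are a core for `∂_i`: since `∂_i` is skew-symmetric, an element of its graph
which is orthogonal to all `(η ⊗ v, ∂_i η ⊗ v)` vanishes. -/
theorem derivGraph_le_of_test {i : Fin d} (K : Submodule ℂ (L2 d r H × L2 d r H))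
    (hK : IsClosed (K : Set (L2 d r H × L2 d r H)))
    (h : ∀ (η : Rn d → ℝ) (hη : ContDiff ℝ ∞ η) (hc : HasCompactSupport η)
      (v : PiLp 2 fun _ : Fin r => H), (testL2 hη.continuous hc v,
        testL2 (continuous_partialDeriv i hη) (hasCompactSupport_partialDeriv i hc) v) ∈ K) :
    derivGraph i ≤ K := by
  intro p hp
  let e := (WithLp.linearEquiv 2 ℂ (L2 d r H × L2 d r H))
  let K' : Submodule ℂ (WithLp 2 (L2 d r H × L2 d r H)) :=
    (K ⊓ derivGraph i).comap
      (e : WithLp 2 (L2 d r H × L2 d r H) →ₗ[ℂ] L2 d r H × L2 d r H)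
  have hK' : IsClosed (K' : Set (WithLp 2 (L2 d r H × L2 d r H))) :=
    (hK.inter (isClosed_derivGraph i)).preimage (WithLp.prod_continuous_ofLp 2 _ _)
  have : CompleteSpace K' := hK'.completeSpace_coe
  obtain ⟨k, hk, o, ho, hko⟩ := K'.exists_add_mem_mem_orthogonal (WithLp.toLp 2 p)
  have hk' : (k.fst, k.snd) ∈ K ⊓ derivGraph i := hk
  have h1 : p.1 = k.fst + o.fst := congrArg (fun p => WithLp.fst p) hko
  have h2 : p.2 = k.snd + o.snd := congrArg (fun p => WithLp.snd p) hko
  have ho1 : (o.fst, o.snd) ∈ derivGraph i := by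
    have := (derivGraph i).sub_mem hp hk'.2
    have e1 : p - (k.fst, k.snd) = (o.fst, o.snd) := by
      apply Prod.ext
      · simp [h1]
      · simp [h2]
    rwa [e1] at this
  have ho2 : (o.snd, o.fst) ∈ derivGraph i := by
    intro η hη hc
    apply ext_inner_left ℂ
    intro v
    have h3 := (Submodule.mem_orthogonal _ _).1 ho (WithLp.toLp 2 (testL2 hη.continuous hc v,
        testL2 (continuous_partialDeriv i hη) (hasCompactSupport_partialDeriv i hc) v))
        ⟨h η hη hc v, testL2_mem_derivGraph hη hc i v⟩
    rw [WithLp.prod_inner_apply] at h3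
    simp only [inner_testL2] at h3
    rw [inner_neg_right]
    exact eq_neg_of_add_eq_zero_right h3
  have h4 := inner_derivGraph ho1 ho2
  rw [inner_self_eq_ofReal, inner_self_eq_ofReal, ← Complex.ofReal_neg, Complex.ofReal_inj] at h4
  have h5 : ‖o.fst‖ = 0 := by nlinarith [sq_nonneg ‖o.fst‖, sq_nonneg ‖o.snd‖]
  have h6 : ‖o.snd‖ = 0 := by nlinarith [sq_nonneg ‖o.fst‖, sq_nonneg ‖o.snd‖]
  rw [norm_eq_zero] at h5 h6
  rw [h5, add_zero] at h1
  rw [h6, add_zero] at h2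
  have : p = (k.fst, k.snd) := Prod.ext h1 h2
  rw [this]
  exact hk'.1

end WeakDerivativeConsequences

/-! ### Operators acting fibrewise -/

section Fibre

variable {d r : ℕ} {H : Type*} [NormedAddCommGroup H] [InnerProductSpace ℂ H]

/-- A bounded operator in `H` acting componentwise on `ℂ^r ⊗ H`. -/
def fibreAct (r : ℕ) (S : H →L[ℂ] H) :
    (PiLp 2 fun _ : Fin r => H) →L[ℂ] (PiLp 2 fun _ : Fin r => H) :=
  ((PiLp.continuousLinearEquiv 2 ℂ fun _ : Fin r => H).symm :
      (Fin r → H) →L[ℂ] PiLp 2 fun _ : Fin r => H).comp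
    (ContinuousLinearMap.pi fun k => S.comp (PiLp.proj 2 (fun _ : Fin r => H) k))

/-- A bounded operator in `H` acting fibrewise on `L²`. -/
def lift (S : H →L[ℂ] H) : L2 d r H →L[ℂ] L2 d r H := (fibreAct r S).compLpL 2 volume

theorem lift_ae (S : H →L[ℂ] H) (f : L2 d r H) : ∀ᵐ x, ∀ k, (lift S f x) k = S (f x k) := by
  filter_upwards [(fibreAct r S).coeFn_compLpL (p := 2) (μ := volume) f] with x hx k
  rw [lift, hx]
  rfl

theorem matrixAct_apply (c : Matrix (Fin r) (Fin r) ℂ) (v : PiLp 2 fun _ : Fin r => H)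
    (k : Fin r) : matrixAct c v k = ∑ l, c k l • v l := by
  change (∑ l, c k l • PiLp.proj (𝕜 := ℂ) 2 (fun _ : Fin r => H) l) v = _
  rw [_root_.sum_apply]
  rfl

/-- A matrix acting on `L²`. -/
def matrixL2 (c : Matrix (Fin r) (Fin r) ℂ) : L2 d r H →L[ℂ] L2 d r H :=
  (matrixAct c).compLpL 2 volume

theorem matrixL2_ae (c : Matrix (Fin r) (Fin r) ℂ) (f : L2 d r H) :
    ∀ᵐ x, ∀ k, (matrixL2 c f x) k = ∑ l, c k l • f x l := by
  filter_upwards [(matrixAct c).coeFn_compLpL (p := 2) (μ := volume) f] with x hx k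
  rw [matrixL2, hx, matrixAct_apply]

theorem ext_comp_ae {f g : L2 d r H} (h : ∀ᵐ x, ∀ k, f x k = g x k) : f = g := by
  apply Lp.ext
  filter_upwards [h] with x hx
  ext k
  exact hx k

theorem norm_le_of_comp_ae {f g : L2 d r H} {C : ℝ} (hC : 0 ≤ C)
    (h : ∀ᵐ x, ∀ k, ‖g x k‖ ≤ C * ‖f x k‖) : ‖g‖ ≤ C * ‖f‖ := by
  apply Lp.norm_le_mul_norm_of_ae_le_mul
  filter_upwards [h] with x hx
  apply le_of_sq_le_sq _ (by positivity)
  rw [mul_pow, PiLp.norm_sq_eq_of_L2, PiLp.norm_sq_eq_of_L2, Finset.mul_sum]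
  apply Finset.sum_le_sum
  intro k _
  rw [← mul_pow]
  exact pow_le_pow_left₀ (norm_nonneg _) (hx k) 2

theorem inner_eq_of_comp_ae {f f' g g' : L2 d r H}
    (h : ∀ᵐ x, ∀ k, (inner ℂ (f' x k) (g x k) : ℂ) = inner ℂ (f x k) (g' x k)) :
    inner ℂ f' g = inner ℂ f g' := by
  rw [L2.inner_def, L2.inner_def]
  apply integral_congr_ae
  filter_upwards [h] with x hx
  rw [PiLp.inner_apply, PiLp.inner_apply]
  exact Finset.sum_congr rfl fun k _ => hx k

theorem lift_symm {S : H →L[ℂ] H} (hS : ∀ x y, inner ℂ (S x) y = inner ℂ x (S y))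
    (f g : L2 d r H) : inner ℂ (lift S f) g = inner ℂ f (lift S g) := by
  apply inner_eq_of_comp_ae
  filter_upwards [lift_ae S f, lift_ae S g] with x h1 h2 k
  rw [h1, h2, hS]

theorem lift_comm {S T : H →L[ℂ] H} (h : ∀ v, S (T v) = T (S v)) (f : L2 d r H) :
    lift S (lift T f) = lift T (lift S f) := by
  apply ext_comp_ae
  filter_upwards [lift_ae S (lift T f), lift_ae T f, lift_ae T (lift S f), lift_ae S f]
    with x h1 h2 h3 h4 k
  rw [h1, h2, h3, h4, h]

theorem lift_injective {S : H →L[ℂ] H} (h : ∀ v, S v = 0 → v = 0) {f : L2 d r H}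
    (hf : lift S f = 0) : f = 0 := by
  apply ext_comp_ae
  filter_upwards [lift_ae S f, Lp.coeFn_zero (PiLp 2 fun _ : Fin r => H) 2
    (volume : Measure (Rn d))] with x h1 h2 k
  rw [h2]
  apply h
  rw [← h1, hf, h2]
  rfl

theorem norm_lift_le {S : H →L[ℂ] H} {C : ℝ} (hC : 0 ≤ C) (h : ∀ v, ‖S v‖ ≤ C * ‖v‖)
    (f : L2 d r H) : ‖lift S f‖ ≤ C * ‖f‖ := by
  apply norm_le_of_comp_ae hC
  filter_upwards [lift_ae S f] with x h1 k
  rw [h1]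
  exact h _

theorem matrixL2_mul (c c' : Matrix (Fin r) (Fin r) ℂ) (f : L2 d r H) :
    matrixL2 c (matrixL2 c' f) = matrixL2 (c * c') f := by
  apply ext_comp_ae
  filter_upwards [matrixL2_ae c (matrixL2 c' f), matrixL2_ae c' f, matrixL2_ae (c * c') f]
    with x h1 h2 h3 k
  rw [h1, h3]
  simp only [h2, Finset.smul_sum, smul_smul, Matrix.mul_apply, Finset.sum_smul]
  exact Finset.sum_comm

theorem matrixL2_add (c c' : Matrix (Fin r) (Fin r) ℂ) (f : L2 d r H) :
    matrixL2 c f + matrixL2 c' f = matrixL2 (c + c') f := by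
  apply ext_comp_ae
  filter_upwards [matrixL2_ae c f, matrixL2_ae c' f, matrixL2_ae (c + c') f,
    Lp.coeFn_add (matrixL2 c f) (matrixL2 c' f)] with x h1 h2 h3 h4 k
  rw [h3, h4, Pi.add_apply, PiLp.add_apply, h1, h2, ← Finset.sum_add_distrib]
  exact Finset.sum_congr rfl fun l _ => by rw [Matrix.add_apply, add_smul]

theorem matrixL2_smul_one (z : ℂ) (f : L2 d r H) :
    matrixL2 (z • (1 : Matrix (Fin r) (Fin r) ℂ)) f = z • f := by
  apply ext_comp_ae
  filter_upwards [matrixL2_ae (z • (1 : Matrix (Fin r) (Fin r) ℂ)) f, Lp.coeFn_smul z f]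
    with x h1 h2 k
  rw [h1, h2, Pi.smul_apply, PiLp.smul_apply]
  simp [Matrix.smul_apply, Matrix.one_apply]

/-- Skew-Hermitian matrices act as skew-symmetric operators. -/
theorem inner_matrixL2 {c : Matrix (Fin r) (Fin r) ℂ} (hc : c.conjTranspose = -c)
    (f g : L2 d r H) : inner ℂ (matrixL2 c f) g = -inner ℂ f (matrixL2 c g) := by
  rw [L2.inner_def, L2.inner_def, ← integral_neg]
  apply integral_congr_ae
  filter_upwards [matrixL2_ae c f, matrixL2_ae c g] with x h1 h2
  rw [PiLp.inner_apply, PiLp.inner_apply]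
  simp only [h1, h2, sum_inner, inner_sum, inner_smul_left, inner_smul_right]
  rw [Finset.sum_comm, ← Finset.sum_neg_distrib]
  refine Finset.sum_congr rfl fun k _ => ?_
  rw [← Finset.sum_neg_distrib]
  refine Finset.sum_congr rfl fun l _ => ?_
  have h3 : (starRingEnd ℂ) (c l k) = -c k l := congrFun (congrFun hc k) l
  rw [h3, neg_mul]

/-- Multiplication operators commute with matrices. -/
theorem matrixL2_mem_mulGraph (c : Matrix (Fin r) (Fin r) ℂ) {T : Rn d → H →ₗ.[ℂ] H}
    {f g : L2 d r H} (h : (f, g) ∈ mulGraph T) : (matrixL2 c f, matrixL2 c g) ∈ mulGraph T := by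
  have h' : ∀ᵐ x, ∀ k, ((f x) k, (g x) k) ∈ (T x).graph := h
  change ∀ᵐ x, ∀ k, ((matrixL2 c f x) k, (matrixL2 c g x) k) ∈ (T x).graph
  filter_upwards [h', matrixL2_ae c f, matrixL2_ae c g] with x h0 h1 h2 k
  have e : (matrixL2 c f x k, matrixL2 c g x k) = ∑ l, c k l • (f x l, g x l) :=
    Prod.ext (by simp [h1, Prod.fst_sum]) (by simp [h2, Prod.snd_sum])
  rw [e]
  exact (T x).graph.sum_mem fun l _ => (T x).graph.smul_mem _ (h0 l)

/-- Multiplication by symmetric operators is symmetric. -/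
theorem inner_mulGraph {T : Rn d → H →ₗ.[ℂ] H} (hT : ∀ x, (T x).IsFormalAdjoint (T x))
    {f f' g g' : L2 d r H} (hf : (f, f') ∈ mulGraph T) (hg : (g, g') ∈ mulGraph T) :
    inner ℂ f' g = inner ℂ f g' := by
  have h1 : ∀ᵐ x, ∀ k, ((f x) k, (f' x) k) ∈ (T x).graph := hf
  have h2 : ∀ᵐ x, ∀ k, ((g x) k, (g' x) k) ∈ (T x).graph := hg
  apply inner_eq_of_comp_ae
  filter_upwards [h1, h2] with x h3 h4 k
  exact inner_eq_of_isFormalAdjoint (hT x) (h3 k) (h4 k)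

theorem mem_mulOp_graph {T : Rn d → H →ₗ.[ℂ] H} {f g : L2 d r H} :
    (f, g) ∈ (mulOp T).graph ↔ (f, g) ∈ mulGraph T := by rw [mulOp_graph]

theorem mulGraph_unique {T : Rn d → H →ₗ.[ℂ] H} {f g g' : L2 d r H} (h : (f, g) ∈ mulGraph T)
    (h' : (f, g') ∈ mulGraph T) : g = g' :=
  (mulOp T).mem_graph_snd_inj (mem_mulOp_graph.2 h) (mem_mulOp_graph.2 h') rfl

theorem sub_mem_derivGraph {i : Fin d} {f g f' g' : L2 d r H} (h : (f, g) ∈ derivGraph i)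
    (h' : (f', g') ∈ derivGraph i) : (f - f', g - g') ∈ derivGraph i :=
  (derivGraph i).sub_mem h h'

theorem add_mem_derivGraph {i : Fin d} {f g f' g' : L2 d r H} (h : (f, g) ∈ derivGraph i)
    (h' : (f', g') ∈ derivGraph i) : (f + f', g + g') ∈ derivGraph i :=
  (derivGraph i).add_mem h h'

theorem add_mem_mulGraph {T : Rn d → H →ₗ.[ℂ] H} {f g f' g' : L2 d r H}
    (h : (f, g) ∈ mulGraph T) (h' : (f', g') ∈ mulGraph T) : (f + f', g + g') ∈ mulGraph T := by
  have := (mulGraph T).add_mem h h'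
  rwa [Prod.mk_add_mk] at this

/-- The Clifford relations give `∂̸² = -∑ ∂_i²`. -/
theorem sum_matrixL2_matrixL2
    {c : Fin d → Matrix (Fin r) (Fin r) ℂ}
    (hc : ∀ i j, c i * c j + c j * c i = if i = j then (-2 : ℂ) • 1 else 0)
    {w : Fin d → Fin d → L2 d r H} (hw : ∀ i j, w i j = w j i) :
    ∑ j, matrixL2 (c j) (∑ i, matrixL2 (c i) (w i j)) = -∑ i, w i i := by
  set S := ∑ j, matrixL2 (c j) (∑ i, matrixL2 (c i) (w i j)) with hS
  have h1 : S = ∑ j, ∑ i, matrixL2 (c j * c i) (w i j) := by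
    simp only [hS, map_sum, matrixL2_mul]
  have h2 : S = ∑ j, ∑ i, matrixL2 (c i * c j) (w i j) := by
    rw [h1, Finset.sum_comm]
    refine Finset.sum_congr rfl fun i _ => Finset.sum_congr rfl fun j _ => ?_
    rw [hw]
  have h3 : (2 : ℂ) • S = (2 : ℂ) • -∑ i, w i i := by
    calc (2 : ℂ) • S = S + S := two_smul ℂ S
      _ = ∑ j, ∑ i, matrixL2 (c i * c j) (w i j) + ∑ j, ∑ i, matrixL2 (c j * c i) (w i j) := by
          rw [← h1, ← h2]
      _ = ∑ j, ∑ i, (if i = j then (-2 : ℂ) • w i j else 0) := by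
          rw [← Finset.sum_add_distrib]
          refine Finset.sum_congr rfl fun j _ => ?_
          rw [← Finset.sum_add_distrib]
          refine Finset.sum_congr rfl fun i _ => ?_
          rw [matrixL2_add, hc]
          split_ifs with hij
          · exact matrixL2_smul_one _ _
          · have := matrixL2_smul_one (d := d) (0 : ℂ) (w i j)
            rwa [zero_smul, zero_smul] at this
      _ = (2 : ℂ) • -∑ i, w i i := by
          simp only [Finset.sum_ite_eq', Finset.mem_univ, if_true]
          rw [← Finset.smul_sum, neg_smul, smul_neg]
  exact smul_right_injective _ (two_ne_zero : (2 : ℂ) ≠ 0) h3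

theorem mem_M0_graph {A : H →ₗ.[ℂ] H} {f g : L2 d r H} :
    (f, g) ∈ (M0 A).graph ↔ (f, g) ∈ mulGraph fun _ => A :=
  mem_mulOp_graph

variable [CompleteSpace H] {A : H →ₗ.[ℂ] H}

/-- The graph of `M₀`, described by bounded operators. -/
theorem mem_mulGraph_const_iff (hA : IsSelfAdjoint A) {f g : L2 d r H} :
    (f, g) ∈ mulGraph (fun _ => A) ↔ lift (mulSqResolvent A) f = lift (sqResolvent A) g := by
  change (∀ᵐ x, ∀ k, ((f x) k, (g x) k) ∈ A.graph) ↔ _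
  constructor
  · intro h
    apply ext_comp_ae
    filter_upwards [h, lift_ae (mulSqResolvent A) f, lift_ae (sqResolvent A) g] with x h1 h2 h3 k
    rw [h2, h3]
    exact (mem_graph_iff_sqResolvent hA).1 (h1 k)
  · intro h
    filter_upwards [lift_ae (mulSqResolvent A) f, lift_ae (sqResolvent A) g] with x h2 h3 k
    rw [mem_graph_iff_sqResolvent hA, ← h2, ← h3, h]

theorem isClosed_mulGraph_const (hA : IsSelfAdjoint A) :
    IsClosed ((mulGraph fun _ => A : Submodule ℂ (L2 d r H × L2 d r H)) :
      Set (L2 d r H × L2 d r H)) := by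
  have h : ((mulGraph fun _ => A : Submodule ℂ (L2 d r H × L2 d r H)) :
      Set (L2 d r H × L2 d r H)) =
      {p | lift (mulSqResolvent A) p.1 = lift (sqResolvent A) p.2} := by
    ext ⟨f, g⟩
    exact mem_mulGraph_const_iff hA
  rw [h]
  exact isClosed_eq (by fun_prop) (by fun_prop)

theorem inner_mulGraph_const (hA : IsSelfAdjoint A) {f f' g g' : L2 d r H}
    (hf : (f, f') ∈ mulGraph fun _ => A) (hg : (g, g') ∈ mulGraph fun _ => A) :
    inner ℂ f' g = inner ℂ f g' :=
  inner_mulGraph (fun _ => by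
    have h := LinearPMap.adjoint_isFormalAdjoint hA.dense_domain
    rwa [LinearPMap.isSelfAdjoint_def.1 hA] at h) hf hg

theorem lift_sqrtResolvent_mem (hA : IsSelfAdjoint A) {μ : ℝ} (hμ : 0 < μ) (f : L2 d r H) :
    (lift (sqrtResolvent A μ) f, lift (mulSqrtResolvent A μ) f) ∈ mulGraph fun _ => A := by
  change ∀ᵐ x, ∀ k, _
  filter_upwards [lift_ae (sqrtResolvent A μ) f, lift_ae (mulSqrtResolvent A μ) f] with x h1 h2 k
  simp only [h1, h2]
  exact mulSqrtResolvent_spec hA hμ _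

theorem lift_mulSqrtResolvent_sq (hA : IsSelfAdjoint A) {μ : ℝ} (hμ : 0 < μ) (f : L2 d r H) :
    lift (mulSqrtResolvent A μ) (lift (mulSqrtResolvent A μ) f) +
      (μ : ℂ) • lift (sqrtResolvent A μ) (lift (sqrtResolvent A μ) f) = f := by
  set N := mulSqrtResolvent A μ
  set W := sqrtResolvent A μ
  apply ext_comp_ae
  filter_upwards [lift_ae N f, lift_ae N (lift N f), lift_ae W f, lift_ae W (lift W f),
    Lp.coeFn_add (lift N (lift N f)) ((μ : ℂ) • lift W (lift W f)),
    Lp.coeFn_smul (μ : ℂ) (lift W (lift W f))] with x h1 h2 h3 h4 h5 h6 k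
  rw [h5, Pi.add_apply, h6, Pi.smul_apply, PiLp.add_apply, PiLp.smul_apply, h2, h1, h4, h3]
  exact mulSqrtResolvent_sq hA hμ _

end Fibre

/-! ### The domain and the resolvent of `H₀` -/

section Free

variable {d r : ℕ} {H : Type*} [NormedAddCommGroup H] [InnerProductSpace ℂ H] [CompleteSpace H]

theorem mem_derivOp_graph {i : Fin d} {f g : L2 d r H} :
    (f, g) ∈ (derivOp i).graph ↔ (f, g) ∈ derivGraph i := by rw [derivOp_graph]

theorem derivGraph_unique {i : Fin d} {f g g' : L2 d r H} (h : (f, g) ∈ derivGraph i)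
    (h' : (f, g') ∈ derivGraph i) : g = g' :=
  (derivOp i).mem_graph_snd_inj (mem_derivOp_graph.2 h) (mem_derivOp_graph.2 h') rfl

theorem lift_mem_derivGraph {i : Fin d} {f g : L2 d r H} (h : (f, g) ∈ derivGraph i)
    (S : H →L[ℂ] H) : (lift S f, lift S g) ∈ derivGraph i :=
  compLpL_mem_derivGraph h (fibreAct r S)

theorem matrixL2_mem_derivGraph {i : Fin d} {f g : L2 d r H} (h : (f, g) ∈ derivGraph i)
    (c : Matrix (Fin r) (Fin r) ℂ) : (matrixL2 c f, matrixL2 c g) ∈ derivGraph i :=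
  compLpL_mem_derivGraph h (matrixAct c)

theorem mem_sobolev2_iff {u : L2 d r H} : u ∈ sobolev2 d r H ↔
    ∃ (u' : Fin d → L2 d r H) (u'' : Fin d → Fin d → L2 d r H),
      (∀ i, (u, u' i) ∈ derivGraph i) ∧ ∀ i j, (u' i, u'' i j) ∈ derivGraph j := by
  simp only [sobolev2, Submodule.mem_inf, Submodule.mem_iInf, LinearPMap.mem_domain_iff,
    mem_opMul_graph, mem_derivOp_graph]
  constructor
  · rintro ⟨h1, h2⟩
    choose u' hu' using h1
    choose u'' y hy hu'' using h2
    refine ⟨u', fun i j => u'' j i, hu', fun i j => ?_⟩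
    rw [derivGraph_unique (hu' i) (hy j i)]
    exact hu'' j i
  · rintro ⟨u', u'', h1, h2⟩
    exact ⟨fun i => ⟨u' i, h1 i⟩, fun i j => ⟨u'' j i, u' j, h1 j, h2 j i⟩⟩

theorem mem_laplaceOp_graph {u w : L2 d r H} : (u, w) ∈ laplaceOp.graph ↔
    ∃ (u' : Fin d → L2 d r H) (u'' : Fin d → Fin d → L2 d r H),
      (∀ i, (u, u' i) ∈ derivGraph i) ∧ (∀ i j, (u' i, u'' i j) ∈ derivGraph j) ∧
        w = -∑ i, u'' i i := by
  rw [laplaceOp, mem_domRestrict_graph, mem_neg_graph, mem_sum_graph, mem_sobolev2_iff]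
  simp only [mem_opMul_graph, mem_derivOp_graph]
  constructor
  · rintro ⟨⟨u', u'', h1, h2⟩, y, hy, hw⟩
    refine ⟨u', u'', h1, h2, ?_⟩
    rw [← neg_eq_iff_eq_neg, hw]
    refine Finset.sum_congr rfl fun i hi => ?_
    obtain ⟨v, hv1, hv2⟩ := hy i hi
    rw [derivGraph_unique hv1 (h1 i)] at hv2
    exact derivGraph_unique hv2 (h2 i i)
  · rintro ⟨u', u'', h1, h2, hw⟩
    exact ⟨⟨u', u'', h1, h2⟩, fun i => u'' i i, fun i _ => ⟨u' i, h1 i, h2 i i⟩, by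
      rw [hw, neg_neg]⟩

/-- Integration by parts for `-Δ`. -/
theorem inner_laplace {v : L2 d r H} {u' v' w : Fin d → L2 d r H}
    (hv : ∀ i, (v, v' i) ∈ derivGraph i) (hu : ∀ i, (u' i, w i) ∈ derivGraph i) :
    (inner ℂ v (-∑ i : Fin d, w i) : ℂ) = ∑ i : Fin d, (inner ℂ (v' i) (u' i) : ℂ) := by
  rw [inner_neg_right, inner_sum, ← Finset.sum_neg_distrib]
  exact Finset.sum_congr rfl fun i _ => (inner_derivGraph (hv i) (hu i)).symm

theorem inner_laplace_self {u : L2 d r H} {u' w : Fin d → L2 d r H}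
    (hu : ∀ i, (u, u' i) ∈ derivGraph i) (hw : ∀ i, (u' i, w i) ∈ derivGraph i) :
    (inner ℂ u (-∑ i : Fin d, w i) : ℂ) = ((∑ i : Fin d, ‖u' i‖ ^ 2 : ℝ) : ℂ) := by
  rw [inner_laplace hu hw, Complex.ofReal_sum]
  exact Finset.sum_congr rfl fun i _ => inner_self_eq_ofReal _

/-- The resolvent `a = (Δ + μ)⁻¹`, together with the bounded operators `D i = ∂_i (Δ + μ)⁻¹` and
the second derivatives `D2 i j f = ∂_j ∂_i (Δ + μ)⁻¹ f`. -/
structure LaplaceResolvent (d r : ℕ) (H : Type*) [NormedAddCommGroup H] [InnerProductSpace ℂ H]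
    (μ : ℝ) where
  /-- `(Δ + μ)⁻¹` -/
  a : L2 d r H →L[ℂ] L2 d r H
  /-- `∂_i (Δ + μ)⁻¹` -/
  D : Fin d → L2 d r H →L[ℂ] L2 d r H
  /-- `∂_j ∂_i (Δ + μ)⁻¹` -/
  D2 : Fin d → Fin d → L2 d r H → L2 d r H
  mem_D : ∀ i f, (a f, D i f) ∈ derivGraph i
  mem_D2 : ∀ i j f, (D i f, D2 i j f) ∈ derivGraph j
  eqn : ∀ f, -∑ i, D2 i i f + (μ : ℂ) • a f = f

theorem exists_laplaceResolvent {μ : ℝ} (hμ : 0 < μ) :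
    Nonempty (LaplaceResolvent d r H μ) := by
  set T : L2 d r H →ₗ.[ℂ] L2 d r H := laplaceOp + ofBdd ((μ : ℂ) • ContinuousLinearMap.id ℂ (L2 d r H)) with hT
  have hTg : ∀ {u f : L2 d r H}, (u, f) ∈ T.graph ↔
      ∃ (u' : Fin d → L2 d r H) (u'' : Fin d → Fin d → L2 d r H),
      (∀ i, (u, u' i) ∈ derivGraph i) ∧ (∀ i j, (u' i, u'' i j) ∈ derivGraph j) ∧
        -∑ i, u'' i i + (μ : ℂ) • u = f := by
    intro u f
    rw [hT, mem_add_graph]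
    simp only [mem_laplaceOp_graph, mem_ofBdd_graph]
    constructor
    · rintro ⟨y, w, ⟨u', u'', h1, h2, rfl⟩, rfl, rfl⟩
      exact ⟨u', u'', h1, h2, rfl⟩
    · rintro ⟨u', u'', h1, h2, rfl⟩
      exact ⟨_, _, ⟨u', u'', h1, h2, rfl⟩, rfl, rfl⟩
  have energy : ∀ {u f : L2 d r H} {u' : Fin d → L2 d r H} {u'' : Fin d → Fin d → L2 d r H},
      (∀ i, (u, u' i) ∈ derivGraph i) → (∀ i j, (u' i, u'' i j) ∈ derivGraph j) →
        -∑ i, u'' i i + (μ : ℂ) • u = f → ∑ i, ‖u' i‖ ^ 2 + μ * ‖u‖ ^ 2 ≤ ‖u‖ * ‖f‖ := by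
    intro u f u' u'' h1 h2 h3
    have h4 : inner ℂ u f = ((∑ i, ‖u' i‖ ^ 2 + μ * ‖u‖ ^ 2 : ℝ) : ℂ) := by
      rw [← h3, inner_add_right, inner_laplace_self h1 fun i => h2 i i, inner_smul_right,
        inner_self_eq_ofReal, Complex.ofReal_add, Complex.ofReal_mul]
    have h5 := norm_inner_le_norm (𝕜 := ℂ) u f
    rw [h4, Complex.norm_real] at h5
    exact (le_abs_self _).trans h5
  have bound : ∀ {u f : L2 d r H}, (u, f) ∈ T.graph → ‖u‖ ≤ μ⁻¹ * ‖f‖ := by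
    intro u f h
    obtain ⟨u', u'', h1, h2, h3⟩ := hTg.1 h
    have h4 := energy h1 h2 h3
    have h5 : 0 ≤ ∑ i, ‖u' i‖ ^ 2 := by positivity
    rcases eq_or_lt_of_le (norm_nonneg u) with h6 | h6
    · rw [← h6]; positivity
    · rw [← div_eq_inv_mul, le_div_iff₀ hμ]
      have : ‖u‖ * (μ * ‖u‖) ≤ ‖u‖ * ‖f‖ := by nlinarith
      linarith [le_of_mul_le_mul_left this h6]
  have hker : T.toFun.ker = ⊥ := ker_toFun_eq_bot fun x hx => by
    have := bound hx
    simpa using this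
  obtain ⟨a, ha⟩ := exists_eq_ofBdd (T := T.inverse) (C := μ⁻¹)
    (fun f => by
      obtain ⟨u, u', u'', h⟩ := exists_laplace_eq hμ f
      exact ⟨u, (mem_inverse_graph hker).2 (hTg.2 ⟨u', u'', h⟩)⟩)
    (fun f u h => bound ((mem_inverse_graph hker).1 h))
  have haT : ∀ f, (a f, f) ∈ T.graph := fun f => by
    rw [← mem_inverse_graph hker, ha, mem_ofBdd_graph]
  have hD : ∀ i : Fin d, ∃ S : L2 d r H →L[ℂ] L2 d r H,
      opMul (derivOp i) (ofBdd a) = ofBdd S := by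
    intro i
    refine exists_eq_ofBdd (C := √μ⁻¹) (fun f => ?_) (fun f g h => ?_)
    · obtain ⟨u', u'', h1, -⟩ := hTg.1 (haT f)
      exact ⟨u' i, mem_opMul_graph.2 ⟨a f, mem_ofBdd_graph.2 rfl, mem_derivOp_graph.2 (h1 i)⟩⟩
    · obtain ⟨y, hy, h⟩ := mem_opMul_graph.1 h
      rw [mem_ofBdd_graph] at hy
      rw [hy, mem_derivOp_graph] at h
      obtain ⟨u', u'', h1, h2, h3⟩ := hTg.1 (haT f)
      rw [derivGraph_unique h (h1 i)]
      have h4 := energy h1 h2 h3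
      have h5 : ‖u' i‖ ^ 2 ≤ ∑ i, ‖u' i‖ ^ 2 :=
        Finset.single_le_sum (f := fun i => ‖u' i‖ ^ 2) (fun _ _ => by positivity)
          (Finset.mem_univ i)
      have h6 : ‖a f‖ * ‖f‖ ≤ μ⁻¹ * ‖f‖ * ‖f‖ :=
        mul_le_mul_of_nonneg_right (bound (haT f)) (norm_nonneg _)
      have h7 : 0 ≤ μ * ‖a f‖ ^ 2 := by positivity
      apply le_of_sq_le_sq _ (by positivity)
      rw [mul_pow, Real.sq_sqrt (by positivity)]
      nlinarith
  choose D hD using hD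
  have hD1 : ∀ i f, (a f, D i f) ∈ derivGraph i := by
    intro i f
    have h : (f, D i f) ∈ (opMul (derivOp i) (ofBdd a)).graph := by
      rw [hD, mem_ofBdd_graph]
    obtain ⟨y, hy, h⟩ := mem_opMul_graph.1 h
    rw [mem_ofBdd_graph] at hy
    rwa [hy, mem_derivOp_graph] at h
  have h := fun f => hTg.1 (haT f)
  choose u' u'' h1 h2 h3 using h
  exact ⟨⟨a, D, fun i j f => u'' f i j, hD1, fun i j f => by
    rw [derivGraph_unique (hD1 i f) (h1 f i)]; exact h2 f i j, h3⟩⟩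

namespace LaplaceResolvent

variable {μ : ℝ} (Λ : LaplaceResolvent d r H μ)

theorem inner_left (x y : L2 d r H) : inner ℂ (Λ.a x) y =
    (∑ i, inner ℂ (Λ.D i x) (Λ.D i y) : ℂ) + (μ : ℂ) * inner ℂ (Λ.a x) (Λ.a y) := by
  conv_lhs => rw [← Λ.eqn y]
  rw [inner_add_right, inner_laplace (fun i => Λ.mem_D i x) (fun i => Λ.mem_D2 i i y),
    inner_smul_right]

theorem symm (x y : L2 d r H) : inner ℂ (Λ.a x) y = inner ℂ x (Λ.a y) := by
  rw [← inner_conj_symm x (Λ.a y), Λ.inner_left x y, Λ.inner_left y x, map_add, map_sum, map_mul,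
    Complex.conj_ofReal, inner_conj_symm]
  simp only [inner_conj_symm]

theorem re_inner_self (x : L2 d r H) :
    (inner ℂ (Λ.a x) x).re = ∑ i, ‖Λ.D i x‖ ^ 2 + μ * ‖Λ.a x‖ ^ 2 := by
  have : inner ℂ (Λ.a x) x = ((∑ i, ‖Λ.D i x‖ ^ 2 + μ * ‖Λ.a x‖ ^ 2 : ℝ) : ℂ) := by
    rw [Λ.inner_left x x, inner_self_eq_ofReal]
    simp only [inner_self_eq_ofReal]
    push_cast
    rfl
  rw [this, Complex.ofReal_re]

theorem injective {x : L2 d r H} (hx : Λ.a x = 0) : x = 0 := by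
  have h1 : ∀ i, Λ.D i x = 0 := fun i => by
    have := Λ.mem_D i x
    rw [hx] at this
    exact derivGraph_unique this (derivGraph i).zero_mem
  have h2 : ∀ i, Λ.D2 i i x = 0 := fun i => by
    have := Λ.mem_D2 i i x
    rw [h1] at this
    exact derivGraph_unique this (derivGraph i).zero_mem
  rw [← Λ.eqn x, hx]
  simp [h2]

/-- The resolvent of `Δ` commutes with fibrewise operators, since `Δ` does. -/
theorem comm (hμ : 0 < μ) (S : H →L[ℂ] H) (f : L2 d r H) : Λ.a (lift S f) = lift S (Λ.a f) := by
  have h1 : ∀ i, (Λ.a (lift S f) - lift S (Λ.a f), Λ.D i (lift S f) - lift S (Λ.D i f)) ∈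
      derivGraph i := fun i =>
    sub_mem_derivGraph (Λ.mem_D i (lift S f)) (lift_mem_derivGraph (Λ.mem_D i f) S)
  have h2 : ∀ i, (Λ.D i (lift S f) - lift S (Λ.D i f),
      Λ.D2 i i (lift S f) - lift S (Λ.D2 i i f)) ∈ derivGraph i := fun i =>
    sub_mem_derivGraph (Λ.mem_D2 i i (lift S f)) (lift_mem_derivGraph (Λ.mem_D2 i i f) S)
  have h3 : -∑ i, (Λ.D2 i i (lift S f) - lift S (Λ.D2 i i f)) +
      (μ : ℂ) • (Λ.a (lift S f) - lift S (Λ.a f)) = 0 := by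
    have h4 := Λ.eqn (lift S f)
    have h5 := congrArg (lift S) (Λ.eqn f)
    rw [map_add, map_neg, map_sum, map_smul] at h5
    rw [Finset.sum_sub_distrib, smul_sub, neg_sub', ← add_sub_add_comm, h4, h5, sub_self]
  have h4 := congrArg (inner ℂ (Λ.a (lift S f) - lift S (Λ.a f))) h3
  rw [inner_add_right, inner_laplace_self h1 h2, inner_smul_right, inner_self_eq_ofReal,
    inner_zero_right] at h4
  have h5 : ∑ i, ‖Λ.D i (lift S f) - lift S (Λ.D i f)‖ ^ 2 +
      μ * ‖Λ.a (lift S f) - lift S (Λ.a f)‖ ^ 2 = 0 := by exact_mod_cast h4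
  have h6 : 0 ≤ ∑ i, ‖Λ.D i (lift S f) - lift S (Λ.D i f)‖ ^ 2 := by positivity
  have h7 : ‖Λ.a (lift S f) - lift S (Λ.a f)‖ ^ 2 = 0 := by
    nlinarith [sq_nonneg ‖Λ.a (lift S f) - lift S (Λ.a f)‖]
  exact sub_eq_zero.1 (norm_eq_zero.1 (pow_eq_zero_iff two_ne_zero |>.1 h7))

theorem comm_D (hμ : 0 < μ) (i : Fin d) (S : H →L[ℂ] H) (f : L2 d r H) :
    Λ.D i (lift S f) = lift S (Λ.D i f) := by
  have h := Λ.mem_D i (lift S f)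
  rw [Λ.comm hμ] at h
  exact derivGraph_unique h (lift_mem_derivGraph (Λ.mem_D i f) S)

end LaplaceResolvent

/-- `u ∈ H²(ℝ^d, ℂ^r ⊗ H) ∩ dom M₀²` together with its derivatives `∂_i u` and `∂_j ∂_i u`, with
`M₀ u` and `M₀² u`, and with the mixed terms `∂_i M₀ u = M₀ ∂_i u`. -/
structure Jet (A : H →ₗ.[ℂ] H) (u : L2 d r H) where
  /-- `∂_i u` -/
  d1 : Fin d → L2 d r H
  /-- `∂_j ∂_i u` -/
  d2 : Fin d → Fin d → L2 d r H
  /-- `M₀ u` -/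
  m : L2 d r H
  /-- `M₀² u` -/
  mm : L2 d r H
  /-- `∂_i M₀ u` -/
  n : Fin d → L2 d r H
  mem_d1 : ∀ i, (u, d1 i) ∈ derivGraph i
  mem_d2 : ∀ i j, (d1 i, d2 i j) ∈ derivGraph j
  mem_m : (u, m) ∈ mulGraph fun _ => A
  mem_mm : (m, mm) ∈ mulGraph fun _ => A
  mem_n : ∀ i, (m, n i) ∈ derivGraph i
  mem_d1_n : ∀ i, (d1 i, n i) ∈ mulGraph fun _ => A

variable {A : H →ₗ.[ℂ] H}

theorem norm_sq_lift_resolvents (hA : IsSelfAdjoint A) {μ : ℝ} (hμ : 0 < μ) (f : L2 d r H) :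
    ‖lift (mulSqrtResolvent A μ) f‖ ^ 2 + μ * ‖lift (sqrtResolvent A μ) f‖ ^ 2 = ‖f‖ ^ 2 := by
  set N := mulSqrtResolvent A μ
  set W := sqrtResolvent A μ
  have h1 : inner ℂ (lift N (lift N f) + (μ : ℂ) • lift W (lift W f)) f = inner ℂ f f := by
    rw [lift_mulSqrtResolvent_sq hA hμ]
  rw [inner_add_left, inner_smul_left, lift_symm (mulSqrtResolvent_symm hA hμ),
    lift_symm (sqrtResolvent_symm A μ), inner_self_eq_ofReal, inner_self_eq_ofReal,
    inner_self_eq_ofReal, Complex.conj_ofReal] at h1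
  exact_mod_cast h1

theorem norm_lift_mulSqrtResolvent_le (hA : IsSelfAdjoint A) {μ : ℝ} (hμ : 0 < μ)
    (f : L2 d r H) : ‖lift (mulSqrtResolvent A μ) f‖ ≤ ‖f‖ := by
  have := norm_sq_lift_resolvents hA hμ f
  apply le_of_sq_le_sq _ (norm_nonneg _)
  nlinarith [sq_nonneg ‖lift (sqrtResolvent A μ) f‖]

theorem norm_lift_sqrtResolvent_le (hA : IsSelfAdjoint A) {μ : ℝ} (hμ : 0 < μ)
    (f : L2 d r H) : √μ * ‖lift (sqrtResolvent A μ) f‖ ≤ ‖f‖ := by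
  have := norm_sq_lift_resolvents hA hμ f
  apply le_of_sq_le_sq _ (norm_nonneg _)
  rw [mul_pow, Real.sq_sqrt hμ.le]
  nlinarith [sq_nonneg ‖lift (mulSqrtResolvent A μ) f‖]

/-- `H₀ + 2μ` has a bounded right inverse with values in the functions that have a `Jet`, and
`M₀² + μ` is bounded by `H₀ + 2μ`. -/
theorem exists_resolvent_jet (hA : IsSelfAdjoint A) {μ : ℝ} (hμ : 0 < μ) :
    ∃ G : L2 d r H →L[ℂ] L2 d r H, ∀ h, ∃ J : Jet A (G h),
      -∑ i, J.d2 i i + J.mm + ((2 * μ : ℝ) : ℂ) • G h = h ∧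
        ‖J.mm + (μ : ℂ) • G h‖ ≤ ‖h‖ := by
  obtain ⟨Λ⟩ := exists_laplaceResolvent (d := d) (r := r) (H := H) hμ
  set a := Λ.a
  set D := Λ.D
  set D2 := Λ.D2
  have hD : ∀ i f, (a f, D i f) ∈ derivGraph i := Λ.mem_D
  have hD2 : ∀ i j f, (D i f, D2 i j f) ∈ derivGraph j := Λ.mem_D2
  have haf : ∀ f, -∑ i, D2 i i f + (μ : ℂ) • a f = f := Λ.eqn
  set W : L2 d r H →L[ℂ] L2 d r H := lift (sqrtResolvent A μ) with hWdef
  set N : L2 d r H →L[ℂ] L2 d r H := lift (mulSqrtResolvent A μ) with hNdef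
  have hWs : ∀ x y, inner ℂ (W x) y = inner ℂ x (W y) := lift_symm (sqrtResolvent_symm A μ)
  have hNs : ∀ x y, inner ℂ (N x) y = inner ℂ x (N y) := lift_symm (mulSqrtResolvent_symm hA hμ)
  have hNW : ∀ f, N (W f) = W (N f) := lift_comm (mulSqrtResolvent_comm hA hμ)
  have hN1 : ∀ f, ‖N f‖ ≤ ‖f‖ := norm_lift_mulSqrtResolvent_le hA hμ
  have hWN : ∀ f, (W f, N f) ∈ mulGraph fun _ => A := lift_sqrtResolvent_mem hA hμ
  have hNN : ∀ f, N (N f) + (μ : ℂ) • W (W f) = f := lift_mulSqrtResolvent_sq hA hμ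
  have hacomm : ∀ (S : H →L[ℂ] H) (f : L2 d r H), a (lift S f) = lift S (a f) := Λ.comm hμ
  have hDcomm : ∀ (i) (S : H →L[ℂ] H) (f : L2 d r H), D i (lift S f) = lift S (D i f) :=
    Λ.comm_D hμ
  have hax : ∀ x, (inner ℂ (a x) x).re = ∑ i, ‖D i x‖ ^ 2 + μ * ‖a x‖ ^ 2 := Λ.re_inner_self
  obtain ⟨hdense, ha1, hW1, X, Y, hX, hY, hXY, haY, hX1, hY1⟩ := exists_resolvent_sum a W Λ.symm
    (fun x => by rw [hax]; positivity) (fun _ => Λ.injective) hWs (hacomm _)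
  -- `Z i` maps `(a + W²) k` to `∂_i M₀ a W² k`: the mixed terms are bounded by
  -- `‖∂_i a N W k‖² ≤ ⟨N² a k, W² k⟩` with `N = M₀ W`
  have hZ : ∀ i, ∃ Z : L2 d r H →L[ℂ] L2 d r H,
      (∀ k, Z ((a + W * W) k) = ((D i).comp (N.comp W)) k) ∧ ∀ v, ‖Z v‖ ≤ 1 * ‖v‖ := by
    intro i
    refine exists_factor_of_denseRange _ _ hdense fun k => ?_
    rw [one_mul]
    apply le_of_sq_le_sq _ (norm_nonneg _)
    have h1 : ‖D i (N (W k))‖ ^ 2 ≤ (inner ℂ (a (N (W k))) (N (W k))).re := by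
      rw [hax]
      have := Finset.single_le_sum (f := fun i => ‖D i (N (W k))‖ ^ 2)
        (fun _ _ => by positivity) (Finset.mem_univ i)
      have h0 : 0 ≤ μ * ‖a (N (W k))‖ ^ 2 := by positivity
      linarith
    have h2 : inner ℂ (a (N (W k))) (N (W k)) = inner ℂ (N (N (a k))) (W (W k)) := by
      rw [hNdef, hacomm, hWdef, hacomm, ← hNdef, ← hWdef, ← hNs, hNW, hNW, hWs]
    have h3 : (inner ℂ (N (N (a k))) (W (W k))).re ≤ ‖(a + W * W) k‖ * ‖(a + W * W) k‖ :=
      ((Complex.re_le_norm _).trans (norm_inner_le_norm _ _)).trans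
        (mul_le_mul (((hN1 _).trans (hN1 _)).trans (ha1 k)) (hW1 k) (norm_nonneg _)
          (norm_nonneg _))
    rw [h2] at h1
    change ‖D i (N (W k))‖ ^ 2 ≤ _
    nlinarith
  choose Z hZ _ using hZ
  have hZ1 : ∀ i h, (N (W (X h)), Z i h) ∈ derivGraph i := by
    intro i
    have hcl : IsClosed {h | (N (W (X h)), Z i h) ∈ derivGraph i} :=
      (isClosed_derivGraph i).preimage (by fun_prop : Continuous fun h => (N (W (X h)), Z i h))
    refine isClosed_property hdense hcl fun k => ?_
    rw [hX, hZ, hWdef, ← hacomm, hNdef, ← hacomm]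
    exact hD i _
  have hZ2 : ∀ i h, (D i (Y h), Z i h) ∈ mulGraph fun _ => A := by
    intro i
    have hcl : IsClosed {h | (D i (Y h), Z i h) ∈ mulGraph fun _ => A} :=
      (isClosed_mulGraph_const hA).preimage
        (by fun_prop : Continuous fun h => (D i (Y h), Z i h))
    refine isClosed_property hdense hcl fun k => ?_
    have e1 : D i (W (W k)) = W (D i (W k)) := hDcomm i _ _
    have e2 : D i (N (W k)) = N (D i (W k)) := hDcomm i _ _
    rw [hY, hZ, e1]
    change (_, D i (N (W k))) ∈ _
    rw [e2]
    exact hWN _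
  refine ⟨a.comp Y, fun h => ⟨⟨fun i => D i (Y h), fun i j => D2 i j (Y h), N (W (X h)),
    N (N (X h)), fun i => Z i h, fun i => hD i _, fun i j => hD2 i j _, ?_, ?_,
    fun i => hZ1 i h, fun i => hZ2 i h⟩, ?_, ?_⟩⟩
  · change (a (Y h), _) ∈ _
    rw [haY]
    exact hWN _
  · rw [hNW]
    exact hWN _
  · change -∑ i, D2 i i (Y h) + N (N (X h)) + ((2 * μ : ℝ) : ℂ) • a (Y h) = h
    have h1 := haf (Y h)
    have h2 := hNN (X h)
    rw [← haY] at h2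
    calc _ = (-∑ i, D2 i i (Y h) + (μ : ℂ) • a (Y h)) + (N (N (X h)) + (μ : ℂ) • a (Y h)) := by
          rw [two_mul, Complex.ofReal_add, add_smul]; abel
      _ = h := by rw [h1, h2, add_comm, hXY]
  · change ‖N (N (X h)) + (μ : ℂ) • a (Y h)‖ ≤ ‖h‖
    rw [haY, hNN]
    exact hX1 h

theorem mem_H0_graph {u w : L2 d r H} : (u, w) ∈ (H0 A).graph ↔
    ∃ (u' : Fin d → L2 d r H) (u'' : Fin d → Fin d → L2 d r H) (m mm : L2 d r H),
      (∀ i, (u, u' i) ∈ derivGraph i) ∧ (∀ i j, (u' i, u'' i j) ∈ derivGraph j) ∧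
      ((u, m) ∈ mulGraph fun _ => A) ∧ ((m, mm) ∈ mulGraph fun _ => A) ∧
        w = -∑ i, u'' i i + mm := by
  rw [H0, mem_add_graph]
  simp only [mem_laplaceOp_graph, mem_opMul_graph, mem_M0_graph]
  constructor
  · rintro ⟨y, w, ⟨u', u'', h1, h2, rfl⟩, ⟨m, h3, h4⟩, rfl⟩
    exact ⟨u', u'', m, w, h1, h2, h3, h4, rfl⟩
  · rintro ⟨u', u'', m, mm, h1, h2, h3, h4, rfl⟩
    exact ⟨_, mm, ⟨u', u'', h1, h2, rfl⟩, ⟨m, h3, h4⟩, rfl⟩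

theorem Jet.mem_H0_graph {u : L2 d r H} (J : Jet A u) :
    (u, -∑ i, J.d2 i i + J.mm) ∈ (H0 A).graph :=
  DiracSchrodinger.mem_H0_graph.2
    ⟨J.d1, J.d2, J.m, J.mm, J.mem_d1, J.mem_d2, J.mem_m, J.mem_mm, rfl⟩

/-- The maximal regularity of `H₀`: on its domain the mixed terms `∂_i M₀ u` exist as well. -/
theorem exists_jet_of_mem_H0_domain (hA : IsSelfAdjoint A) {u : L2 d r H}
    (hu : u ∈ (H0 A).domain) : Nonempty (Jet A u) := by
  obtain ⟨w, hw⟩ := LinearPMap.mem_domain_iff.1 hu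
  obtain ⟨G, hG⟩ := exists_resolvent_jet (d := d) (r := r) hA one_pos
  obtain ⟨J, hJ, -⟩ := hG (w + ((2 * 1 : ℝ) : ℂ) • u)
  -- the solution of `(H₀ + 2) v = (H₀ + 2) u` with a `Jet` agrees with `u`, since `H₀ ≥ 0`
  suffices h : u = G (w + ((2 * 1 : ℝ) : ℂ) • u) by rw [h]; exact ⟨J⟩
  generalize G (w + ((2 * 1 : ℝ) : ℂ) • u) = v at J hJ
  have h1 : (u - v, w - (-∑ i, J.d2 i i + J.mm)) ∈ (H0 A).graph :=
    (H0 A).graph.sub_mem hw J.mem_H0_graph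
  obtain ⟨u', u'', m, mm, h2, h3, h4, h5, h6⟩ := DiracSchrodinger.mem_H0_graph.1 h1
  have h7 : -∑ i, u'' i i + mm + ((2 * 1 : ℝ) : ℂ) • (u - v) = 0 := by
    rw [← h6, smul_sub]
    rw [← sub_eq_zero] at hJ
    rw [← neg_eq_zero, ← hJ]
    abel
  have h8 := congrArg (inner ℂ (u - v)) h7
  rw [inner_add_right, inner_add_right, inner_laplace_self h2 fun i => h3 i i,
    ← inner_mulGraph_const hA h4 h5, inner_smul_right, inner_self_eq_ofReal,
    inner_self_eq_ofReal, inner_zero_right] at h8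
  have h9 : ∑ i, ‖u' i‖ ^ 2 + ‖m‖ ^ 2 + 2 * 1 * ‖u - v‖ ^ 2 = 0 := by exact_mod_cast h8
  have h10 : 0 ≤ ∑ i, ‖u' i‖ ^ 2 := by positivity
  have h11 : ‖u - v‖ ^ 2 = 0 := by nlinarith [sq_nonneg ‖u - v‖, sq_nonneg ‖m‖]
  exact sub_eq_zero.1 (norm_eq_zero.1 (pow_eq_zero_iff two_ne_zero |>.1 h11))

end Free

/-! ### Relatively bounded families of operators -/

section Family

variable {d r : ℕ} {H : Type*} [NormedAddCommGroup H] [InnerProductSpace ℂ H]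

theorem norm_le_of_opENorm_le {T : H →ₗ.[ℂ] H} {ε : ℝ} (hε : 0 ≤ ε)
    (h : opENorm T ≤ ENNReal.ofReal ε) {x y : H} (hxy : (x, y) ∈ T.graph) : ‖y‖ ≤ ε * ‖x‖ := by
  have hx := domain_of_mem_graph hxy
  rcases eq_or_ne x 0 with rfl | hx0
  · rw [LinearPMap.graph_fst_eq_zero_snd _ hxy rfl]
    simp
  have h1 : ‖T ⟨x, hx⟩‖ₑ / ‖x‖ₑ ≤ ENNReal.ofReal ε :=
    (le_iSup (fun u : T.domain => ‖T u‖ₑ / ‖(u : H)‖ₑ) ⟨x, hx⟩).trans h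
  rw [apply_of_mem_graph hxy hx, ENNReal.div_le_iff (by simpa using hx0) (by simp)] at h1
  rw [← ofReal_norm, ← ofReal_norm, ← ENNReal.ofReal_mul hε] at h1
  exact (ENNReal.ofReal_le_ofReal_iff (by positivity)).1 h1

variable [CompleteSpace H] {A : H →ₗ.[ℂ] H} {B : Rn d → H →ₗ.[ℂ] H}

theorem bracketPow_neg_one (hA : IsSelfAdjoint A) :
    bracketPow A (-1) = ofBdd (sqrtResolvent A 1) := by
  rw [bracketPow, if_pos (by norm_num), neg_neg, ← bracketNeg_one hA one_pos, Complex.ofReal_one]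

theorem bracketPow_neg_two (hA : IsSelfAdjoint A) :
    bracketPow A (-1 - 1) = ofBdd (sqResolvent A) := by
  rw [bracketPow, if_pos (by norm_num), ← bracketNeg_two hA]
  norm_num

theorem bracketPow_zero (hA : IsSelfAdjoint A) : bracketPow A 0 = ofBdd 1 := by
  rw [bracketPow, if_pos le_rfl, neg_zero, bracketNeg_zero hA]

theorem mem_bracketPow_one_graph (hA : IsSelfAdjoint A) {s t : H} :
    (s, t) ∈ (bracketPow A 1).graph ↔ s = sqrtResolvent A 1 t := by
  rw [bracketPow, if_neg (by norm_num), ← Complex.ofReal_one, bracketNeg_one hA one_pos,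
    mem_inverse_graph (ker_toFun_eq_bot fun x hx => ?_), mem_ofBdd_graph]
  rw [mem_ofBdd_graph] at hx
  exact sqrtResolvent_injective hA one_pos hx.symm

theorem sqrtResolvent_one_sq (hA : IsSelfAdjoint A) (v : H) :
    sqrtResolvent A 1 (sqrtResolvent A 1 v) = sqResolvent A v := by
  obtain ⟨C, hC⟩ := exists_sqrtResolvent_sq hA one_pos
  obtain ⟨h1, h2⟩ := hC v
  rw [Complex.ofReal_one, one_smul, sub_add_cancel] at h2
  rw [h1, ← h2]

/-- The bounded family `B ⟨A⟩⁻¹`. -/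
def relOp (A : H →ₗ.[ℂ] H) (B : Rn d → H →ₗ.[ℂ] H) (x : Rn d) : H →L[ℂ] H :=
  bddClosure (opMul (B x) (bracketPow A (-1)))

/-- The bounded family `⟨A⟩ B ⟨A⟩⁻²`. -/
def conjRelOp (A : H →ₗ.[ℂ] H) (B : Rn d → H →ₗ.[ℂ] H) (x : Rn d) : H →L[ℂ] H :=
  bddClosure (opMul (bracketPow A 1) (opMul (B x) (bracketPow A (-1 - 1))))

theorem relOp_regularity (hA : IsSelfAdjoint A) (hBW : MemWInftyRel 1 A 1 B) :
    (∀ x, HasBddClosure (opMul (B x) (bracketPow A (-1)))) ∧ MemWInfty 1 (relOp A B) := by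
  have h := hBW 0 (by norm_num)
  rw [sub_zero, bracketPow_zero hA] at h
  simp only [opMul_ofBdd_one] at h
  exact h

theorem memLInfty_relOp (hA : IsSelfAdjoint A) (hBW : MemWInftyRel 1 A 1 B) :
    MemLInfty (relOp A B) := (relOp_regularity hA hBW).2.1

theorem weakPartial_relOp (hA : IsSelfAdjoint A) (hBW : MemWInftyRel 1 A 1 B) (i : Fin d) :
    IsWeakPartial i (relOp A B) (weakPartial i (relOp A B)) ∧
      MemLInfty (weakPartial i (relOp A B)) := by
  have h : ∃ G, IsWeakPartial i (relOp A B) G ∧ MemLInfty G := (relOp_regularity hA hBW).2.2 i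
  rw [weakPartial, dif_pos h]
  exact h.choose_spec

theorem memLInfty_conjRelOp (hBW : MemWInftyRel 1 A 1 B) : MemLInfty (conjRelOp A B) :=
  (hBW 1 (by norm_num)).2.1

theorem relOp_mem (hA : IsSelfAdjoint A) (hBdom : ∀ x, (B x).domain = A.domain)
    (hBW : MemWInftyRel 1 A 1 B) (x : Rn d) (v : H) :
    (sqrtResolvent A 1 v, relOp A B x v) ∈ (B x).graph := by
  have h1 : sqrtResolvent A 1 v ∈ (B x).domain := by
    rw [hBdom]
    exact domain_of_mem_graph (mulSqrtResolvent_spec hA one_pos v)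
  have h2 := mem_graph_of_domain (B x) h1
  have h3 : (v, B x ⟨_, h1⟩) ∈ (opMul (B x) (bracketPow A (-1))).graph := by
    rw [bracketPow_neg_one hA, mem_opMul_graph]
    exact ⟨_, mem_ofBdd_graph.2 rfl, h2⟩
  rw [relOp, ((relOp_regularity hA hBW).1 x).apply_eq h3]
  exact h2

theorem relOp_eq (hA : IsSelfAdjoint A) (hBdom : ∀ x, (B x).domain = A.domain)
    (hBW : MemWInftyRel 1 A 1 B) {x : Rn d} {v y : H}
    (h : (sqrtResolvent A 1 v, y) ∈ (B x).graph) : y = relOp A B x v :=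
  (B x).mem_graph_snd_inj h (relOp_mem hA hBdom hBW x v) rfl

/-- `B ⟨A⟩⁻¹` preserves the domain of `A`: `B ⟨A⟩⁻² = ⟨A⟩⁻¹ (⟨A⟩ B ⟨A⟩⁻²)`. -/
theorem relOp_sqrtResolvent (hA : IsSelfAdjoint A) (hBdom : ∀ x, (B x).domain = A.domain)
    (hBW : MemWInftyRel 1 A 1 B) (x : Rn d) (v : H) :
    relOp A B x (sqrtResolvent A 1 v) = sqrtResolvent A 1 (conjRelOp A B x v) := by
  have h := (hBW 1 (by norm_num)).1 x
  have hcl : IsClosed {v | relOp A B x (sqrtResolvent A 1 v) =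
      sqrtResolvent A 1 (conjRelOp A B x v)} := isClosed_eq (by fun_prop) (by fun_prop)
  refine hcl.closure_subset_iff.2 (fun v hv => ?_) (h.dense v)
  obtain ⟨t, h1⟩ := LinearPMap.mem_domain_iff.1 hv
  have h2 : conjRelOp A B x v = t := h.apply_eq h1
  rw [bracketPow_neg_two hA, mem_opMul_graph] at h1
  obtain ⟨s, h3, h4⟩ := h1
  obtain ⟨q, h5, h6⟩ := mem_opMul_graph.1 h3
  rw [mem_bracketPow_one_graph hA] at h4
  rw [mem_ofBdd_graph, ← sqrtResolvent_one_sq hA] at h5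
  rw [h5] at h6
  change relOp A B x (sqrtResolvent A 1 v) = sqrtResolvent A 1 (conjRelOp A B x v)
  rw [← relOp_eq hA hBdom hBW h6, h4, h2]

/-- The pointwise bounds contained in the semi-norm `ρ_μ(B)`. -/
theorem bounds_of_rho_le (hA : IsSelfAdjoint A) {μ ε : ℝ} (hμ : 0 < μ) (hε : 0 ≤ ε)
    (h : rho A B (μ : ℂ) ≤ ENNReal.ofReal ε) : ∀ᵐ x,
      (∀ v y, (sqrtResolvent A μ v, y) ∈ (B x).graph → ‖y‖ ≤ ε * ‖v‖) ∧
      (∀ v t, (sqrtResolvent A 1 (sqrtResolvent A μ v), sqrtResolvent A 1 t) ∈ (B x).graph →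
        ‖t‖ ≤ ε * ‖v‖) ∧
      ∀ i v, ‖weakPartial i (relOp A B) x (sqrtResolvent A μ v)‖ ≤ ε * ‖v‖ := by
  rw [rho, bracketNeg_one hA hμ] at h
  have h1 := (le_self_add.trans le_self_add).trans h
  have h2 := (le_add_self.trans le_self_add).trans h
  have h3 := fun i => ((Finset.single_le_sum (f := fun i : Fin d => essSup (fun x =>
    ‖(weakPartial i (fun y => bddClosure (opMul (B y) (bracketPow A (-1)))) x).comp
      (sqrtResolvent A μ)‖ₑ) volume) (fun _ _ => bot_le) (Finset.mem_univ i)).trans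
        le_add_self).trans h
  have e1 := ENNReal.ae_le_essSup (μ := (volume : Measure (Rn d)))
    (fun x => opENorm (opMul (B x) (ofBdd (sqrtResolvent A μ))))
  have e2 := ENNReal.ae_le_essSup (μ := (volume : Measure (Rn d)))
    (fun x => opENorm (opMul (bracketPow A 1) (opMul (B x)
    (opMul (bracketPow A (-1)) (ofBdd (sqrtResolvent A μ))))))
  have e3 := ae_all_iff.2 fun i : Fin d => ENNReal.ae_le_essSup (μ := (volume : Measure (Rn d)))
    (fun x => ‖(weakPartial i (fun y => bddClosure (opMul (B y) (bracketPow A (-1)))) x).comp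
      (sqrtResolvent A μ)‖ₑ)
  filter_upwards [e1, e2, e3] with x f1 f2 f3
  refine ⟨fun v y hy => ?_, fun v t ht => ?_, fun i v => ?_⟩
  · exact norm_le_of_opENorm_le hε (f1.trans h1)
      (mem_opMul_graph.2 ⟨_, mem_ofBdd_graph.2 rfl, hy⟩)
  · refine norm_le_of_opENorm_le hε (f2.trans h2) (x := v) (y := t) ?_
    rw [bracketPow_neg_one hA]
    exact mem_opMul_graph.2 ⟨_, mem_opMul_graph.2 ⟨_, mem_opMul_graph.2
      ⟨_, mem_ofBdd_graph.2 rfl, mem_ofBdd_graph.2 rfl⟩, ht⟩,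
      (mem_bracketPow_one_graph hA).2 rfl⟩
  · have f4 := (f3 i).trans (h3 i)
    rw [← ofReal_norm, ENNReal.ofReal_le_ofReal_iff hε] at f4
    exact (ContinuousLinearMap.le_opNorm _ v).trans
      (mul_le_mul_of_nonneg_right f4 (norm_nonneg _))

theorem exists_rho_le (h : Tendsto (rho A B)
      (comap (fun z : ℂ => Metric.infDist z {w : ℂ | w.re ≤ 0 ∧ w.im = 0}) atTop) (𝓝 0))
    {ε : ℝ} (hε : 0 < ε) : ∃ μ : ℝ, 1 ≤ μ ∧ rho A B (μ : ℂ) ≤ ENNReal.ofReal ε := by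
  have h1 : Tendsto (fun μ : ℝ => (μ : ℂ)) atTop
      (comap (fun z : ℂ => Metric.infDist z {w : ℂ | w.re ≤ 0 ∧ w.im = 0}) atTop) := by
    rw [tendsto_comap_iff]
    refine tendsto_atTop_mono (fun μ => ?_) tendsto_id
    refine (Metric.le_infDist ⟨0, by simp⟩).2 fun w hw => ?_
    rw [Complex.dist_eq]
    refine le_trans ?_ (Complex.re_le_norm _)
    simp only [id, Complex.sub_re, Complex.ofReal_re]
    linarith [hw.1]
  have h2 : ∀ᶠ y in 𝓝 (0 : ℝ≥0∞), y ≤ ENNReal.ofReal ε :=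
    (eventually_lt_nhds (ENNReal.ofReal_pos.2 hε)).mono fun _ h => h.le
  obtain ⟨μ, h3, h4⟩ := (((h.comp h1).eventually h2).and (eventually_ge_atTop 1)).exists
  exact ⟨μ, h4, h3⟩

end Family

/-! ### Multiplication by bounded families -/

section MulFamily

variable {d r : ℕ} {H : Type*} [NormedAddCommGroup H] [InnerProductSpace ℂ H]

theorem MemLInfty.aestronglyMeasurable_apply {F : Rn d → H →L[ℂ] H} (hF : MemLInfty F)
    {f : Rn d → H} (hf : AEStronglyMeasurable f volume) :
    AEStronglyMeasurable (fun x => F x (f x)) volume := by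
  have hs : ∀ s : SimpleFunc (Rn d) H, AEStronglyMeasurable (fun x => F x (s x)) volume := by
    intro s
    induction s using SimpleFunc.induction with
    | @const c s hs =>
      refine ((hF.1 c).indicator hs).congr (Eventually.of_forall fun x => ?_)
      by_cases hx : x ∈ s
      · simp [SimpleFunc.piecewise_apply, hx, Set.indicator]
      · simp [SimpleFunc.piecewise_apply, hx, Set.indicator]
    | add _ h1 h2 =>
      refine (h1.add h2).congr (Eventually.of_forall fun x => ?_)
      simp
  obtain ⟨g, hg, hfg⟩ := hf
  refine AEStronglyMeasurable.congr (f := fun x => F x (g x)) ?_ (hfg.mono fun x hx => by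
    simp only [hx])
  exact aestronglyMeasurable_of_tendsto_ae atTop (fun n => hs (hg.approx n))
    (Eventually.of_forall fun x => ((F x).continuous.tendsto _).comp (hg.tendsto_approx x))

theorem MemLInfty.ae_norm_le {F : Rn d → H →L[ℂ] H} (hF : MemLInfty F) :
    ∀ᵐ x, ‖F x‖ ≤ (essSup (fun x => ‖F x‖ₑ) volume).toReal := by
  filter_upwards [ENNReal.ae_le_essSup (μ := (volume : Measure (Rn d))) fun x => ‖F x‖ₑ] with x hx
  rw [← toReal_enorm]
  exact ENNReal.toReal_mono hF.2.ne hx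

theorem MemLInfty.exists_apply {F : Rn d → H →L[ℂ] H} (hF : MemLInfty F) (f : L2 d r H) :
    ∃ g : L2 d r H, ∀ᵐ x, ∀ k, g x k = F x (f x k) := by
  set C := (essSup (fun x => ‖F x‖ₑ) (volume : Measure (Rn d))).toReal
  have hC : 0 ≤ C := ENNReal.toReal_nonneg
  let g : Rn d → PiLp 2 fun _ : Fin r => H := fun x => WithLp.toLp 2 fun k => F x (f x k)
  have hg : AEStronglyMeasurable g volume := by
    have h1 : ∀ k, AEStronglyMeasurable (fun x => F x (f x k)) volume := fun k =>
      hF.aestronglyMeasurable_apply ((PiLp.proj (𝕜 := ℂ) 2 (fun _ : Fin r => H)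
        k).continuous.comp_aestronglyMeasurable (Lp.aestronglyMeasurable f))
    have h2 : AEStronglyMeasurable (fun x => ∑ k, (PiLp.single 2 k (F x (f x k)) :
        PiLp 2 fun _ : Fin r => H)) volume := by
      refine Finset.aestronglyMeasurable_fun_sum _ fun k _ => ?_
      refine Continuous.comp_aestronglyMeasurable (g := fun v : H =>
        (PiLp.single 2 k v : PiLp 2 fun _ : Fin r => H)) ?_ (h1 k)
      exact (PiLp.continuous_toLp 2 (fun _ : Fin r => H)).comp
        (continuous_single (A := fun _ : Fin r => H) k)
    refine h2.congr (Eventually.of_forall fun x => ?_)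
    ext l
    simp [g, Finset.sum_apply, Pi.single_apply]
  have hL : MemLp g 2 volume := by
    refine (Lp.memLp f).of_le_mul (c := C) hg ?_
    filter_upwards [hF.ae_norm_le] with x hx
    apply le_of_sq_le_sq _ (by positivity)
    rw [mul_pow, PiLp.norm_sq_eq_of_L2, PiLp.norm_sq_eq_of_L2, Finset.mul_sum]
    refine Finset.sum_le_sum fun k _ => ?_
    rw [← mul_pow]
    exact pow_le_pow_left₀ (norm_nonneg _) ((F x).le_of_opNorm_le hx _) 2
  refine ⟨hL.toLp, ?_⟩
  filter_upwards [hL.coeFn_toLp] with x hx k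
  rw [hx]

/-- Multiplication by a family in `L^∞(ℝ^d, B(H))`, as a bounded operator in `L²`. -/
theorem MemLInfty.exists_mulCLM {F : Rn d → H →L[ℂ] H} (hF : MemLInfty F) :
    ∃ M : L2 d r H →L[ℂ] L2 d r H, ∀ f, ∀ᵐ x, ∀ k, M f x k = F x (f x k) := by
  choose M hM using fun f : L2 d r H => hF.exists_apply f
  refine ⟨LinearMap.mkContinuous
    { toFun := M
      map_add' := fun f g => ?_
      map_smul' := fun c f => ?_ } (essSup (fun x => ‖F x‖ₑ) volume).toReal fun f => ?_, hM⟩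
  · apply ext_comp_ae
    filter_upwards [hM f, hM g, hM (f + g), Lp.coeFn_add f g, Lp.coeFn_add (M f) (M g)]
      with x h1 h2 h3 h4 h5 k
    change M (f + g) x k = (M f + M g : L2 d r H) x k
    rw [h3, h4, h5, Pi.add_apply, Pi.add_apply, PiLp.add_apply, PiLp.add_apply, map_add, h1, h2]
  · apply ext_comp_ae
    filter_upwards [hM f, hM (c • f), Lp.coeFn_smul c f, Lp.coeFn_smul c (M f)]
      with x h1 h3 h4 h5 k
    change M (c • f) x k = (c • M f : L2 d r H) x k
    rw [h3, h4, h5, Pi.smul_apply, Pi.smul_apply, PiLp.smul_apply, PiLp.smul_apply, map_smul, h1]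
  · apply norm_le_of_comp_ae ENNReal.toReal_nonneg
    filter_upwards [hF.ae_norm_le, hM f] with x h1 h2 k
    change ‖M f x k‖ ≤ _
    rw [h2]
    exact (F x).le_of_opNorm_le h1 _

variable [CompleteSpace H]

/-- The product rule `∂_i (F w) = (∂_i F) w + F ∂_i w`; it extends from test functions by the core
property. -/
theorem mulCLM_mem_derivGraph {i : Fin d} {F G : Rn d → H →L[ℂ] H}
    (h : IsWeakPartial i F G) {M M' : L2 d r H →L[ℂ] L2 d r H}
    (hM : ∀ f, ∀ᵐ x, ∀ k, M f x k = F x (f x k)) (hM' : ∀ f, ∀ᵐ x, ∀ k, M' f x k = G x (f x k))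
    {w w' : L2 d r H} (hw : (w, w') ∈ derivGraph i) : (M w, M' w + M w') ∈ derivGraph i := by
  let Φ : L2 d r H × L2 d r H →L[ℂ] L2 d r H × L2 d r H :=
    (M.comp (ContinuousLinearMap.fst ℂ _ _)).prod
      (M'.comp (ContinuousLinearMap.fst ℂ _ _) + M.comp (ContinuousLinearMap.snd ℂ _ _))
  have hcl : IsClosed (((derivGraph i).comap Φ.toLinearMap :
      Submodule ℂ (L2 d r H × L2 d r H)) : Set (L2 d r H × L2 d r H)) :=
    (isClosed_derivGraph i).preimage Φ.continuous
  refine derivGraph_le_of_test _ hcl (fun η hη hc v => ?_) hw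
  set t := testL2 hη.continuous hc v
  set t' := testL2 (continuous_partialDeriv i hη) (hasCompactSupport_partialDeriv i hc) v
  change (M t, M' t + M t') ∈ derivGraph i
  intro θ hθ hθc
  change ∫ x, partialDeriv i θ x • M t x = -∫ x, θ x • (M' t + M t') x
  have a1 : ∀ᵐ x, ∀ k, M t x k = η x • F x (v k) := by
    filter_upwards [hM t, (memLp_test_smul hη.continuous hc v).coeFn_toLp] with x h1 h2 k
    rw [h1]
    simp only [t, testL2, h2, PiLp.smul_apply]
    exact (F x).map_smul_of_tower _ _
  have a2 : ∀ᵐ x, ∀ k, M' t x k = η x • G x (v k) := by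
    filter_upwards [hM' t, (memLp_test_smul hη.continuous hc v).coeFn_toLp] with x h1 h2 k
    rw [h1]
    simp only [t, testL2, h2, PiLp.smul_apply]
    exact (G x).map_smul_of_tower _ _
  have a3 : ∀ᵐ x, ∀ k, M t' x k = partialDeriv i η x • F x (v k) := by
    filter_upwards [hM t', (memLp_test_smul (continuous_partialDeriv i hη)
      (hasCompactSupport_partialDeriv i hc) v).coeFn_toLp] with x h1 h2 k
    rw [h1]
    simp only [t', testL2, h2, PiLp.smul_apply]
    exact (F x).map_smul_of_tower _ _
  have j1 := integrable_test_smul (M t) (continuous_partialDeriv i hθ)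
    (hasCompactSupport_partialDeriv i hθc)
  have j2 := integrable_test_smul (M' t + M t') hθ.continuous hθc
  have j3 := integrable_test_smul (M' t) hθ.continuous hθc
  have j4 := integrable_test_smul (M t') hθ.continuous hθc
  let π := fun k => PiLp.proj (𝕜 := ℂ) 2 (fun _ : Fin r => H) k
  ext k
  have c1 : (∫ x, partialDeriv i θ x • M t x) k =
      ∫ x, (partialDeriv i θ x * η x) • F x (v k) := by
    refine ((π k).integral_comp_comm j1).symm.trans (integral_congr_ae ?_)
    filter_upwards [a1] with x h1
    change partialDeriv i θ x • M t x k = _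
    rw [h1, smul_smul]
  have c2 : (∫ x, θ x • (M' t + M t') x) k =
      (∫ x, (θ x * η x) • G x (v k)) + ∫ x, (θ x * partialDeriv i η x) • F x (v k) := by
    have b2 : (fun x => (θ x * η x) • G x (v k)) =ᵐ[volume] fun x => π k (θ x • M' t x) := by
      filter_upwards [a2] with x h1
      change _ = θ x • M' t x k
      rw [h1, smul_smul]
    have b3 : (fun x => (θ x * partialDeriv i η x) • F x (v k)) =ᵐ[volume]
        fun x => π k (θ x • M t' x) := by
      filter_upwards [a3] with x h1
      change _ = θ x • M t' x k
      rw [h1, smul_smul]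
    rw [integral_congr_ae b2, integral_congr_ae b3,
      ← integral_add ((π k).integrable_comp j3) ((π k).integrable_comp j4)]
    refine ((π k).integral_comp_comm j2).symm.trans (integral_congr_ae ?_)
    filter_upwards [Lp.coeFn_add (M' t) (M t')] with x h1
    rw [h1, Pi.add_apply, smul_add, map_add]
  change (∫ x, partialDeriv i θ x • M t x) k = -((∫ x, θ x • (M' t + M t') x) k)
  have hd : ∀ x, partialDeriv i (fun x => θ x * η x) x =
      partialDeriv i θ x * η x + θ x * partialDeriv i η x := by
    intro x
    rw [partialDeriv, fderiv_fun_mul (hθ.differentiable (by simp) x)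
      (hη.differentiable (by simp) x)]
    simp only [_root_.add_apply, _root_.smul_apply, smul_eq_mul,
      partialDeriv]
    ring
  have key := h (v k) (fun x => θ x * η x) (hθ.mul hη) hθc.mul_right
  simp only [hd, add_smul] at key
  rw [integral_add] at key
  · rw [c1, c2, ← sub_eq_zero]
    rw [← sub_eq_zero] at key
    rw [← key]
    abel
  · refine ((π k).integrable_comp j1).congr ?_
    filter_upwards [a1] with x h1
    change partialDeriv i θ x • M t x k = _
    rw [h1, smul_smul]
  · refine ((π k).integrable_comp j4).congr ?_
    filter_upwards [a3] with x h1
    change θ x • M t' x k = _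
    rw [h1, smul_smul]

end MulFamily

/-! ### Bounds for the perturbation relative to `H₀` -/

section Perturbation

variable {d r : ℕ} {H : Type*} [NormedAddCommGroup H] [InnerProductSpace ℂ H] [CompleteSpace H]
  {A : H →ₗ.[ℂ] H} {B : Rn d → H →ₗ.[ℂ] H}

theorem lift_mulSqrtResolvent_of_mem (hA : IsSelfAdjoint A) {μ : ℝ} (hμ : 0 < μ) {u m : L2 d r H}
    (h : (u, m) ∈ mulGraph fun _ => A) :
    lift (mulSqrtResolvent A μ) u = lift (sqrtResolvent A μ) m := by
  have h' : ∀ᵐ x, ∀ k, ((u x) k, (m x) k) ∈ A.graph := h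
  apply ext_comp_ae
  filter_upwards [h', lift_ae (mulSqrtResolvent A μ) u, lift_ae (sqrtResolvent A μ) m]
    with x h1 h2 h3 k
  rw [h2, h3]
  exact mulSqrtResolvent_of_mem_graph hA hμ (h1 k)

/-- `(M₀² + μ)^(1/2) u = M₀ (M₀² + μ)^(-1/2) M₀ u + μ (M₀² + μ)^(-1/2) u` for `u ∈ dom M₀`. -/
theorem lift_sqrtResolvent_preimage (hA : IsSelfAdjoint A) {μ : ℝ} (hμ : 0 < μ) {u m : L2 d r H}
    (h : (u, m) ∈ mulGraph fun _ => A) :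
    lift (sqrtResolvent A μ)
      (lift (mulSqrtResolvent A μ) m + (μ : ℂ) • lift (sqrtResolvent A μ) u) = u := by
  rw [map_add, map_smul, ← lift_comm (mulSqrtResolvent_comm hA hμ),
    ← lift_mulSqrtResolvent_of_mem hA hμ h, lift_mulSqrtResolvent_sq hA hμ]

theorem norm_preimage_le (hA : IsSelfAdjoint A) {μ : ℝ} (hμ : 0 < μ) (u m : L2 d r H) :
    ‖lift (mulSqrtResolvent A μ) m + (μ : ℂ) • lift (sqrtResolvent A μ) u‖ ≤
      ‖m‖ + √μ * ‖u‖ := by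
  refine (norm_add_le _ _).trans (add_le_add (norm_lift_mulSqrtResolvent_le hA hμ m) ?_)
  rw [norm_smul, Complex.norm_real, Real.norm_of_nonneg hμ.le]
  calc μ * ‖lift (sqrtResolvent A μ) u‖ = √μ * (√μ * ‖lift (sqrtResolvent A μ) u‖) := by
        rw [← mul_assoc, Real.mul_self_sqrt hμ.le]
    _ ≤ √μ * ‖u‖ := mul_le_mul_of_nonneg_left (norm_lift_sqrtResolvent_le hA hμ u)
        (Real.sqrt_nonneg _)

/-- `B` maps `dom M₀` into `L²`. -/
theorem exists_mem_mulGraph (hA : IsSelfAdjoint A) (hBdom : ∀ x, (B x).domain = A.domain)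
    (hBW : MemWInftyRel 1 A 1 B) {u m : L2 d r H} (h : (u, m) ∈ mulGraph fun _ => A) :
    ∃ b, (u, b) ∈ mulGraph B := by
  obtain ⟨M, hM⟩ := (memLInfty_relOp hA hBW).exists_mulCLM (r := r)
  have e := lift_sqrtResolvent_preimage hA one_pos h
  set w := lift (mulSqrtResolvent A 1) m + ((1 : ℝ) : ℂ) • lift (sqrtResolvent A 1) u
  refine ⟨M w, ?_⟩
  change ∀ᵐ x, ∀ k, (u x k, M w x k) ∈ (B x).graph
  filter_upwards [hM w, lift_ae (sqrtResolvent A 1) w] with x h1 h2 k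
  rw [← e, h1, h2]
  exact relOp_mem hA hBdom hBW x _

/-- On the functions with a `Jet`, all the first order terms of the perturbation exist, and they are
small relative to `g = (M₀² + μ) u` for suitable large `μ`. With `w = ⟨M₀⟩ u` one has
`B u = (B ⟨M₀⟩⁻¹) w`, which is differentiated by the product rule. -/
theorem exists_perturbation_bounds (hA : IsSelfAdjoint A)
    (hBdom : ∀ x, (B x).domain = A.domain) (hBW : MemWInftyRel 1 A 1 B)
    (hrho : Tendsto (rho A B)
      (comap (fun z : ℂ => Metric.infDist z {w : ℂ | w.re ≤ 0 ∧ w.im = 0}) atTop) (𝓝 0))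
    {ε : ℝ} (hε : 0 < ε) :
    ∃ μ : ℝ, 0 < μ ∧ ∀ (u : L2 d r H) (J : Jet A u),
      ∃ (b bm bb mb : L2 d r H) (b' δ : Fin d → L2 d r H),
        (u, b) ∈ mulGraph B ∧ (J.m, bm) ∈ mulGraph B ∧ (b, bb) ∈ mulGraph B ∧
        ((b, mb) ∈ mulGraph fun _ => A) ∧ (∀ i, (J.d1 i, b' i) ∈ mulGraph B) ∧
        (∀ i, (b, δ i + b' i) ∈ derivGraph i) ∧
        ‖bm‖ ≤ ε * ‖J.mm + (μ : ℂ) • u‖ ∧ ‖bb‖ ≤ ε * (2 * ε * ‖J.mm + (μ : ℂ) • u‖) ∧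
        ‖mb‖ ≤ ε * ‖J.mm + (μ : ℂ) • u‖ ∧ ∀ i, ‖δ i‖ ≤ ε * ‖J.mm + (μ : ℂ) • u‖ := by
  obtain ⟨μ, hμ1, hμ⟩ := exists_rho_le hrho hε
  have hμ0 : 0 < μ := one_pos.trans_le hμ1
  have hb := bounds_of_rho_le hA hμ0 hε.le hμ
  obtain ⟨K, hK1, hK2, hK3⟩ := exists_sqrtResolvent_factor hA hμ1
  obtain ⟨M, hM⟩ := (memLInfty_relOp hA hBW).exists_mulCLM (r := r)
  obtain ⟨S, hS⟩ := (memLInfty_conjRelOp hBW).exists_mulCLM (r := r)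
  have hG := fun i => weakPartial_relOp hA hBW i
  choose M' hM' using fun i => (hG i).2.exists_mulCLM (r := r)
  set R : L2 d r H →L[ℂ] L2 d r H := lift (sqrtResolvent A 1) with hR
  set N₁ : L2 d r H →L[ℂ] L2 d r H := lift (mulSqrtResolvent A 1) with hN₁
  set W : L2 d r H →L[ℂ] L2 d r H := lift (sqrtResolvent A μ) with hW
  set N : L2 d r H →L[ℂ] L2 d r H := lift (mulSqrtResolvent A μ) with hN
  have hRM : ∀ w, (R w, M w) ∈ mulGraph B := by
    intro w
    change ∀ᵐ x, ∀ k, (R w x k, M w x k) ∈ (B x).graph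
    filter_upwards [hM w, lift_ae (sqrtResolvent A 1) w] with x h1 h2 k
    rw [h1, h2]
    exact relOp_mem hA hBdom hBW x _
  have hMR : ∀ q, M (R q) = R (S q) := by
    intro q
    apply ext_comp_ae
    filter_upwards [hM (R q), lift_ae (sqrtResolvent A 1) q, lift_ae (sqrtResolvent A 1) (S q),
      hS q] with x h1 h2 h3 h4 k
    rw [h1, h2, h3, h4, relOp_sqrtResolvent hA hBdom hBW]
  have hRK : ∀ f, R (lift K f) = W f := by
    intro f
    apply ext_comp_ae
    filter_upwards [lift_ae (sqrtResolvent A 1) (lift K f), lift_ae K f,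
      lift_ae (sqrtResolvent A μ) f] with x h1 h2 h3 k
    rw [h1, h2, h3, hK2]
  have hKW : ∀ f, lift K (W f) = W (lift K f) :=
    lift_comm fun v => congrArg (fun T : H →L[ℂ] H => T v) hK3
  have hRinj : ∀ f : L2 d r H, R f = 0 → f = 0 := fun f =>
    lift_injective fun v => sqrtResolvent_injective hA one_pos
  -- the three bounds contained in `ρ_μ(B)`
  have bound1 : ∀ {f b : L2 d r H}, (W f, b) ∈ mulGraph B → ‖b‖ ≤ ε * ‖f‖ := by
    intro f b h
    have h' : ∀ᵐ x, ∀ k, (W f x k, b x k) ∈ (B x).graph := h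
    apply norm_le_of_comp_ae hε.le
    filter_upwards [h', hb, lift_ae (sqrtResolvent A μ) f] with x h1 h2 h3 k
    refine h2.1 _ _ ?_
    rw [← h3]
    exact h1 k
  have bound2 : ∀ f, ‖S (lift K f)‖ ≤ ε * ‖f‖ := by
    intro f
    apply norm_le_of_comp_ae hε.le
    filter_upwards [hb, hS (lift K f), lift_ae K f] with x h1 h2 h3 k
    refine h1.2.1 _ _ ?_
    rw [h2, h3, ← relOp_sqrtResolvent hA hBdom hBW, hK2]
    exact relOp_mem hA hBdom hBW x _
  have bound3 : ∀ i f, ‖M' i (W f)‖ ≤ ε * ‖f‖ := by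
    intro i f
    apply norm_le_of_comp_ae hε.le
    filter_upwards [hb, hM' i (W f), lift_ae (sqrtResolvent A μ) f] with x h1 h2 h3 k
    rw [h2, h3]
    exact h1.2.2 i _
  refine ⟨μ, hμ0, fun u J => ?_⟩
  set g := J.mm + (μ : ℂ) • u with hg
  -- `u = (M₀² + μ)⁻¹ g`
  have hu : W (W g) = u := by
    conv_rhs => rw [← lift_sqrtResolvent_preimage hA hμ0 J.mem_m]
    rw [lift_mulSqrtResolvent_of_mem hA hμ0 J.mem_mm, ← map_smul, ← map_add]
  have hm : J.m = W (N g) := by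
    have h1 := lift_sqrtResolvent_mem hA hμ0 (W g)
    rw [← hW, hu, ← hN] at h1
    rw [mulGraph_unique J.mem_m h1]
    exact lift_comm (mulSqrtResolvent_comm hA hμ0) g
  -- `w = ⟨M₀⟩ u` and its derivatives
  have hw : ∀ {v m : L2 d r H}, ((v, m) ∈ mulGraph fun _ => A) → R (N₁ m + R v) = v := by
    intro v m h
    have := lift_sqrtResolvent_preimage hA one_pos h
    rwa [Complex.ofReal_one, one_smul] at this
  set w := N₁ J.m + R u with hwdef
  have hwu : R w = u := hw J.mem_m
  have hwK : w = R (lift K (lift K g)) := by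
    rw [hRK, ← sub_eq_zero]
    apply hRinj
    rw [map_sub, hwu, ← hKW, hRK, hu, sub_self]
  have hwW : w = W (lift K g) := by rw [hwK, hRK]
  have hw' : ∀ i, (w, N₁ (J.n i) + R (J.d1 i)) ∈ derivGraph i := fun i =>
    add_mem_derivGraph (lift_mem_derivGraph (J.mem_n i) _) (lift_mem_derivGraph (J.mem_d1 i) _)
  have hKg : ‖lift K g‖ ≤ ‖g‖ := by
    simpa using norm_lift_le zero_le_one (fun v => by simpa using hK1 v) g
  have hub : (u, M w) ∈ mulGraph B := by
    have := hRM w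
    rwa [hwu] at this
  have hmb : (M w, N₁ (S (lift K (lift K g)))) ∈ mulGraph fun _ => A := by
    rw [hwK, hMR]
    exact lift_sqrtResolvent_mem hA one_pos _
  have hmb1 : ‖N₁ (S (lift K (lift K g)))‖ ≤ ε * ‖g‖ :=
    ((norm_lift_mulSqrtResolvent_le hA one_pos _).trans (bound2 _)).trans
      (mul_le_mul_of_nonneg_left hKg hε.le)
  have hb1 : √μ * ‖M w‖ ≤ ε * ‖g‖ := by
    have h1 : ‖M w‖ ≤ ε * ‖W g‖ := bound1 (by rw [hu]; exact hub)
    calc √μ * ‖M w‖ ≤ √μ * (ε * ‖W g‖) := mul_le_mul_of_nonneg_left h1 (Real.sqrt_nonneg _)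
      _ = ε * (√μ * ‖W g‖) := by ring
      _ ≤ ε * ‖g‖ := mul_le_mul_of_nonneg_left (norm_lift_sqrtResolvent_le hA hμ0 g) hε.le
  obtain ⟨bm, hbm⟩ := exists_mem_mulGraph hA hBdom hBW J.mem_mm
  obtain ⟨bb, hbb⟩ := exists_mem_mulGraph hA hBdom hBW hmb
  refine ⟨M w, bm, bb, N₁ (S (lift K (lift K g))), fun i => M (N₁ (J.n i) + R (J.d1 i)),
    fun i => M' i w, hub, hbm, hbb, hmb, fun i => ?_,
    fun i => mulCLM_mem_derivGraph (hG i).1 hM (hM' i) (hw' i), ?_, ?_, hmb1, fun i => ?_⟩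
  · have := hRM (N₁ (J.n i) + R (J.d1 i))
    rwa [hw (J.mem_d1_n i)] at this
  · rw [hm] at hbm
    exact (bound1 hbm).trans (mul_le_mul_of_nonneg_left
      (norm_lift_mulSqrtResolvent_le hA hμ0 g) hε.le)
  · rw [← lift_sqrtResolvent_preimage hA hμ0 hmb] at hbb
    refine (bound1 hbb).trans (mul_le_mul_of_nonneg_left ?_ hε.le)
    have := norm_preimage_le hA hμ0 (M w) (N₁ (S (lift K (lift K g))))
    linarith
  · rw [hwW]
    exact (bound3 i _).trans (mul_le_mul_of_nonneg_left hKg hε.le)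

end Perturbation

/-! ### Dirac operators -/

section Dirac

variable {d r : ℕ} {H : Type*} [NormedAddCommGroup H] [InnerProductSpace ℂ H] [CompleteSpace H]
  {c : Fin d → Matrix (Fin r) (Fin r) ℂ} {A : H →ₗ.[ℂ] H} {B : Rn d → H →ₗ.[ℂ] H}

theorem smul_mem_of_submodule {E : Type*} [AddCommGroup E] [Module ℂ E] (K : Submodule ℂ (E × E))
    (z : ℂ) {f g : E} (h : (f, g) ∈ K) : (z • f, z • g) ∈ K := by
  have := K.smul_mem z h
  rwa [Prod.smul_mk] at this

theorem sum_mem_of_submodule {ι E : Type*} [Fintype ι] [AddCommGroup E] [Module ℂ E]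
    (K : Submodule ℂ (E × E)) {f g : ι → E} (h : ∀ i, (f i, g i) ∈ K) :
    (∑ i, f i, ∑ i, g i) ∈ K := by
  have e : (∑ i, f i, ∑ i, g i) = ∑ i, (f i, g i) :=
    Prod.ext (by simp [Prod.fst_sum]) (by simp [Prod.snd_sum])
  rw [e]
  exact K.sum_mem fun i _ => h i

theorem mem_diracOp_graph {u v : L2 d r H} : (u, v) ∈ (diracOp c).graph ↔
    ∃ u' : Fin d → L2 d r H, (∀ i, (u, u' i) ∈ derivGraph i) ∧
      v = ∑ i, matrixL2 (c i) (u' i) := by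
  rw [diracOp, mem_sum_graph]
  simp only [mem_opMul_graph, mem_derivOp_graph, mem_ofBdd_graph]
  constructor
  · rintro ⟨y, hy, rfl⟩
    choose u' hu' hy using fun i => hy i (Finset.mem_univ i)
    exact ⟨u', hu', Finset.sum_congr rfl fun i _ => hy i⟩
  · rintro ⟨u', hu', rfl⟩
    exact ⟨fun i => matrixL2 (c i) (u' i), fun i _ => ⟨u' i, hu' i, rfl⟩, rfl⟩

theorem mem_D0_domain {u : L2 d r H} : u ∈ (D0 c A).domain ↔
    (∃ u' : Fin d → L2 d r H, ∀ i, (u, u' i) ∈ derivGraph i) ∧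
      ∃ m, (u, m) ∈ mulGraph fun _ => A := by
  rw [LinearPMap.mem_domain_iff]
  simp only [D0, mem_add_graph, mem_smul_graph, mem_diracOp_graph, mem_M0_graph]
  constructor
  · rintro ⟨_, _, m, ⟨_, ⟨u', h1, _⟩, _⟩, h2, _⟩
    exact ⟨⟨u', h1⟩, m, h2⟩
  · rintro ⟨⟨u', h1⟩, m, h2⟩
    exact ⟨_, _, m, ⟨_, ⟨u', h1, rfl⟩, rfl⟩, h2, rfl⟩

/-- The relation `v = κ ∂̸ u + B u + M₀ u`, where all the terms lie in `L²`. -/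
def DiracRel (κ : ℂ) (c : Fin d → Matrix (Fin r) (Fin r) ℂ) (A : H →ₗ.[ℂ] H)
    (B : Rn d → H →ₗ.[ℂ] H) (u v : L2 d r H) : Prop :=
  ∃ (u' : Fin d → L2 d r H) (b m : L2 d r H), (∀ i, (u, u' i) ∈ derivGraph i) ∧
    (u, b) ∈ mulGraph B ∧ ((u, m) ∈ mulGraph fun _ => A) ∧
      v = κ • ∑ i, matrixL2 (c i) (u' i) + b + m

theorem mem_DB_graph {u v : L2 d r H} :
    (u, v) ∈ (DB c A B).graph ↔ DiracRel Complex.I c A B u v := by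
  rw [DB, mem_domRestrict_graph, mem_D0_domain]
  simp only [mem_add_graph, mem_smul_graph, mem_diracOp_graph, mem_M0_graph, mem_mulOp_graph]
  constructor
  · rintro ⟨-, _, m, ⟨_, b, ⟨_, ⟨u', h1, rfl⟩, rfl⟩, h2, rfl⟩, h3, rfl⟩
    exact ⟨u', b, m, h1, h2, h3, rfl⟩
  · rintro ⟨u', b, m, h1, h2, h3, rfl⟩
    exact ⟨⟨⟨u', h1⟩, m, h3⟩, _, m, ⟨_, b, ⟨_, ⟨u', h1, rfl⟩, rfl⟩, h2, rfl⟩, h3, rfl⟩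

theorem mem_DBminus_graph {u v : L2 d r H} :
    (u, v) ∈ (DBminus c A B).graph ↔ DiracRel (-Complex.I) c A B u v := by
  rw [DBminus, mem_domRestrict_graph, mem_D0_domain]
  simp only [mem_add_graph, mem_neg_graph, mem_smul_graph, mem_diracOp_graph, mem_M0_graph,
    mem_mulOp_graph]
  constructor
  · rintro ⟨-, _, m, ⟨y, b, ⟨_, ⟨u', h1, rfl⟩, h4⟩, h2, rfl⟩, h3, rfl⟩
    exact ⟨u', b, m, h1, h2, h3, by rw [neg_smul, ← h4, neg_neg]⟩
  · rintro ⟨u', b, m, h1, h2, h3, rfl⟩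
    exact ⟨⟨⟨u', h1⟩, m, h3⟩, _, m, ⟨_, b, ⟨_, ⟨u', h1, rfl⟩, by rw [neg_smul, neg_neg]⟩, h2, rfl⟩,
      h3, rfl⟩

/-- Since `B` is bounded relative to `M₀`, the domain of `κ ∂̸ + B + M₀` is that of `D₀`. -/
theorem exists_diracRel_iff (hA : IsSelfAdjoint A) (hBdom : ∀ x, (B x).domain = A.domain)
    (hBW : MemWInftyRel 1 A 1 B) (κ : ℂ) {u : L2 d r H} :
    (∃ v, DiracRel κ c A B u v) ↔ u ∈ (D0 c A).domain := by
  rw [mem_D0_domain]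
  constructor
  · rintro ⟨_, u', b, m, h1, h2, h3, -⟩
    exact ⟨⟨u', h1⟩, m, h3⟩
  · rintro ⟨⟨u', h1⟩, m, h3⟩
    obtain ⟨b, h2⟩ := exists_mem_mulGraph hA hBdom hBW h3
    exact ⟨_, u', b, m, h1, h2, h3, rfl⟩

theorem inner_diracRel (hA : IsSelfAdjoint A) (hBsymm : ∀ x, (B x).IsFormalAdjoint (B x))
    (hskew : ∀ i, (c i).conjTranspose = -c i) {κ : ℂ} (hκ : (starRingEnd ℂ) κ = -κ)
    {u v p q : L2 d r H} (h : DiracRel κ c A B u v) (h' : DiracRel (-κ) c A B p q) :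
    inner ℂ v p = inner ℂ u q := by
  obtain ⟨u', b, m, h1, h2, h3, rfl⟩ := h
  obtain ⟨p', b', m', h1', h2', h3', rfl⟩ := h'
  rw [inner_add_left, inner_add_left, inner_add_right, inner_add_right,
    inner_mulGraph hBsymm h2 h2', inner_mulGraph_const hA h3 h3', inner_smul_left,
    inner_smul_right, hκ, sum_inner, inner_sum]
  congr 3
  refine Finset.sum_congr rfl fun i _ => ?_
  rw [inner_matrixL2 (hskew i), inner_derivGraph (h1 i) (matrixL2_mem_derivGraph (h1' i) (c i)),
    neg_neg]

/-- The product `(-κ ∂̸ + B + M₀) (κ ∂̸ + B + M₀)` for `κ² = -1`, on a function with a `Jet`. The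
mixed terms cancel, except for the derivative `δ i = ([∂_i, B]) u` of the perturbation. -/
theorem diracRel_comp
    (hc : ∀ i j, c i * c j + c j * c i = if i = j then (-2 : ℂ) • 1 else 0)
    {κ : ℂ} (hκ : κ * κ = -1) {u : L2 d r H} (J : Jet A u) {b bm bb mb : L2 d r H}
    {b' δ : Fin d → L2 d r H} (hb : (u, b) ∈ mulGraph B) (hbm : (J.m, bm) ∈ mulGraph B)
    (hbb : (b, bb) ∈ mulGraph B) (hmb : (b, mb) ∈ mulGraph fun _ => A)
    (hb' : ∀ i, (J.d1 i, b' i) ∈ mulGraph B) (hδ : ∀ i, (b, δ i + b' i) ∈ derivGraph i) :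
    ∃ v, DiracRel κ c A B u v ∧ DiracRel (-κ) c A B v
      (-∑ i, J.d2 i i + J.mm + (bm + bb + mb - κ • ∑ i, matrixL2 (c i) (δ i))) := by
  set v := κ • ∑ i, matrixL2 (c i) (J.d1 i) + b + J.m with hv
  have hsymm : ∀ i j, J.d2 i j = J.d2 j i := fun i j =>
    derivGraph_unique (J.mem_d2 i j) (derivGraph_comm (J.mem_d1 j) (J.mem_d1 i) (J.mem_d2 j i))
  refine ⟨v, ⟨J.d1, b, J.m, J.mem_d1, hb, J.mem_m, rfl⟩,
    fun j => κ • ∑ i, matrixL2 (c i) (J.d2 i j) + (δ j + b' j) + J.n j,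
    κ • ∑ i, matrixL2 (c i) (b' i) + bb + bm, κ • ∑ i, matrixL2 (c i) (J.n i) + mb + J.mm,
    fun j => ?_, ?_, ?_, ?_⟩
  · have h1 : (∑ i, matrixL2 (c i) (J.d1 i), ∑ i, matrixL2 (c i) (J.d2 i j)) ∈ derivGraph j :=
      sum_mem_of_submodule _ fun i => matrixL2_mem_derivGraph (J.mem_d2 i j) (c i)
    exact add_mem_derivGraph (add_mem_derivGraph (smul_mem_of_submodule _ κ h1) (hδ j)) (J.mem_n j)
  · have h1 : (∑ i, matrixL2 (c i) (J.d1 i), ∑ i, matrixL2 (c i) (b' i)) ∈ mulGraph B :=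
      sum_mem_of_submodule _ fun i => matrixL2_mem_mulGraph (c i) (hb' i)
    exact add_mem_mulGraph (add_mem_mulGraph (smul_mem_of_submodule _ κ h1) hbb) hbm
  · have h1 : (∑ i, matrixL2 (c i) (J.d1 i), ∑ i, matrixL2 (c i) (J.n i)) ∈
        mulGraph fun _ => A :=
      sum_mem_of_submodule _ fun i => matrixL2_mem_mulGraph (c i) (J.mem_d1_n i)
    exact add_mem_mulGraph (add_mem_mulGraph (smul_mem_of_submodule _ κ h1) hmb) J.mem_mm
  · have h1 : ∑ j, matrixL2 (c j) (κ • ∑ i, matrixL2 (c i) (J.d2 i j) + (δ j + b' j) + J.n j) =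
        κ • -∑ i, J.d2 i i + ∑ j, matrixL2 (c j) (δ j) + ∑ j, matrixL2 (c j) (b' j) +
          ∑ j, matrixL2 (c j) (J.n j) := by
      rw [← sum_matrixL2_matrixL2 hc hsymm, Finset.smul_sum, ← Finset.sum_add_distrib,
        ← Finset.sum_add_distrib, ← Finset.sum_add_distrib]
      refine Finset.sum_congr rfl fun j _ => ?_
      rw [map_add, map_add, map_add, map_smul, ← add_assoc]
    rw [h1]
    have h2 : -κ • κ • -∑ i, J.d2 i i = -∑ i, J.d2 i i := by
      rw [smul_smul, neg_mul, hκ, neg_neg, one_smul]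
    simp only [smul_add]
    rw [h2]
    simp only [neg_smul]
    abel

/-- `H₀ + 2μ` stays surjective under a perturbation which is small relative to `M₀² + μ`. -/
theorem surjective_of_small_perturbation (hA : IsSelfAdjoint A) {μ : ℝ} (hμ : 0 < μ)
    {T : L2 d r H →ₗ.[ℂ] L2 d r H}
    (h : ∀ (u : L2 d r H) (J : Jet A u), ∃ ρ, (u, -∑ i, J.d2 i i + J.mm + ρ) ∈ T.graph ∧
      ‖ρ‖ ≤ 1 / 2 * ‖J.mm + (μ : ℂ) • u‖) (f : L2 d r H) :
    ∃ u ∈ (H0 A).domain, ∃ g, (u, g) ∈ T.graph ∧ g + ((2 * μ : ℝ) : ℂ) • u = f := by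
  obtain ⟨G, hG⟩ := exists_resolvent_jet (d := d) (r := r) hA hμ
  have hGT : ∀ k, G k ∈ T.domain := fun k => by
    obtain ⟨J, -, -⟩ := hG k
    obtain ⟨ρ, h1, -⟩ := h _ J
    exact domain_of_mem_graph h1
  obtain ⟨k, hk⟩ := exists_solution_of_near_resolvent T G ((2 * μ : ℝ) : ℂ) hGT (fun k => by
    obtain ⟨J, h2, h3⟩ := hG k
    obtain ⟨ρ, h1, h4⟩ := h _ J
    rw [apply_of_mem_graph h1]
    have e : -∑ i, J.d2 i i + J.mm + ρ + ((2 * μ : ℝ) : ℂ) • G k - k = ρ := by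
      rw [add_right_comm, h2, add_sub_cancel_left]
    rw [e]
    exact h4.trans (mul_le_mul_of_nonneg_left h3 (by norm_num))) f
  obtain ⟨J, -, -⟩ := hG k
  exact ⟨G k, domain_of_mem_graph J.mem_H0_graph, _, mem_graph_of_domain T (hGT k), hk⟩

theorem mem_HB_graph {u z : L2 d r H} : (u, z) ∈ (HB A B).graph ↔ u ∈ (H0 A).domain ∧
    ∃ (u' : Fin d → L2 d r H) (u'' : Fin d → Fin d → L2 d r H) (b m bv mv : L2 d r H),
      (∀ i, (u, u' i) ∈ derivGraph i) ∧ (∀ i j, (u' i, u'' i j) ∈ derivGraph j) ∧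
      (u, b) ∈ mulGraph B ∧ ((u, m) ∈ mulGraph fun _ => A) ∧ (b + m, bv) ∈ mulGraph B ∧
      ((b + m, mv) ∈ mulGraph fun _ => A) ∧ z = -∑ i, u'' i i + (bv + mv) := by
  rw [HB, mem_domRestrict_graph]
  simp only [mem_add_graph, mem_laplaceOp_graph, mem_opMul_graph, mem_M0_graph, mem_mulOp_graph]
  refine and_congr_right fun _ => ?_
  constructor
  · rintro ⟨_, _, ⟨u', u'', h1, h2, rfl⟩, ⟨_, ⟨b, m, h3, h4, rfl⟩, ⟨bv, mv, h5, h6, rfl⟩⟩, rfl⟩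
    exact ⟨u', u'', b, m, bv, mv, h1, h2, h3, h4, h5, h6, rfl⟩
  · rintro ⟨u', u'', b, m, bv, mv, h1, h2, h3, h4, h5, h6, rfl⟩
    exact ⟨_, _, ⟨u', u'', h1, h2, rfl⟩, ⟨_, ⟨b, m, h3, h4, rfl⟩, ⟨bv, mv, h5, h6, rfl⟩⟩, rfl⟩

theorem HB_isFormalAdjoint (hA : IsSelfAdjoint A) (hBsymm : ∀ x, (B x).IsFormalAdjoint (B x)) :
    (HB A B : L2 d r H →ₗ.[ℂ] L2 d r H).IsFormalAdjoint (HB A B) := by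
  intro x y
  obtain ⟨-, u', u'', b, m, bv, mv, h1, h2, h3, h4, h5, h6, h7⟩ :=
    mem_HB_graph.1 ((HB A B).mem_graph x)
  obtain ⟨-, p', p'', b', m', bv', mv', h1', h2', h3', h4', h5', h6', h7'⟩ :=
    mem_HB_graph.1 ((HB A B).mem_graph y)
  rw [h7, h7', inner_add_left, inner_add_right, inner_laplace h1 fun i => h2' i i,
    ← inner_conj_symm, inner_laplace h1' fun i => h2 i i, map_sum]
  simp only [inner_conj_symm]
  congr 1
  rw [inner_add_left, inner_mulGraph hBsymm h5 h3', inner_mulGraph_const hA h6 h4',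
    ← inner_add_right, inner_add_right x.1, ← inner_mulGraph hBsymm h3 h5',
    ← inner_mulGraph_const hA h4 h6', ← inner_add_left]

theorem HB_isNonneg (hA : IsSelfAdjoint A) (hBsymm : ∀ x, (B x).IsFormalAdjoint (B x)) :
    IsNonneg (HB A B : L2 d r H →ₗ.[ℂ] L2 d r H) := by
  intro x
  obtain ⟨-, u', u'', b, m, bv, mv, h1, h2, h3, h4, h5, h6, h7⟩ :=
    mem_HB_graph.1 ((HB A B).mem_graph x)
  rw [h7, inner_add_right, inner_laplace_self h1 fun i => h2 i i, inner_add_right x.1,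
    ← inner_mulGraph hBsymm h3 h5, ← inner_mulGraph_const hA h4 h6, ← inner_add_left,
    inner_self_eq_ofReal, ← Complex.ofReal_add, Complex.ofReal_re]
  positivity

/-- For suitable large `μ`, both products of Dirac operators and `H_B` differ from `H₀` by at most
half of `M₀² + μ`. -/
theorem exists_small_perturbation (hA : IsSelfAdjoint A)
    (hc : ∀ i j, c i * c j + c j * c i = if i = j then (-2 : ℂ) • 1 else 0)
    (hBdom : ∀ x, (B x).domain = A.domain) (hBW : MemWInftyRel 1 A 1 B)
    (hrho : Tendsto (rho A B)
      (comap (fun z : ℂ => Metric.infDist z {w : ℂ | w.re ≤ 0 ∧ w.im = 0}) atTop) (𝓝 0)) :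
    ∃ μ : ℝ, 0 < μ ∧ ∀ (u : L2 d r H) (J : Jet A u),
      (∀ κ : ℂ, κ * κ = -1 → ∃ v ρ, DiracRel κ c A B u v ∧
        DiracRel (-κ) c A B v (-∑ i, J.d2 i i + J.mm + ρ) ∧
          ‖ρ‖ ≤ 1 / 2 * ‖J.mm + (μ : ℂ) • u‖) ∧
      ∃ ρ, (u, -∑ i, J.d2 i i + J.mm + ρ) ∈ (HB A B).graph ∧
        ‖ρ‖ ≤ 1 / 2 * ‖J.mm + (μ : ℂ) • u‖ := by
  -- `B M₀ u`, `M₀ B u` and `B² u` add up to at most `4 ε ‖(M₀² + μ) u‖`, and the terms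
  -- `c^i [∂_i, B] u` to at most `C ε ‖(M₀² + μ) u‖`
  set C : ℝ := ∑ i, ‖(matrixL2 (c i) : L2 d r H →L[ℂ] L2 d r H)‖ with hC
  have hC0 : 0 ≤ C := by positivity
  set ε : ℝ := 1 / (2 * (C + 4)) with hε
  have hε0 : 0 < ε := by positivity
  have hε1 : ε ≤ 1 := by
    rw [hε, div_le_one (by positivity)]
    linarith
  have hεC : (C + 4) * ε = 1 / 2 := by
    rw [hε]
    field_simp
  obtain ⟨μ, hμ, h⟩ := exists_perturbation_bounds (d := d) (r := r) hA hBdom hBW hrho hε0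
  refine ⟨μ, hμ, fun u J => ?_⟩
  obtain ⟨b, bm, bb, mb, b', δ, h1, h2, h3, h4, h5, h6, n1, n2, n3, n4⟩ := h u J
  set g := J.mm + (μ : ℂ) • u
  have hbb : ‖bm + bb + mb‖ ≤ 4 * ε * ‖g‖ := by
    have h7 := (norm_add_le (bm + bb) mb).trans (add_le_add_left (norm_add_le bm bb) _)
    have h8 : ε * (2 * ε * ‖g‖) ≤ 1 * (2 * ε * ‖g‖) :=
      mul_le_mul_of_nonneg_right hε1 (by positivity)
    linarith
  refine ⟨fun κ hκ => ?_, bm + bb + mb, ?_, ?_⟩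
  · obtain ⟨v, hv1, hv2⟩ := diracRel_comp hc hκ J h1 h2 h3 h4 h5 h6
    refine ⟨v, _, hv1, hv2, ?_⟩
    have hκ1 : ‖κ‖ = 1 := by
      have := congrArg norm hκ
      rw [norm_mul, norm_neg, norm_one] at this
      nlinarith [norm_nonneg κ]
    have h9 : ‖κ • ∑ i, matrixL2 (c i) (δ i)‖ ≤ C * (ε * ‖g‖) := by
      rw [norm_smul, hκ1, one_mul, hC, Finset.sum_mul]
      exact (norm_sum_le _ _).trans (Finset.sum_le_sum fun i _ =>
        ((matrixL2 (c i)).le_opNorm _).trans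
          (mul_le_mul_of_nonneg_left (n4 i) (norm_nonneg _)))
    calc _ ≤ 4 * ε * ‖g‖ + C * (ε * ‖g‖) := (norm_sub_le _ _).trans (add_le_add hbb h9)
      _ = (C + 4) * ε * ‖g‖ := by ring
      _ = 1 / 2 * ‖g‖ := by rw [hεC]
  · exact mem_HB_graph.2 ⟨domain_of_mem_graph J.mem_H0_graph, J.d1, J.d2, b, J.m, bb + bm,
      mb + J.mm, J.mem_d1, J.mem_d2, h1, J.mem_m, add_mem_mulGraph h3 h2,
      add_mem_mulGraph h4 J.mem_mm, by abel⟩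
  · rw [← hεC]
    nlinarith [mul_nonneg (mul_nonneg hC0 hε0.le) (norm_nonneg g)]

end Dirac

end DiracSchrodinger

end

open DiracSchrodinger in
theorem mainTheorem5 {H : Type*} [NormedAddCommGroup H] [InnerProductSpace ℂ H] [CompleteSpace H]
    [TopologicalSpace.SeparableSpace H]
    (d r : ℕ) (hd : 3 ≤ d) (hodd : Odd d)
    (c : Fin d → Matrix (Fin r) (Fin r) ℂ)
    (hc : ∀ i j, c i * c j + c j * c i = if i = j then (-2 : ℂ) • 1 else 0)
    (hskew : ∀ i, (c i).conjTranspose = -c i)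
    (A₀ : H →ₗ.[ℂ] H) (hA₀ : IsSelfAdjoint A₀)
    (B : Rn d → H →ₗ.[ℂ] H)
    (hBdom : ∀ x, (B x).domain = A₀.domain)
    (hBsymm : ∀ x, (B x).IsFormalAdjoint (B x))
    (hBW : MemWInftyRel 1 A₀ 1 B)
    (hrho : Tendsto (rho A₀ B)
      (comap (fun z : ℂ => Metric.infDist z {w : ℂ | w.re ≤ 0 ∧ w.im = 0}) atTop) (𝓝 0)) :
    -- `D_B` is a well-defined closed operator on `dom D₀`
    (Dense ((DB c A₀ B : L2 d r H →ₗ.[ℂ] L2 d r H).domain : Set (L2 d r H)) ∧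
      (DB c A₀ B : L2 d r H →ₗ.[ℂ] L2 d r H).domain = (D0 c A₀).domain ∧
      (DB c A₀ B : L2 d r H →ₗ.[ℂ] L2 d r H).IsClosed) ∧
    -- its adjoint is `-i ∂̸ + B + M₀` on `dom D₀`
    ((DB c A₀ B : L2 d r H →ₗ.[ℂ] L2 d r H)† = DBminus c A₀ B ∧
      (DB c A₀ B : L2 d r H →ₗ.[ℂ] L2 d r H)†.domain = (D0 c A₀).domain) ∧
    -- `D_B D_B*`, `D_B* D_B` and `H_B` are non-negative and self-adjoint on `dom H₀`
    ∀ T ∈ ({opMul (DB c A₀ B) (DB c A₀ B)†, opMul (DB c A₀ B)† (DB c A₀ B), HB A₀ B} :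
        Set (L2 d r H →ₗ.[ℂ] L2 d r H)),
      T.domain = (H0 A₀).domain ∧ IsSelfAdjoint T ∧ IsNonneg T := by
  obtain ⟨μ, hμ, hsmall⟩ :=
    exists_small_perturbation (d := d) (r := r) (c := c) (B := B) hA₀ hc hBdom hBW hrho
  have hν : 0 < 2 * μ := by positivity
  -- the products of the two Dirac operators, in both orders
  have hprod : ∀ {κ : ℂ} {P Q : L2 d r H →ₗ.[ℂ] L2 d r H}, κ * κ = -1 →
      (∀ {u v}, (u, v) ∈ P.graph ↔ DiracRel κ c A₀ B u v) →
      (∀ {u v}, (u, v) ∈ Q.graph ↔ DiracRel (-κ) c A₀ B u v) →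
      (H0 A₀).domain ≤ (opMul Q P).domain ∧ ∀ f, ∃ u ∈ (H0 A₀).domain, ∃ g,
        (u, g) ∈ (opMul Q P).graph ∧ g + ((2 * μ : ℝ) : ℂ) • u = f := by
    intro κ P Q hκ hP hQ
    have h : ∀ (u : L2 d r H) (J : Jet A₀ u), ∃ ρ,
        (u, -∑ i, J.d2 i i + J.mm + ρ) ∈ (opMul Q P).graph ∧
          ‖ρ‖ ≤ 1 / 2 * ‖J.mm + (μ : ℂ) • u‖ := fun u J => by
      obtain ⟨v, ρ, h1, h2, h3⟩ := (hsmall u J).1 κ hκ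
      exact ⟨ρ, mem_opMul_graph.2 ⟨v, hP.2 h1, hQ.2 h2⟩, h3⟩
    refine ⟨fun u hu => ?_, surjective_of_small_perturbation hA₀ hμ h⟩
    obtain ⟨J⟩ := exists_jet_of_mem_H0_domain hA₀ hu
    obtain ⟨ρ, h1, -⟩ := h u J
    exact domain_of_mem_graph h1
  have hmem : ∀ {u v : L2 d r H}, (u, v) ∈ (DB c A₀ B).graph ↔
      DiracRel (-(-Complex.I)) c A₀ B u v := by
    intro u v
    rw [neg_neg]
    exact mem_DB_graph
  obtain ⟨d1, s1⟩ := hprod Complex.I_mul_I mem_DB_graph mem_DBminus_graph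
  obtain ⟨d2, s2⟩ := hprod (by rw [neg_mul_neg, Complex.I_mul_I]) mem_DBminus_graph hmem
  have hadj : (DB c A₀ B : L2 d r H →ₗ.[ℂ] L2 d r H).IsFormalAdjoint (DBminus c A₀ B) :=
    fun x y => inner_diracRel hA₀ hBsymm hskew Complex.conj_I
      (mem_DB_graph.1 ((DB c A₀ B).mem_graph x)) (mem_DBminus_graph.1 ((DBminus c A₀ B).mem_graph y))
  obtain ⟨e1, e2, e3⟩ := opMul_isSelfAdjoint_of_surj hadj d1 hν s1
  obtain ⟨f1, f2, f3⟩ := opMul_isSelfAdjoint_of_surj hadj.symm d2 hν s2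
  have hdense : Dense ((DB c A₀ B : L2 d r H →ₗ.[ℂ] L2 d r H).domain : Set (L2 d r H)) :=
    e2.dense_domain.mono fun u hu => by
      obtain ⟨z, hz⟩ := LinearPMap.mem_domain_iff.1 hu
      obtain ⟨v, hv, -⟩ := mem_opMul_graph.1 hz
      exact domain_of_mem_graph hv
  have hdense' : Dense ((DBminus c A₀ B : L2 d r H →ₗ.[ℂ] L2 d r H).domain : Set (L2 d r H)) :=
    f2.dense_domain.mono fun u hu => by
      obtain ⟨z, hz⟩ := LinearPMap.mem_domain_iff.1 hu
      obtain ⟨v, hv, -⟩ := mem_opMul_graph.1 hz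
      exact domain_of_mem_graph hv
  have t1 : ∀ f, ∃ u g, (u, g) ∈ (opMul (DBminus c A₀ B) (DB c A₀ B)).graph ∧
      g + ((2 * μ : ℝ) : ℂ) • u = f := fun f => by
    obtain ⟨u, -, h⟩ := s1 f
    exact ⟨u, h⟩
  have t2 : ∀ f, ∃ u g, (u, g) ∈ (opMul (DB c A₀ B) (DBminus c A₀ B)).graph ∧
      g + ((2 * μ : ℝ) : ℂ) • u = f := fun f => by
    obtain ⟨u, -, h⟩ := s2 f
    exact ⟨u, h⟩
  have hstar := adjoint_eq_of_surj hadj hdense t1 t2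
  have hstar' := adjoint_eq_of_surj hadj.symm hdense' t2 t1
  have hclosed : (DB c A₀ B : L2 d r H →ₗ.[ℂ] L2 d r H).IsClosed := by
    rw [← hstar']
    exact LinearPMap.adjoint_isClosed hdense'
  have hdom : (DB c A₀ B : L2 d r H →ₗ.[ℂ] L2 d r H).domain = (D0 c A₀).domain := by
    ext u
    rw [LinearPMap.mem_domain_iff, ← exists_diracRel_iff hA₀ hBdom hBW Complex.I]
    exact exists_congr fun v => mem_DB_graph
  have hdom' : (DBminus c A₀ B : L2 d r H →ₗ.[ℂ] L2 d r H).domain = (D0 c A₀).domain := by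
    ext u
    rw [LinearPMap.mem_domain_iff, ← exists_diracRel_iff hA₀ hBdom hBW (-Complex.I)]
    exact exists_congr fun v => mem_DBminus_graph
  have hHB : (HB A₀ B : L2 d r H →ₗ.[ℂ] L2 d r H).domain = (H0 A₀).domain := by
    ext u
    refine ⟨fun hu => ?_, fun hu => ?_⟩
    · exact (mem_HB_graph.1 (mem_graph_of_domain _ hu)).1
    · obtain ⟨J⟩ := exists_jet_of_mem_H0_domain hA₀ hu
      obtain ⟨ρ, h1, -⟩ := (hsmall u J).2
      exact domain_of_mem_graph h1
  have hHBs : IsSelfAdjoint (HB A₀ B : L2 d r H →ₗ.[ℂ] L2 d r H) :=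
    isSelfAdjoint_of_symm_of_surj _ (HB_isFormalAdjoint hA₀ hBsymm) (2 * μ) fun f => by
      obtain ⟨u, -, h⟩ := surjective_of_small_perturbation hA₀ hμ (fun u J => (hsmall u J).2) f
      exact ⟨u, h⟩
  refine ⟨⟨hdense, hdom, hclosed⟩, ⟨hstar, by rw [hstar, hdom']⟩, fun T hT => ?_⟩
  rw [hstar] at hT
  rcases hT with rfl | rfl | rfl
  · exact ⟨f1, f2, f3⟩
  · exact ⟨e1, e2, e3⟩
  · exact ⟨hHB, hHBs, HB_isNonneg hA₀ hBsymm⟩
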